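/- **Notation and definitions.** For random arrays $x_1,\ldots,x_k\in\mathbb{R}^n$ (one for each $n$) and a random vector $(X_1,\ldots,X_k)$, write $(x_1,\ldots,x_k)\overset{W}{\to}(X_1,\ldots,X_k)$ if for every $p\ge 1$ and every continuous $f:\mathbb{R}^k\to\mathbb{R}$ with $|f(z)|\le C(1+\|z\|_2^p)$ for some $C>0$, $\frac1n\sum_{i=1}^n f(x_1[i],\ldots,x_k[i])\to\mathbb{E}f(X_1,\ldots,X_k)$ as $n\to\infty$. A *diagonal tensor network* $T=(\mathcal{V},\mathcal{E},\{q_v\})$ in $k$ variables is a finite undirected tree with vertex set $\mathcal V$ and edge set $\mathcal E$ whose vertices $v$ are labelled by real polynomials $q_v$ in $k$ variables. Its value on a symmetric matrix $W\in\mathbb{R}^{n\times n}$ and vectors $x_1,\ldots,x_k\in\mathbb{R}^n$ is $$\operatorname{val}_T(W;x_1,\ldots,x_k)=\frac1n\sum_{\mathbf i\in[n]^{\mathcal V}}\ \prod_{v\in\mathcal V}q_v(x_1[i_v],\ldots,x_k[i_v])\prod_{\{u,v\}\in\mathcal E}W[i_u,i_v].$$ A *uniformly random signed permutation* is $\Pi=P\Xi$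 with $P$ a uniformly random $n\times n$ permutation matrix and $\Xi$ an independent diagonal matrix of i.i.d. uniform $\pm1$ entries. A sequence of random matrices $W=ODO^\top\in\mathbb{R}^{n\times n}$ is a *symmetric generalized invariant matrix* with limit spectral distribution $D$ if (a) $\mathbf D=\operatorname{diag}(\mathbf d)$ (the middle factor) satisfies $\mathbf d\overset{W}{\to}D$ almost surely, where the law of $D$ has compact support and $\operatorname{Var}[D]>0$; (b) $O=\Pi_VH\Pi_E$, where $H$ is a (deterministic or random) orthogonal matrix and $\Pi_V,\Pi_E$ are uniformly random signed permutations, independent of each other and of $(\mathbf D,H)$; (c) for every $\varepsilon>0$, almost surely for all large $n$, $\max_{i,j}|O[i,j]|=\max_{i,j}|H[i,j]|<n^{-1/2+\varepsilon}$. A sequence $G=ODO^\top$ is an *orthogonally invariant matrix* with limit spectral distribution $D$ if (a) holds and $O$ is Haar-distributed on the orthogonal group and independent of $\mathbf D$. **Lemma 2.7.** Let $T$ be a diagonal tensor network in $k$ variables. There is a deterministic value $\operatorname{lim-val}_T(X_1,\ldots,X_k,D)\in\mathbb{R}$, depending only on $T$, the joint law of $(X_1,\ldots,X_k)$ and the law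 of $D$, such that the following holds whenever $(X_1,\ldots,X_k)$ has finite moments of all orders. Let $x_1,\ldots,x_k\in\mathbb{R}^n$ be (random or deterministic) vectors with $(x_1,\ldots,x_k)\overset{W}{\to}(X_1,\ldots,X_k)$ almost surely as $n\to\infty$, and let $W\in\mathbb{R}^{n\times n}$ be a symmetric generalized invariant matrix with limit spectral distribution $D$ which, for every $n$, is independent of $(x_1,\ldots,x_k)$. Then almost surely $$\lim_{n\to\infty}\operatorname{val}_T(W;x_1,\ldots,x_k)=\operatorname{lim-val}_T(X_1,\ldots,X_k,D).$$ The same almost sure convergence, to the same limit value, holds with $W$ replaced by any orthogonally invariant matrix $G$ with limit spectral distribution $D$ which, for every $n$, is independent of $(x_1,\ldots,x_k)$. -/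

import Mathlib

open MeasureTheory ProbabilityTheory Filter Topology

/-- Matrices carry the product (equivalently, Borel) `σ`-algebra. -/
instance instMeasurableSpaceRealMatrix {m n : ℕ} :
    MeasurableSpace (Matrix (Fin m) (Fin n) ℝ) :=
  inferInstanceAs (MeasurableSpace (Fin m → Fin n → ℝ))

/-- Convergence `y →^W μ`: the empirical distribution of the entries `y n 0, …, y n (n-1)` converges
to `μ` in every Wasserstein-`p` distance, `p ≥ 1`. This means that the empirical averages of every
continuous function of polynomial growth converge to its integral against `μ`. For `k` vectors
`x₁, …, x_k ∈ ℝⁿ` one takes `E = EuclideanSpace ℝ (Fin k)`, and `y n i` is the `i`-th row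
`(x₁[i], …, x_k[i])`. -/
def TendstoW {E : Type*} [NormedAddCommGroup E] [MeasurableSpace E]
    (y : (n : ℕ) → Fin n → E) (μ : Measure E) : Prop :=
  ∀ p : ℕ, 1 ≤ p → ∀ f : E → ℝ, Continuous f →
    (∃ C : ℝ, 0 < C ∧ ∀ z, |f z| ≤ C * (1 + ‖z‖ ^ p)) →
    Tendsto (fun n : ℕ => (1 / (n : ℝ)) * ∑ i : Fin n, f (y n i)) atTop (𝓝 (∫ z, f z ∂μ))

/-- All moments of the law `μ` are finite. -/
def FiniteMoments {E : Type*} [NormedAddCommGroup E] [MeasurableSpace E] (μ : Measure E) : Prop :=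
  ∀ p : ℕ, Integrable (fun z => ‖z‖ ^ p) μ

/-- A diagonal tensor network in `k` variables with vertex set `V`: an undirected tree on `V`
whose vertices are labelled by polynomials in `k` variables. -/
structure DiagonalTensorNetwork (V : Type*) (k : ℕ) where
  /-- the underlying undirected graph -/
  graph : SimpleGraph V
  /-- the underlying graph is a tree -/
  isTree : graph.IsTree
  /-- the polynomial labels of the vertices -/
  q : V → MvPolynomial (Fin k) ℝ

open Classical in
/-- The value of a diagonal tensor network on a symmetric matrix `W` and on the vectors
`x₁, …, x_k ∈ ℝⁿ` with `x_j[i] = x i j`. The factor of an edge `e = {u, v}` is `W[i_u, i_v]`, where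
`(u, v) = e.out` is an ordering of the two endpoints; the ordering is immaterial as `W` is
symmetric. -/
noncomputable def DiagonalTensorNetwork.val {V : Type*} [Fintype V] {k n : ℕ}
    (T : DiagonalTensorNetwork V k) (W : Matrix (Fin n) (Fin n) ℝ)
    (x : Fin n → EuclideanSpace ℝ (Fin k)) : ℝ :=
  (1 / (n : ℝ)) * ∑ i : V → Fin n,
    (∏ v : V, MvPolynomial.eval (fun j => x (i v) j) (T.q v)) *
      ∏ e ∈ T.graph.edgeFinset, W (i e.out.1) (i e.out.2)

/-- The signed permutation matrix `P Ξ`, with `P` the permutation matrix of `σ` and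
`Ξ = diag(ξ)`, `ξ[i] ∈ {+1, -1}`. -/
def signedPermMatrix {n : ℕ} (σ : Equiv.Perm (Fin n)) (ξ : Fin n → ℤˣ) :
    Matrix (Fin n) (Fin n) ℝ :=
  σ.permMatrix ℝ * Matrix.diagonal (fun i => ((ξ i : ℤ) : ℝ))

/-- `Π` is a uniformly random signed permutation: it has the law of `P Ξ` for a uniformly
random permutation and independent uniform signs, all independent. -/
def IsUniformSignedPerm {Ω : Type*} [MeasurableSpace Ω] (P : Measure Ω) {n : ℕ}
    (Pi : Ω → Matrix (Fin n) (Fin n) ℝ) : Prop :=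
  Measurable Pi ∧
    P.map Pi = ((PMF.uniformOfFintype (Equiv.Perm (Fin n) × (Fin n → ℤˣ))).map
      (fun s => signedPermMatrix s.1 s.2)).toMeasure

/-- The eigenvalue condition: the random vectors `d n ∈ ℝⁿ` satisfy `d →^W ν` almost surely, and
the law `ν` has compact support and positive variance. -/
structure HasLimitSpectrum {Ω : Type*} [MeasurableSpace Ω] (P : Measure Ω) (ν : Measure ℝ)
    (d : (n : ℕ) → Ω → Fin n → ℝ) : Prop where
  measurable : ∀ n, Measurable (d n)
  tendstoW : ∀ᵐ ω ∂P, TendstoW (fun n => d n ω) ν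
  compactSupport : ∃ K : Set ℝ, IsCompact K ∧ ν Kᶜ = 0
  variance_pos : 0 < variance id ν

/-- The sequence `W n` of random matrices is a symmetric generalized invariant matrix with limit
spectral distribution `ν`: `W = O D Oᵀ` with `D = diag(d)` and `O = Π_V H Π_E`. -/
def IsSymmGeneralizedInvariant {Ω : Type*} [MeasurableSpace Ω] (P : Measure Ω) (ν : Measure ℝ)
    (W : (n : ℕ) → Ω → Matrix (Fin n) (Fin n) ℝ) : Prop :=
  ∃ (d : (n : ℕ) → Ω → Fin n → ℝ) (O H PiV PiE : (n : ℕ) → Ω → Matrix (Fin n) (Fin n) ℝ),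
    (∀ n ω, W n ω = O n ω * Matrix.diagonal (d n ω) * (O n ω).transpose) ∧
    -- (a) the eigenvalues
    HasLimitSpectrum P ν d ∧
    -- (b) the eigenvectors
    (∀ n ω, O n ω = PiV n ω * H n ω * PiE n ω) ∧
    (∀ n, Measurable (H n)) ∧
    (∀ n ω, H n ω ∈ Matrix.orthogonalGroup (Fin n) ℝ) ∧
    (∀ n, IsUniformSignedPerm P (PiV n)) ∧
    (∀ n, IsUniformSignedPerm P (PiE n)) ∧
    (∀ n, IndepFun (PiV n) (PiE n) P) ∧
    (∀ n, IndepFun (fun ω => (PiV n ω, PiE n ω)) (fun ω => (d n ω, H n ω)) P) ∧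
    -- (c) delocalization
    (∀ ε : ℝ, 0 < ε → ∀ᵐ ω ∂P, ∀ᶠ n : ℕ in atTop,
      ∀ i j : Fin n, |H n ω i j| < (n : ℝ) ^ (-1 / 2 + ε))

/-- The sequence `G n` of random matrices is an orthogonally invariant matrix with limit spectral
distribution `ν`: `G = O D Oᵀ` with `D = diag(d)`, and `O` Haar-distributed on the orthogonal group
and independent of `D`. -/
def IsOrthogonallyInvariant {Ω : Type*} [MeasurableSpace Ω] (P : Measure Ω) (ν : Measure ℝ)
    (G : (n : ℕ) → Ω → Matrix (Fin n) (Fin n) ℝ) : Prop :=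
  ∃ (d : (n : ℕ) → Ω → Fin n → ℝ) (O : (n : ℕ) → Ω → Matrix.orthogonalGroup (Fin n) ℝ),
    (∀ n ω, G n ω = (O n ω : Matrix (Fin n) (Fin n) ℝ) * Matrix.diagonal (d n ω) *
      (O n ω : Matrix (Fin n) (Fin n) ℝ).transpose) ∧
    HasLimitSpectrum P ν d ∧
    (∀ n, Measurable (O n)) ∧
    (∀ n, (P.map (O n)).IsHaarMeasure) ∧
    (∀ n, IndepFun (O n) (d n) P)

-- Expand every factor as W[i_u, i_v] = Σ_j O[i_u, j] d_j O[i_v, j] with O = Π_V H Π_E. The value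
-- becomes 1/n times a labelled contraction of `H` along a bipartite multigraph: one side consists
-- of the vertices of the tree, labelled by the polynomials, the other side of the edges of the
-- tree, labelled by `d`, and every half-edge is an edge of the multigraph. The signed permutations
-- permute the labels and put signs at the ends of the half-edges. For fixed `H`, `x` and `d`,
-- concentration is proved for the average over the pair of signed permutations alone.
--
-- Split the index assignments by their coincidences (`fullSum_eq_sum_injSum`) and write each label
-- as its mean plus a centred part. If all labels are constant and all degrees are even, the
-- randomness disappears and a contraction of `H` over distinct indices remains. To evaluate it, sum
-- over the index at a vertex of degree two: since H Hᵀ = 1, this deletes the vertex and merges its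
-- neighbours. Once no such vertex is left, either there are no edges, or all nonzero degrees are at
-- least 4 and delocalization makes the contraction negligible (`exists_contraction_limit`).
-- Inclusion–exclusion over partitions passes from free to distinct indices
-- (`exists_kernelSum_limit`). The constants obtained depend only on the multigraph.
--
-- The terms with a centred label or an odd degree are fluctuations. Their K-th moment is a
-- contraction over K copies of the multigraph with some indices identified. If I copies share no
-- index with another copy on the fluctuating side, the average over signed permutations gains
-- n^(-I/2) (`abs_sum_perm_prod_le`), while the glued multigraph has at most (K + I)/2 components.
-- The moment is therefore of order n^(K/2) (`exists_moment_bound`), against n^K for the main term.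
--
-- With K = 12, Markov's inequality shows that all but a fraction n^(-4) of the pairs of signed
-- permutations give a value close to a continuous function of the empirical moments of the labels
-- (`exists_card_bad_le`). A Borel–Cantelli argument which uses only the independence of `W` and `x`
-- gives almost sure convergence. For a Haar matrix, bi-invariance allows signed permutations to be
-- inserted on both sides for free, and exponential moments of the entries give delocalization, so
-- both models are instances of `IsConjMixture`.

universe u

set_option linter.unusedSectionVars false

/-! ### Contractions of an orthogonal matrix along a bipartite multigraph -/

section Contraction

open scoped Classical

variable {A B F : Type u} [Fintype A] [Fintype B] [Fintype F] {n : ℕ}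

/-- A bipartite multigraph with edge set `F` has vertices `A` and `B`, and the edge `f` joins `a f`
to `b f`. This is the product of the entries of `H` selected by an assignment of indices. -/
noncomputable def edgeProd (H : Matrix (Fin n) (Fin n) ℝ) (a : F → A) (b : F → B)
    (i : A → Fin n) (j : B → Fin n) : ℝ :=
  ∏ f, H (i (a f)) (j (b f))

/-- All vertices have even degree. -/
def EvenIncidence (a : F → A) : Prop := ∀ s : A → ℤˣ, ∏ f, s (a f) = 1

/-- The bipartite multigraph has at most `c` connected components. -/
def ComponentsLE (a : F → A) (b : F → B) (c : ℕ) : Prop :=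
  ∀ (X : Type u) (p : A → X) (q : B → X), (∀ f, p (a f) = q (b f)) →
    (Set.range p ∪ Set.range q).ncard ≤ c

theorem ComponentsLE.swap {a : F → A} {b : F → B} {c : ℕ} (h : ComponentsLE a b c) :
    ComponentsLE b a c := by
  intro X p q hpq
  rw [Set.union_comm]
  exact h X q p fun f => (hpq f).symm

theorem edgeProd_transpose (H : Matrix (Fin n) (Fin n) ℝ) (a : F → A) (b : F → B)
    (i : A → Fin n) (j : B → Fin n) :
    edgeProd H.transpose b a j i = edgeProd H a b i j := rfl

theorem sum_edgeProd_transpose (H : Matrix (Fin n) (Fin n) ℝ) (a : F → A) (b : F → B) :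
    ∑ j : B → Fin n, ∑ i : A → Fin n, edgeProd H.transpose b a j i =
      ∑ i : A → Fin n, ∑ j : B → Fin n, edgeProd H a b i j :=
  Finset.sum_comm

/-- The relation identifying the two neighbours of a vertex of degree two. -/
def joinRel (x y : A) : A → A → Prop := fun u v => u = x ∧ v = y

noncomputable instance (x y : A) : Fintype (Quot (joinRel x y)) :=
  Fintype.ofSurjective (Quot.mk _) Quot.mk_surjective

/-- Functions on the quotient are functions which agree at the two points. -/
def joinEquiv (x y : A) (β : Type*) :
    {i : A → β // i x = i y} ≃ (Quot (joinRel x y) → β) where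
  toFun i := Quot.lift i.1 (by rintro u v ⟨rfl, rfl⟩; exact i.2)
  invFun k := ⟨fun v => k (Quot.mk _ v), congrArg k (Quot.sound ⟨rfl, rfl⟩)⟩
  left_inv i := rfl
  right_inv k := by
    funext v
    induction v using Quot.ind
    rfl

/-- The sum over the index at the degree-two vertex `b₀` is an entry of H Hᵀ = 1, so it forces the
indices at the two neighbours to agree. If the neighbours already coincide, the entry is 1 and the
quotient merges nothing. -/
theorem sum_edgeProd_contract (H : Matrix (Fin n) (Fin n) ℝ)
    (hH : H * H.transpose = 1) (a : F → A) (b : F → B)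
    {f₁ f₂ : F} (hne : f₁ ≠ f₂) {b₀ : B} (h₁ : b f₁ = b₀) (h₂ : b f₂ = b₀)
    (hf : ∀ f, b f = b₀ → f = f₁ ∨ f = f₂) :
    ∑ i : A → Fin n, ∑ j : B → Fin n, edgeProd H a b i j =
      ∑ i : Quot (joinRel (a f₁) (a f₂)) → Fin n, ∑ j : {v // v ≠ b₀} → Fin n,
        edgeProd H (fun f : {f // b f ≠ b₀} => Quot.mk _ (a f.1))
          (fun f : {f // b f ≠ b₀} => (⟨b f.1, f.2⟩ : {v // v ≠ b₀})) i j := by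
  have key : ∀ i : A → Fin n, ∑ j : B → Fin n, edgeProd H a b i j =
      if i (a f₁) = i (a f₂) then ∑ j : {v // v ≠ b₀} → Fin n,
        edgeProd H (fun f : {f // b f ≠ b₀} => a f.1)
          (fun f : {f // b f ≠ b₀} => (⟨b f.1, f.2⟩ : {v // v ≠ b₀})) i j else 0 := by
    intro i
    have hsplit : ∀ j : B → Fin n, edgeProd H a b i j =
        (H (i (a f₁)) (j b₀) * H (i (a f₂)) (j b₀)) *
          ∏ f : {f // b f ≠ b₀}, H (i (a f.1)) (j (b f.1)) := by
      intro j
      unfold edgeProd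
      rw [← Fintype.prod_subtype_mul_prod_subtype (fun f => b f = b₀)]
      congr 1
      have : ∏ f : {f // b f = b₀}, H (i (a f.1)) (j (b f.1)) =
          ∏ f ∈ ({f₁, f₂} : Finset F), H (i (a f)) (j (b f)) := by
        refine (Finset.prod_subtype (p := fun f => b f = b₀) ({f₁, f₂} : Finset F) ?_
          (fun f => H (i (a f)) (j (b f)))).symm
        intro f
        simp only [Finset.mem_insert, Finset.mem_singleton]
        constructor
        · rintro (rfl | rfl) <;> assumption
        · exact hf f
      rw [this, Finset.prod_pair hne, h₁, h₂]
    simp_rw [hsplit]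
    rw [← (Equiv.funSplitAt b₀ (Fin n)).symm.sum_comp, Fintype.sum_prod_type, Finset.sum_comm]
    have : ∀ (x : Fin n) (j : {v // v ≠ b₀} → Fin n),
        (H (i (a f₁)) ((Equiv.funSplitAt b₀ (Fin n)).symm (x, j) b₀) *
          H (i (a f₂)) ((Equiv.funSplitAt b₀ (Fin n)).symm (x, j) b₀)) *
          ∏ f : {f // b f ≠ b₀}, H (i (a f.1))
            ((Equiv.funSplitAt b₀ (Fin n)).symm (x, j) (b f.1)) =
        (H (i (a f₁)) x * H (i (a f₂)) x) *
          edgeProd H (fun f : {f // b f ≠ b₀} => a f.1)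
          (fun f : {f // b f ≠ b₀} => (⟨b f.1, f.2⟩ : {v // v ≠ b₀})) i j := by
      intro x j
      congr 1
      · simp [Equiv.funSplitAt, Equiv.piSplitAt]
      · refine Finset.prod_congr rfl fun f _ => ?_
        simp [Equiv.funSplitAt, Equiv.piSplitAt, f.2]
    simp_rw [this, ← Finset.sum_mul]
    have horth : ∑ x, H (i (a f₁)) x * H (i (a f₂)) x =
        if i (a f₁) = i (a f₂) then 1 else 0 := by
      have := congrFun (congrFun hH (i (a f₁))) (i (a f₂))
      rw [Matrix.mul_apply, Matrix.one_apply] at this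
      simpa using this
    rw [horth]
    split_ifs <;> simp
  simp_rw [key]
  rw [← Finset.sum_filter, ← (joinEquiv (a f₁) (a f₂) (Fin n)).sum_comp]
  rw [Finset.sum_subtype (p := fun i : A → Fin n => i (a f₁) = i (a f₂)) _ (by simp)]
  rfl

/-- The two deleted edges end at the same merged vertex, so together they contribute the square of a
sign. -/
theorem EvenIncidence.contract_left {a : F → A} (b : F → B)
    (ha : EvenIncidence a) {f₁ f₂ : F} (hne : f₁ ≠ f₂) {b₀ : B} (h₁ : b f₁ = b₀) (h₂ : b f₂ = b₀)
    (hf : ∀ f, b f = b₀ → f = f₁ ∨ f = f₂) :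
    EvenIncidence (fun f : {f // b f ≠ b₀} =>
      (Quot.mk _ (a f.1) : Quot (joinRel (a f₁) (a f₂)))) := by
  intro s
  have := ha (fun v => s (Quot.mk _ v))
  rw [← Fintype.prod_subtype_mul_prod_subtype (fun f => b f = b₀)] at this
  have h2 : ∏ f : {f // b f = b₀}, s (Quot.mk (joinRel (a f₁) (a f₂)) (a f.1)) =
      ∏ f ∈ ({f₁, f₂} : Finset F), s (Quot.mk (joinRel (a f₁) (a f₂)) (a f)) := by
    refine (Finset.prod_subtype (p := fun f => b f = b₀) ({f₁, f₂} : Finset F) ?_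
      (fun f => s (Quot.mk (joinRel (a f₁) (a f₂)) (a f)))).symm
    intro f
    simp only [Finset.mem_insert, Finset.mem_singleton]
    constructor
    · rintro (rfl | rfl) <;> assumption
    · exact hf f
  have h3 : (Quot.mk (joinRel (a f₁) (a f₂)) (a f₁)) = Quot.mk _ (a f₂) := Quot.sound ⟨rfl, rfl⟩
  rw [h2, Finset.prod_pair hne, h3, Int.units_mul_self, one_mul] at this
  exact this

theorem EvenIncidence.contract_right {b : F → B} (hb : EvenIncidence b) (b₀ : B) :
    EvenIncidence (fun f : {f // b f ≠ b₀} => (⟨b f.1, f.2⟩ : {v // v ≠ b₀})) := by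
  intro s
  have := hb (fun v => if h : v ≠ b₀ then s ⟨v, h⟩ else 1)
  rw [← Fintype.prod_subtype_mul_prod_subtype (fun f => b f = b₀)] at this
  rw [Finset.prod_eq_one (fun f _ => by simp [f.2]), one_mul] at this
  rw [← this]
  refine Finset.prod_congr rfl fun f _ => ?_
  simp [f.2]

/-- A labelling of the contracted multigraph extends to the original one by giving `b₀` the value of
the merged neighbour, and no value is lost. -/
theorem ComponentsLE.contract {a : F → A} {b : F → B} {c : ℕ} (h : ComponentsLE a b c)
    {f₁ f₂ : F} {b₀ : B} (hf : ∀ f, b f = b₀ → f = f₁ ∨ f = f₂) :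
    ComponentsLE (fun f : {f // b f ≠ b₀} =>
      (Quot.mk _ (a f.1) : Quot (joinRel (a f₁) (a f₂))))
      (fun f : {f // b f ≠ b₀} => (⟨b f.1, f.2⟩ : {v // v ≠ b₀})) c := by
  intro X p q hpq
  have h3 : (Quot.mk (joinRel (a f₁) (a f₂)) (a f₁)) = Quot.mk _ (a f₂) := Quot.sound ⟨rfl, rfl⟩
  refine le_trans (Set.ncard_le_ncard ?_ (Set.toFinite _))
    (h X (fun v => p (Quot.mk _ v))
      (fun v => if hv : v ≠ b₀ then q ⟨v, hv⟩ else p (Quot.mk _ (a f₁))) ?_)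
  · rintro x (⟨v, rfl⟩ | ⟨v, rfl⟩)
    · induction v using Quot.ind with | _ v => exact Or.inl ⟨v, rfl⟩
    · exact Or.inr ⟨v.1, by simp [v.2]⟩
  · intro f
    by_cases hv : b f = b₀
    · rcases hf f hv with rfl | rfl
      · simp [hv]
      · simp [hv, h3]
    · simp [hv, ← hpq ⟨f, hv⟩]

/-- The vertices of a side which meet no edge. -/
noncomputable def isolatedVertices (a : F → A) : Finset A :=
  Finset.univ.filter fun v => ∀ f, a f ≠ v

/-- An even degree different from 0 and 2 is at least 4; sum the degrees over the side. -/
theorem card_side_le {a : F → A} (ha : EvenIncidence a)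
    (h2 : ∀ v, (Finset.univ.filter fun f => a f = v).card ≠ 2) :
    4 * Fintype.card A ≤ Fintype.card F + 4 * (isolatedVertices a).card := by
  have heven : ∀ v, Even (Finset.univ.filter fun f => a f = v).card := by
    intro v
    -- Flipping the sign at `v` alone turns the product over the edges into (-1) to the degree of
    -- `v`.
    have := ha (fun w => if w = v then -1 else 1)
    rw [← Finset.prod_filter_mul_prod_filter_not _ (fun f => a f = v),
      Finset.prod_congr rfl (g := fun _ => (-1 : ℤˣ)) (fun f hf => by
        simp only [Finset.mem_filter] at hf; simp [hf.2]),
      Finset.prod_eq_one (s := Finset.univ.filter fun f => ¬ a f = v) (fun f hf => by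
        simp only [Finset.mem_filter] at hf; simp [hf.2]),
      mul_one, Finset.prod_const] at this
    by_contra hodd
    rw [Nat.not_even_iff_odd] at hodd
    rw [hodd.neg_one_pow] at this
    exact absurd this (by decide)
  have hsum : Fintype.card F = ∑ v, (Finset.univ.filter fun f => a f = v).card := by
    rw [← Finset.card_univ]
    exact Finset.card_eq_sum_card_fiberwise (fun _ _ => Finset.mem_univ _)
  have hiso : (isolatedVertices a).card = ∑ v, if (∀ f, a f ≠ v) then 1 else 0 := by
    rw [isolatedVertices, Finset.card_filter]
  rw [hsum, hiso, Finset.mul_sum, ← Finset.sum_add_distrib, ← Finset.card_univ,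
    Finset.card_eq_sum_ones, Finset.mul_sum]
  refine Finset.sum_le_sum fun v _ => ?_
  split_ifs with hv
  · omega
  · push Not at hv
    obtain ⟨f, hf⟩ := hv
    have hpos : 0 < (Finset.univ.filter fun f => a f = v).card :=
      Finset.card_pos.mpr ⟨f, by simp [hf]⟩
    obtain ⟨k, hk⟩ := heven v
    have := h2 v
    omega

/-- Each isolated vertex is a component of its own, and the edges make up at least one more. In the
test labelling, `none` is the common value of all vertices that meet an edge. -/
theorem ComponentsLE.card_isolated_lt {a : F → A} {b : F → B} {c : ℕ} (h : ComponentsLE a b c)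
    (hF : Nonempty F) :
    (isolatedVertices a).card + (isolatedVertices b).card + 1 ≤ c := by
  refine le_trans ?_ (h (Option (A ⊕ B))
    (fun v => if v ∈ isolatedVertices a then some (Sum.inl v) else none)
    (fun v => if v ∈ isolatedVertices b then some (Sum.inr v) else none) ?_)
  · have : (isolatedVertices a).card + (isolatedVertices b).card + 1 =
        ((Finset.disjSum (isolatedVertices a) (isolatedVertices b)).insertNone).card := by
      rw [Finset.card_insertNone, Finset.card_disjSum]
    rw [this, ← Set.ncard_coe_finset]
    refine Set.ncard_le_ncard ?_ (Set.toFinite _)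
    intro x hx
    obtain ⟨f⟩ := hF
    rcases x with _ | (v | v)
    · exact Or.inl ⟨a f, by simp [isolatedVertices]⟩
    · have : v ∈ isolatedVertices a := by simpa using hx
      exact Or.inl ⟨v, by simp [this]⟩
    · have : v ∈ isolatedVertices b := by simpa using hx
      exact Or.inr ⟨v, by simp [this]⟩
  · intro f
    have h1 : a f ∉ isolatedVertices a := by simp [isolatedVertices]
    have h2 : b f ∉ isolatedVertices b := by simp [isolatedVertices]
    rw [if_neg h1, if_neg h2]

theorem abs_edgeProd_le (H : Matrix (Fin n) (Fin n) ℝ) {t : ℝ} (ht : ∀ i j, |H i j| ≤ t)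
    (a : F → A) (b : F → B) (i : A → Fin n) (j : B → Fin n) :
    |edgeProd H a b i j| ≤ t ^ Fintype.card F := by
  rw [edgeProd, Finset.abs_prod, ← Finset.card_univ, ← Finset.prod_const]
  exact Finset.prod_le_prod (fun _ _ => abs_nonneg _) fun f _ => ht _ _

theorem abs_sum_edgeProd_le (H : Matrix (Fin n) (Fin n) ℝ) {t : ℝ} (ht : ∀ i j, |H i j| ≤ t)
    (a : F → A) (b : F → B) :
    |∑ i : A → Fin n, ∑ j : B → Fin n, edgeProd H a b i j| ≤
      (n : ℝ) ^ (Fintype.card A + Fintype.card B) * t ^ Fintype.card F := by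
  refine (Finset.abs_sum_le_sum_abs _ _).trans ?_
  refine (Finset.sum_le_sum fun i _ => (Finset.abs_sum_le_sum_abs _ _).trans
    (Finset.sum_le_sum fun j _ => abs_edgeProd_le H ht a b i j)).trans ?_
  simp [pow_add, mul_assoc]

/-- A contraction without vertices of degree two is negligible, or has no edges. -/
theorem exists_contraction_limit_of_degree_ne_two {a : F → A} {b : F → B} {c : ℕ}
    (ha : EvenIncidence a) (hb : EvenIncidence b) (hc : ComponentsLE a b c)
    (ha2 : ∀ v, (Finset.univ.filter fun f => a f = v).card ≠ 2)
    (hb2 : ∀ v, (Finset.univ.filter fun f => b f = v).card ≠ 2) :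
    ∃ κ : ℝ, ∀ n : ℕ, 0 < n → ∀ H ∈ Matrix.orthogonalGroup (Fin n) ℝ, ∀ t : ℝ, 1 ≤ t →
      (∀ i j, |H i j| ≤ t / √n) →
      |(∑ i : A → Fin n, ∑ j : B → Fin n, edgeProd H a b i j) / (n : ℝ) ^ c - κ| ≤
        t ^ Fintype.card F / n := by
  rcases isEmpty_or_nonempty F with hF | hF
  · have hcard : Fintype.card A + Fintype.card B ≤ c := by
      have := hc (A ⊕ B) Sum.inl Sum.inr (fun f => (hF.false f).elim)
      rwa [Set.range_inl_union_range_inr, Set.ncard_univ, Nat.card_eq_fintype_card,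
        Fintype.card_sum] at this
    have hval : ∀ (n : ℕ) (H : Matrix (Fin n) (Fin n) ℝ),
        ∑ i : A → Fin n, ∑ j : B → Fin n, edgeProd H a b i j =
          (n : ℝ) ^ (Fintype.card A + Fintype.card B) := by
      intro n H
      simp [edgeProd, pow_add]
    rcases hcard.eq_or_lt with heq | hlt
    · refine ⟨1, fun n hn H _ t ht _ => ?_⟩
      have hn' : (0 : ℝ) < n := by exact_mod_cast hn
      rw [hval, heq, div_self (by positivity), sub_self, abs_zero]
      positivity
    · refine ⟨0, fun n hn H _ t ht _ => ?_⟩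
      have hn' : (0 : ℝ) < n := by exact_mod_cast hn
      have hn1 : (1 : ℝ) ≤ n := by exact_mod_cast hn
      rw [hval, sub_zero, abs_of_nonneg (by positivity), Fintype.card_eq_zero (α := F), pow_zero,
        div_le_div_iff₀ (by positivity) hn', one_mul, ← pow_succ]
      exact pow_le_pow_right₀ hn1 hlt
  · refine ⟨0, fun n hn H _ t ht hH => ?_⟩
    have hn' : (0 : ℝ) < n := by exact_mod_cast hn
    have hn1 : (1 : ℝ) ≤ n := by exact_mod_cast hn
    have hs : (0 : ℝ) < √n := Real.sqrt_pos.mpr hn'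
    have hs1 : (1 : ℝ) ≤ √n := Real.one_le_sqrt.mpr hn1
    -- The three counts give 2(|A| + |B| + 1) ≤ |F| + 2c. Hence the trivial bound n^(|A|+|B|)
    -- (t/√n)^|F| is at most t^|F| n^(c-1), and the limit is 0.
    have hiso := hc.card_isolated_lt hF
    have hA := card_side_le ha ha2
    have hB := card_side_le hb hb2
    have hsq : (n : ℝ) = √n ^ 2 := (Real.sq_sqrt hn'.le).symm
    rw [sub_zero, abs_div, abs_of_nonneg (by positivity : (0 : ℝ) ≤ (n : ℝ) ^ c),
      div_le_div_iff₀ (by positivity) hn']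
    calc _ ≤ ((n : ℝ) ^ (Fintype.card A + Fintype.card B) * (t / √n) ^ Fintype.card F) * n := by
          gcongr
          exact abs_sum_edgeProd_le H hH a b
      _ = t ^ Fintype.card F * (√n ^ (2 * (Fintype.card A + Fintype.card B + 1)) /
            √n ^ Fintype.card F) := by
          rw [pow_mul, ← hsq, div_pow]; ring
      _ ≤ t ^ Fintype.card F * (n : ℝ) ^ c := by
          gcongr
          rw [div_le_iff₀ (by positivity)]
          nth_rewrite 2 [hsq]
          rw [← pow_mul, ← pow_add]
          exact pow_le_pow_right₀ hs1 (by omega)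

theorem exists_pair_of_card_fiber_eq_two {b : F → B} {b₀ : B}
    (h : (Finset.univ.filter fun f => b f = b₀).card = 2) :
    ∃ f₁ f₂, f₁ ≠ f₂ ∧ b f₁ = b₀ ∧ b f₂ = b₀ ∧ ∀ f, b f = b₀ → f = f₁ ∨ f = f₂ := by
  obtain ⟨f₁, f₂, hne, heq⟩ := Finset.card_eq_two.mp h
  have hmem : ∀ f, b f = b₀ ↔ f = f₁ ∨ f = f₂ := by
    intro f
    have := Finset.ext_iff.mp heq f
    simpa using this
  exact ⟨f₁, f₂, hne, (hmem f₁).2 (Or.inl rfl), (hmem f₂).2 (Or.inr rfl), fun f => (hmem f).1⟩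

end Contraction

section ContractionLimit

open scoped Classical

/-- A normalized contraction of a delocalized orthogonal matrix along a multigraph of even degrees
converges to a limit which depends on the multigraph only. -/
theorem exists_contraction_limit (A B F : Type u) [Fintype A] [Fintype B] [Fintype F]
    (a : F → A) (b : F → B) (c : ℕ)
    (ha : EvenIncidence a) (hb : EvenIncidence b) (hc : ComponentsLE a b c) :
    ∃ κ : ℝ, ∀ n : ℕ, 0 < n → ∀ H ∈ Matrix.orthogonalGroup (Fin n) ℝ, ∀ t : ℝ, 1 ≤ t →
      (∀ i j, |H i j| ≤ t / √n) →
      |(∑ i : A → Fin n, ∑ j : B → Fin n, edgeProd H a b i j) / (n : ℝ) ^ c - κ| ≤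
        t ^ Fintype.card F / n := by
  induction hN : Fintype.card A + Fintype.card B using Nat.strong_induction_on
    generalizing A B F with
  | _ N ih =>
  -- Contracting a vertex of degree two in the second side removes it and does not enlarge the first
  -- side, so the induction on the number of vertices applies. A vertex of degree two in the first
  -- side is handled by transposing `H`.
  have step : ∀ (A B F : Type u) [Fintype A] [Fintype B] [Fintype F]
      (a : F → A) (b : F → B), Fintype.card A + Fintype.card B = N →
      EvenIncidence a → EvenIncidence b → ComponentsLE a b c →
      ∀ b₀, (Finset.univ.filter fun f => b f = b₀).card = 2 →
      ∃ κ : ℝ, ∀ n : ℕ, 0 < n → ∀ H ∈ Matrix.orthogonalGroup (Fin n) ℝ, ∀ t : ℝ, 1 ≤ t →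
        (∀ i j, |H i j| ≤ t / √n) →
        |(∑ i : A → Fin n, ∑ j : B → Fin n, edgeProd H a b i j) / (n : ℝ) ^ c - κ| ≤
          t ^ Fintype.card F / n := by
    intro A B F _ _ _ a b hN ha hb hc b₀ h2
    obtain ⟨f₁, f₂, hne, h₁, h₂, hf⟩ := exists_pair_of_card_fiber_eq_two h2
    have hcard : Fintype.card (Quot (joinRel (a f₁) (a f₂))) +
        Fintype.card {v // v ≠ b₀} < N := by
      have q1 : Fintype.card (Quot (joinRel (a f₁) (a f₂))) ≤ Fintype.card A :=
        Fintype.card_le_of_surjective _ Quot.mk_surjective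
      have q2 : Fintype.card {v // v ≠ b₀} < Fintype.card B :=
        Fintype.card_subtype_lt (x := b₀) (by simp)
      omega
    obtain ⟨κ, hκ⟩ := ih _ hcard _ _ _ _ _ (ha.contract_left b hne h₁ h₂ hf)
      (hb.contract_right b₀) (hc.contract hf) rfl
    refine ⟨κ, fun n hn H hH t ht hHt => ?_⟩
    rw [sum_edgeProd_contract H ((Matrix.mem_orthogonalGroup_iff _ _).mp hH) a b hne h₁ h₂ hf]
    have hle : t ^ Fintype.card {f // b f ≠ b₀} / (n : ℝ) ≤ t ^ Fintype.card F / n := by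
      gcongr
      exact Fintype.card_subtype_le _
    have := (hκ n hn H hH t ht hHt).trans hle
    refine le_trans (le_of_eq ?_) this
    congr!
  by_cases hb2 : ∃ v, (Finset.univ.filter fun f => b f = v).card = 2
  · obtain ⟨b₀, h2⟩ := hb2
    exact step A B F a b hN ha hb hc b₀ h2
  by_cases ha2 : ∃ v, (Finset.univ.filter fun f => a f = v).card = 2
  · obtain ⟨a₀, h2⟩ := ha2
    obtain ⟨κ, hκ⟩ := step B A F b a (by omega) hb ha hc.swap a₀ h2
    refine ⟨κ, fun n hn H hH t ht hHt => ?_⟩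
    rw [← sum_edgeProd_transpose]
    exact hκ n hn H.transpose (by
      rw [Matrix.mem_orthogonalGroup_iff]
      simpa using (Matrix.mem_orthogonalGroup_iff' _ _).mp hH) t ht (fun i j => hHt j i)
  push Not at ha2 hb2
  exact exists_contraction_limit_of_degree_ne_two ha hb hc ha2 hb2

end ContractionLimit

/-! ### Contractions with prescribed index coincidences -/

section KernelSum

open scoped Classical

instance Setoid.instFinite (A : Type*) [Finite A] : Finite (Setoid A) :=
  Finite.of_injective (fun s : Setoid A => (s : A → A → Prop)) fun _ _ h =>
    Setoid.ext fun x y => iff_of_eq (congrFun (congrFun h x) y)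

noncomputable instance Setoid.instFintype (A : Type*) [Finite A] : Fintype (Setoid A) :=
  Fintype.ofFinite _

variable {A B F : Type u} [Fintype A] [Fintype B] [Fintype F] {n : ℕ}

/-- The part of a contraction carried by index assignments with prescribed coincidences. -/
noncomputable def kernelSum (H : Matrix (Fin n) (Fin n) ℝ) (a : F → A) (b : F → B)
    (S : Setoid A) (R : Setoid B) : ℝ :=
  ∑ i : A → Fin n with Setoid.ker i = S, ∑ j : B → Fin n with Setoid.ker j = R, edgeProd H a b i j

/-- The edge maps of the quotient multigraph. -/
def quotEdge (a : F → A) (S : Setoid A) (f : F) : Quotient S := Quotient.mk S (a f)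

theorem EvenIncidence.mono {a : F → A} {S S' : Setoid A} (h : S ≤ S')
    (he : EvenIncidence (quotEdge a S)) : EvenIncidence (quotEdge a S') := fun s =>
  he fun x => s (Quotient.map' id (fun _ _ hxy => h hxy) x)

theorem EvenIncidence.quotEdge {a : F → A} (ha : EvenIncidence a) (S : Setoid A) :
    EvenIncidence (quotEdge a S) := fun s => ha fun v => s (Quotient.mk S v)

theorem ComponentsLE.mono {a : F → A} {b : F → B} {c : ℕ} {S S' : Setoid A} {R R' : Setoid B}
    (h : S ≤ S') (h' : R ≤ R') (hc : ComponentsLE (_root_.quotEdge a S) (_root_.quotEdge b R) c) :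
    ComponentsLE (_root_.quotEdge a S') (_root_.quotEdge b R') c := by
  intro X p q hpq
  refine le_trans (Set.ncard_le_ncard ?_ (Set.toFinite _))
    (hc X (fun x => p (Quotient.map' id (fun _ _ hxy => h hxy) x))
      (fun x => q (Quotient.map' id (fun _ _ hxy => h' hxy) x)) hpq)
  rintro x (⟨v, rfl⟩ | ⟨v, rfl⟩)
  · induction v using Quotient.ind with | _ v => exact Or.inl ⟨Quotient.mk _ v, rfl⟩
  · induction v using Quotient.ind with | _ v => exact Or.inr ⟨Quotient.mk _ v, rfl⟩

theorem ComponentsLE.quotEdge {a : F → A} {b : F → B} {c : ℕ} (hc : ComponentsLE a b c)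
    (S : Setoid A) (R : Setoid B) :
    ComponentsLE (_root_.quotEdge a S) (_root_.quotEdge b R) c := by
  intro X p q hpq
  refine le_trans (Set.ncard_le_ncard ?_ (Set.toFinite _))
    (hc X (fun x => p (Quotient.mk _ x)) (fun x => q (Quotient.mk _ x)) hpq)
  rintro x (⟨v, rfl⟩ | ⟨v, rfl⟩)
  · induction v using Quotient.ind with | _ v => exact Or.inl ⟨v, rfl⟩
  · induction v using Quotient.ind with | _ v => exact Or.inr ⟨v, rfl⟩

theorem sum_quotient_functions {M : Type*} [AddCommMonoid M] (S : Setoid A)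
    (g : (A → Fin n) → M) :
    ∑ i : Quotient S → Fin n, g (fun v => i (Quotient.mk S v)) =
      ∑ i : A → Fin n with S ≤ Setoid.ker i, g i := by
  rw [Finset.sum_subtype (p := fun i : A → Fin n => S ≤ Setoid.ker i) _ (by simp),
    ← (Setoid.liftEquiv S).sum_comp]
  rfl

theorem sum_edgeProd_quotEdge (H : Matrix (Fin n) (Fin n) ℝ) (a : F → A) (b : F → B)
    (S : Setoid A) (R : Setoid B) :
    ∑ i : Quotient S → Fin n, ∑ j : Quotient R → Fin n,
        edgeProd H (quotEdge a S) (quotEdge b R) i j =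
      ∑ p : Setoid A × Setoid B with (S, R) ≤ p, kernelSum H a b p.1 p.2 := by
  have h1 := sum_quotient_functions (n := n) S (fun i => ∑ j : Quotient R → Fin n,
    edgeProd H a (quotEdge b R) i j)
  refine h1.trans ?_
  have h2 : ∀ i : A → Fin n, ∑ j : Quotient R → Fin n, edgeProd H a (quotEdge b R) i j =
      ∑ j : B → Fin n with R ≤ Setoid.ker j, edgeProd H a b i j := fun i =>
    sum_quotient_functions (n := n) R (fun j => edgeProd H a b i j)
  simp_rw [h2]
  have h3 : (Finset.univ.filter fun p : Setoid A × Setoid B => (S, R) ≤ p) =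
      (Finset.univ.filter fun P => S ≤ P) ×ˢ (Finset.univ.filter fun P => R ≤ P) := by
    ext p; simp [Prod.le_def]
  rw [h3, Finset.sum_product]
  have hfib : ∀ (A : Type u) [Fintype A] (S : Setoid A) (g : (A → Fin n) → ℝ),
      ∑ i : A → Fin n with S ≤ Setoid.ker i, g i =
        ∑ P : Setoid A with S ≤ P, ∑ i : A → Fin n with Setoid.ker i = P, g i := by
    intro A _ S g
    rw [← Finset.sum_fiberwise_of_maps_to (s := Finset.univ.filter fun i : A → Fin n =>
      S ≤ Setoid.ker i) (t := Finset.univ.filter fun P => S ≤ P) (g := fun i => Setoid.ker i)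
      (by simp)]
    refine Finset.sum_congr rfl fun P hP => ?_
    congr 1
    ext i
    simp only [Finset.mem_filter, Finset.mem_univ, true_and] at hP ⊢
    constructor
    · exact fun h => h.2
    · exact fun h => ⟨h ▸ hP, h⟩
  rw [hfib]
  refine Finset.sum_congr rfl fun P _ => ?_
  simp_rw [hfib B R]
  rw [Finset.sum_comm]
  rfl

/-- Inclusion–exclusion on pairs of partitions, from the coarsest downwards: a free sum over the
quotient multigraph is the sum of the kernel sums of all coarser pairs, so the kernel sum at `p` is
a free sum minus terms treated before. Coarsening preserves even degrees and the bound on the number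
of components. -/
theorem exists_kernelSum_limit (a : F → A) (b : F → B) (c : ℕ) (p : Setoid A × Setoid B)
    (ha : EvenIncidence (quotEdge a p.1)) (hb : EvenIncidence (quotEdge b p.2))
    (hc : ComponentsLE (quotEdge a p.1) (quotEdge b p.2) c) :
    ∃ κ C : ℝ, 0 ≤ C ∧ ∀ n : ℕ, 0 < n → ∀ H ∈ Matrix.orthogonalGroup (Fin n) ℝ, ∀ t : ℝ, 1 ≤ t →
      (∀ i j, |H i j| ≤ t / √n) →
      |kernelSum H a b p.1 p.2 / (n : ℝ) ^ c - κ| ≤ C * (t ^ Fintype.card F / n) := by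
  induction p using WellFoundedGT.induction with
  | _ p ih =>
  obtain ⟨κ₀, h₀⟩ := exists_contraction_limit _ _ _ _ _ c ha hb hc
  have ih' : ∀ q, p < q → ∃ κ C : ℝ, 0 ≤ C ∧ ∀ n : ℕ, 0 < n →
      ∀ H ∈ Matrix.orthogonalGroup (Fin n) ℝ, ∀ t : ℝ, 1 ≤ t →
      (∀ i j, |H i j| ≤ t / √n) →
      |kernelSum H a b q.1 q.2 / (n : ℝ) ^ c - κ| ≤ C * (t ^ Fintype.card F / n) := fun q hq =>
    ih q hq (ha.mono hq.le.1) (hb.mono hq.le.2) (hc.mono hq.le.1 hq.le.2)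
  -- Only the values at `q > p` are used; elsewhere `κ` and `C` are arbitrary.
  choose! κ C hC hκ using ih'
  have hC' : 0 ≤ ∑ q with p < q, C q :=
    Finset.sum_nonneg fun q hq => hC q (Finset.mem_filter.mp hq).2
  refine ⟨κ₀ - ∑ q with p < q, κ q, 1 + ∑ q with p < q, C q, by positivity,
    fun n hn H hH t ht hHt => ?_⟩
  have hfree : kernelSum H a b p.1 p.2 =
      (∑ i : Quotient p.1 → Fin n, ∑ j : Quotient p.2 → Fin n,
        edgeProd H (quotEdge a p.1) (quotEdge b p.2) i j) -
        ∑ q with p < q, kernelSum H a b q.1 q.2 := by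
    rw [sum_edgeProd_quotEdge]
    have : (Finset.univ.filter fun q : Setoid A × Setoid B => (p.1, p.2) ≤ q) =
        insert p (Finset.univ.filter fun q => p < q) := by
      ext q
      simp only [Prod.mk.eta, Finset.mem_filter, Finset.mem_univ, true_and, Finset.mem_insert]
      rw [le_iff_eq_or_lt, eq_comm]
    rw [this, Finset.sum_insert (by simp)]
    ring
  have h1 := h₀ n hn H hH t ht hHt
  have h2 : (∑ q with p < q, kernelSum H a b q.1 q.2) / (n : ℝ) ^ c - ∑ q with p < q, κ q =
      ∑ q with p < q, (kernelSum H a b q.1 q.2 / (n : ℝ) ^ c - κ q) := by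
    rw [Finset.sum_div, Finset.sum_sub_distrib]
  rw [hfree, sub_div, sub_sub_sub_comm, h2]
  refine (abs_sub _ _).trans ?_
  rw [add_mul, one_mul, Finset.sum_mul]
  refine add_le_add ?_ ((Finset.abs_sum_le_sum_abs _ _).trans (Finset.sum_le_sum fun q hq =>
    hκ q (Finset.mem_filter.mp hq).2 n hn H hH t ht hHt))
  refine le_trans (le_of_eq ?_) h1
  congr!

/-- Contractions of a multigraph of even degrees grow at most like the power of the dimension given
by the number of components. -/
theorem exists_abs_kernelSum_le (a : F → A) (b : F → B) (c : ℕ) (S : Setoid A) (R : Setoid B)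
    (ha : EvenIncidence (quotEdge a S)) (hb : EvenIncidence (quotEdge b R))
    (hc : ComponentsLE (quotEdge a S) (quotEdge b R) c) :
    ∃ C : ℝ, 0 ≤ C ∧ ∀ n : ℕ, 0 < n → ∀ H ∈ Matrix.orthogonalGroup (Fin n) ℝ, ∀ t : ℝ, 1 ≤ t →
      (∀ i j, |H i j| ≤ t / √n) →
      |kernelSum H a b S R| ≤ C * t ^ Fintype.card F * (n : ℝ) ^ c := by
  obtain ⟨κ, C, hC, h⟩ := exists_kernelSum_limit a b c (S, R) ha hb hc
  refine ⟨|κ| + C, by positivity, fun n hn H hH t ht hHt => ?_⟩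
  have hn1 : (1 : ℝ) ≤ n := by exact_mod_cast hn
  have hnc : (0 : ℝ) < (n : ℝ) ^ c := by positivity
  have h1 := h n hn H hH t ht hHt
  have ht1 : 1 ≤ t ^ Fintype.card F := one_le_pow₀ ht
  rw [← div_le_iff₀ hnc]
  nth_rewrite 1 [← abs_of_pos hnc]
  rw [← abs_div]
  have h2 : C * (t ^ Fintype.card F / n) ≤ C * t ^ Fintype.card F := by
    gcongr
    exact div_le_self (by positivity) hn1
  have h3 := abs_sub_abs_le_abs_sub (kernelSum H a b S R / (n : ℝ) ^ c) κ
  have h4 : |κ| ≤ |κ| * t ^ Fintype.card F := le_mul_of_one_le_right (abs_nonneg _) ht1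
  simp only at h1
  linarith [add_mul |κ| C (t ^ Fintype.card F)]

end KernelSum

/-! ### Averages over permutations of products with centred factors -/

section PermutationAverage

open scoped Classical

variable {n : ℕ}

/-- Merging a factor `γ x₀` with sum zero into the others. -/
theorem sum_perm_prod_of_sum_eq_zero (X : Finset (Fin n)) (γ : Fin n → Fin n → ℝ) {x₀ : Fin n}
    (hx₀ : x₀ ∉ X) (h0 : ∑ y, γ x₀ y = 0) :
    ((n : ℝ) - X.card) * ∑ σ : Equiv.Perm (Fin n), ∏ x ∈ insert x₀ X, γ x (σ x) =
      -∑ x ∈ X, ∑ σ : Equiv.Perm (Fin n),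
        ∏ z ∈ X, Function.update γ x (fun y => γ x y * γ x₀ y) z (σ z) := by
  -- In this vanishing double sum, each `y ∈ X` merges the factor at `x₀` into the one at `y`, while
  -- every `y ∉ X`, including `x₀` itself, contributes the same sum, namely the one over `insert x₀
  -- X`.
  have htot : ∑ y : Fin n, ∑ σ : Equiv.Perm (Fin n), γ x₀ (σ y) * ∏ z ∈ X, γ z (σ z) = 0 := by
    rw [Finset.sum_comm]
    refine Finset.sum_eq_zero fun σ _ => ?_
    rw [← Finset.sum_mul, Equiv.sum_comp σ (γ x₀), h0, zero_mul]
  rw [← Finset.sum_add_sum_compl X] at htot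
  have hin : ∀ x ∈ X, ∑ σ : Equiv.Perm (Fin n), γ x₀ (σ x) * ∏ z ∈ X, γ z (σ z) =
      ∑ σ : Equiv.Perm (Fin n),
        ∏ z ∈ X, Function.update γ x (fun y => γ x y * γ x₀ y) z (σ z) := by
    intro x hx
    refine Finset.sum_congr rfl fun σ _ => ?_
    rw [← Finset.mul_prod_erase X _ hx, ← Finset.mul_prod_erase X _ hx, Function.update_self]
    have : ∏ z ∈ X.erase x, Function.update γ x (fun y => γ x y * γ x₀ y) z (σ z) =
        ∏ z ∈ X.erase x, γ z (σ z) := Finset.prod_congr rfl fun z hz => by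
      rw [Function.update_of_ne (Finset.ne_of_mem_erase hz)]
    rw [this]
    ring
  have hout : ∀ y ∈ Xᶜ, ∑ σ : Equiv.Perm (Fin n), γ x₀ (σ y) * ∏ z ∈ X, γ z (σ z) =
      ∑ σ : Equiv.Perm (Fin n), ∏ x ∈ insert x₀ X, γ x (σ x) := by
    intro y hy
    -- Precomposing `σ` with the transposition of `x₀` and `y` leaves its values on `X` unchanged,
    -- because both points lie outside `X`.
    rw [← Equiv.sum_comp (Equiv.mulRight (Equiv.swap x₀ y))]
    refine Finset.sum_congr rfl fun σ _ => ?_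
    rw [Finset.prod_insert hx₀]
    have hy' : y ∉ X := by simpa using hy
    congr 1
    · simp
    · refine Finset.prod_congr rfl fun z hz => ?_
      simp only [Equiv.coe_mulRight, Equiv.Perm.coe_mul, Function.comp_apply]
      rw [Equiv.swap_apply_of_ne_of_ne]
      · rintro rfl; exact hx₀ hz
      · rintro rfl; exact hy' hz
  rw [Finset.sum_congr rfl hin, Finset.sum_congr rfl hout, Finset.sum_const, nsmul_eq_mul,
    Finset.card_compl, Fintype.card_fin, Nat.cast_sub (card_finset_fin_le X)] at htot
  linarith

/-- Each centred factor gains a factor `n ^ (-1/2)` in an average over permutations. -/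
theorem abs_sum_perm_prod_le (hn : 0 < n) (r : ℕ) (X M : Finset (Fin n)) (hX : X.card = r)
    (hM : M ⊆ X) (γ : Fin n → Fin n → ℝ) (t : Fin n → ℝ) (ht : ∀ x ∈ X, ∀ y, |γ x y| ≤ t x)
    (h0 : ∀ x ∈ M, ∑ y, γ x y = 0) :
    |∑ σ : Equiv.Perm (Fin n), ∏ x ∈ X, γ x (σ x)| ≤
      (r.factorial : ℝ) ^ 2 * n.factorial * (∏ x ∈ X, t x) * (√n)⁻¹ ^ M.card := by
  have hn' : (0 : ℝ) < n := by exact_mod_cast hn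
  have hn1 : (1 : ℝ) ≤ n := by exact_mod_cast hn
  have hs : (0 : ℝ) < √n := Real.sqrt_pos.mpr hn'
  have hs1 : (√n)⁻¹ ≤ 1 := inv_le_one_of_one_le₀ (Real.one_le_sqrt.mpr hn1)
  have hs2 : (√n)⁻¹ ^ 2 = (n : ℝ)⁻¹ := by rw [inv_pow, Real.sq_sqrt hn'.le]
  induction r generalizing X M γ t with
  | zero =>
    obtain rfl := Finset.card_eq_zero.mp hX
    obtain rfl := Finset.subset_empty.mp hM
    simp [Fintype.card_perm]
  | succ r ih =>
  have ht0 : ∀ x ∈ X, 0 ≤ t x := fun x hx => (abs_nonneg _).trans (ht x hx ⟨0, hn⟩)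
  have hprod : 0 ≤ ∏ x ∈ X, t x := Finset.prod_nonneg ht0
  rcases M.eq_empty_or_nonempty with rfl | ⟨x₀, hx₀⟩
  · have h1 : |∑ σ : Equiv.Perm (Fin n), ∏ x ∈ X, γ x (σ x)| ≤ n.factorial * ∏ x ∈ X, t x := by
      refine (Finset.abs_sum_le_sum_abs _ _).trans ((Finset.sum_le_sum (g := fun _ => ∏ x ∈ X, t x)
        fun σ _ => ?_).trans (le_of_eq ?_))
      · rw [Finset.abs_prod]
        exact Finset.prod_le_prod (fun _ _ => abs_nonneg _) fun x hx => ht x hx _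
      · simp [Fintype.card_perm]
    have h2 : (1 : ℝ) ≤ ((r + 1).factorial : ℝ) ^ 2 :=
      one_le_pow₀ (by exact_mod_cast Nat.factorial_pos _)
    rw [Finset.card_empty, pow_zero, mul_one, mul_assoc]
    exact h1.trans (le_mul_of_one_le_left (by positivity) h2)
  · obtain ⟨X', hx₀X', rfl⟩ : ∃ X', x₀ ∉ X' ∧ insert x₀ X' = X :=
      ⟨X.erase x₀, Finset.notMem_erase _ _, Finset.insert_erase (hM hx₀)⟩
    have hcard : X'.card = r := by
      rw [Finset.card_insert_of_notMem hx₀X'] at hX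
      omega
    have hle : r + 1 ≤ n := by
      rw [← hX]; exact card_finset_fin_le _
    have hrec := sum_perm_prod_of_sum_eq_zero X' γ hx₀X' (h0 x₀ hx₀)
    set T := ∑ σ : Equiv.Perm (Fin n), ∏ x ∈ insert x₀ X', γ x (σ x) with hT
    set P := ∏ x ∈ insert x₀ X', t x with hP
    have hbound : ∀ x ∈ X', |∑ σ : Equiv.Perm (Fin n),
        ∏ z ∈ X', Function.update γ x (fun y => γ x y * γ x₀ y) z (σ z)| ≤
          (r.factorial : ℝ) ^ 2 * n.factorial * P * ((√n)⁻¹ ^ M.card * n) := by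
      intro x hx
      -- Merging uses up the centred factor at `x₀` and may destroy the centring at `x`. At most two
      -- centred factors are lost, which costs a factor n in the bound, recovered by the division by
      -- `n - r`.
      have hM' : (M.erase x₀).erase x ⊆ X' := by
        intro z hz
        have hz1 := Finset.mem_of_mem_erase hz
        exact (Finset.mem_insert.mp (hM (Finset.mem_of_mem_erase hz1))).resolve_left
          (Finset.ne_of_mem_erase hz1)
      refine (ih X' _ hcard hM' (Function.update γ x (fun y => γ x y * γ x₀ y))
        (Function.update t x (t x * t x₀)) ?_ ?_).trans ?_
      · intro z hz y
        by_cases hzx : z = x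
        · subst hzx
          rw [Function.update_self, Function.update_self, abs_mul]
          exact mul_le_mul (ht z (Finset.mem_insert_of_mem hz) y)
            (ht x₀ (Finset.mem_insert_self _ _) y) (abs_nonneg _)
            (ht0 z (Finset.mem_insert_of_mem hz))
        · rw [Function.update_of_ne hzx, Function.update_of_ne hzx]
          exact ht z (Finset.mem_insert_of_mem hz) y
      · intro z hz
        rw [Function.update_of_ne (Finset.ne_of_mem_erase hz)]
        exact h0 z (Finset.mem_of_mem_erase (Finset.mem_of_mem_erase hz))
      · have hPeq : ∏ z ∈ X', Function.update t x (t x * t x₀) z = P := by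
          rw [Finset.prod_update_of_mem hx, hP, Finset.prod_insert hx₀X',
            ← Finset.mul_prod_erase X' t hx, Finset.sdiff_singleton_eq_erase]
          ring
        rw [hPeq]
        refine mul_le_mul_of_nonneg_left ?_ (by positivity)
        have hc : M.card ≤ ((M.erase x₀).erase x).card + 2 := by
          have := Finset.card_erase_add_one hx₀
          have := Finset.pred_card_le_card_erase (s := M.erase x₀) (a := x)
          omega
        rw [← div_le_iff₀ hn', div_eq_mul_inv, ← hs2, ← pow_add]
        exact pow_le_pow_of_le_one (by positivity) hs1 hc
    have hsum : |((n : ℝ) - X'.card) * T| ≤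
        r * ((r.factorial : ℝ) ^ 2 * n.factorial * P * ((√n)⁻¹ ^ M.card * n)) := by
      rw [hrec, abs_neg]
      refine (Finset.abs_sum_le_sum_abs _ _).trans ((Finset.sum_le_sum hbound).trans ?_)
      rw [Finset.sum_const, hcard, nsmul_eq_mul]
    rw [hcard, abs_mul] at hsum
    have hr : (r : ℝ) + 1 ≤ n := by exact_mod_cast hle
    have hpos : (0 : ℝ) < n - r := by linarith
    rw [abs_of_pos hpos] at hsum
    have hr0 : (0 : ℝ) ≤ r := Nat.cast_nonneg r
    -- One step of the recursion costs r n / (n - r) ≤ (r + 1)², by `r + 1 ≤ n`; this is the growth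
    -- of the constant (r!)².
    have hkey : (r : ℝ) * n ≤ ((r : ℝ) + 1) ^ 2 * (n - r) := by
      nlinarith [mul_nonneg (sq_nonneg (r : ℝ)) (by linarith : (0 : ℝ) ≤ n - r - 1),
        mul_nonneg hr0 hpos.le]
    set Q := (r.factorial : ℝ) ^ 2 * n.factorial * P * (√n)⁻¹ ^ M.card with hQ
    have hQ0 : 0 ≤ Q := by positivity
    have hgoal : ((r + 1).factorial : ℝ) ^ 2 * n.factorial * P * (√n)⁻¹ ^ M.card =
        ((r : ℝ) + 1) ^ 2 * Q := by
      rw [hQ, Nat.factorial_succ]; push_cast; ring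
    rw [hgoal]
    refine le_of_mul_le_mul_left ?_ hpos
    calc (n - r : ℝ) * |T| ≤ r * n * Q := by rw [hQ]; linarith
      _ ≤ ((r : ℝ) + 1) ^ 2 * (n - r) * Q := by gcongr
      _ = _ := by ring

end PermutationAverage

/-- The data of a signed permutation. -/
abbrev SignedPerm (n : ℕ) : Type := Equiv.Perm (Fin n) × (Fin n → ℤˣ)

/-! ### Averages over signed permutations of the factors of one side -/

section SideAverage

open scoped Classical

variable {A F : Type u} [Fintype A] [Fintype F] {n : ℕ}

/-- The product of the permuted vertex labels and of the signs at the ends of the edges. -/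
noncomputable def sideProd (a : F → A) (α : A → Fin n → ℝ) (s : SignedPerm n) (i : A → Fin n) :
    ℝ :=
  (∏ v, α v (s.1 (i v))) * ∏ f, ((s.2 (i (a f)) : ℤ) : ℝ)

theorem exists_perm_comp_of_ker_eq {i i' : A → Fin n} (h : Setoid.ker i = Setoid.ker i') :
    ∃ g : Equiv.Perm (Fin n), ∀ v, i' v = g (i v) := by
  let e : {x // x ∈ Set.range i} ≃ {x // x ∈ Set.range i'} :=
    (Setoid.quotientKerEquivRange i).symm.trans
      ((Quotient.congrRight fun x y => by rw [h]).trans (Setoid.quotientKerEquivRange i'))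
  refine ⟨e.extendSubtype, fun v => ?_⟩
  rw [Equiv.extendSubtype_apply_of_mem e (i v) ⟨v, rfl⟩]
  have : (Setoid.quotientKerEquivRange i).symm ⟨i v, ⟨v, rfl⟩⟩ = Quotient.mk _ v := by
    rw [Equiv.symm_apply_eq]; rfl
  simp only [e, Equiv.trans_apply, this]
  rfl

theorem sum_sideProd_comp_perm (a : F → A) (α : A → Fin n → ℝ) (i : A → Fin n)
    (g : Equiv.Perm (Fin n)) :
    ∑ s, sideProd a α s (fun v => g (i v)) = ∑ s, sideProd a α s i := by
  let e : SignedPerm n ≃ SignedPerm n :=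
    (Equiv.mulRight g).prodCongr (Equiv.arrowCongr g.symm (Equiv.refl _))
  refine Fintype.sum_equiv e _ _ fun s => ?_
  simp [sideProd, e, Equiv.arrowCongr]

/-- Two assignments with the same coincidences differ by a permutation of the indices, which a
change of variables in the signed permutation absorbs. This is why averages can be grouped by
partitions. -/
theorem sum_sideProd_eq_of_ker_eq (a : F → A) (α : A → Fin n → ℝ) {i i' : A → Fin n}
    (h : Setoid.ker i = Setoid.ker i') :
    ∑ s, sideProd a α s i = ∑ s, sideProd a α s i' := by
  obtain ⟨g, hg⟩ := exists_perm_comp_of_ker_eq h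
  rw [funext hg, sum_sideProd_comp_perm]

/-- If a choice of signs on the classes violates evenness, multiplying the random signs by it
preserves the uniform average and changes the sign of every term, so the average is zero. -/
theorem evenIncidence_of_sum_sideProd_ne_zero (a : F → A) (α : A → Fin n → ℝ) (i : A → Fin n)
    (h : ∑ s, sideProd a α s i ≠ 0) : EvenIncidence (quotEdge a (Setoid.ker i)) := by
  by_contra hodd
  apply h
  simp only [EvenIncidence, not_forall] at hodd
  obtain ⟨s₀, hs₀⟩ := hodd
  let z : Fin n → ℤˣ := fun x =>
    if hx : x ∈ Set.range i then s₀ ((Setoid.quotientKerEquivRange i).symm ⟨x, hx⟩) else 1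
  have hz : ∀ v, z (i v) = s₀ (Quotient.mk _ v) := by
    intro v
    have : (Setoid.quotientKerEquivRange i).symm ⟨i v, ⟨v, rfl⟩⟩ = Quotient.mk _ v := by
      rw [Equiv.symm_apply_eq]; rfl
    simp only [z, Set.mem_range_self, dif_pos, this]
  have hprod : ∏ f, z (i (a f)) = -1 := by
    refine (Int.units_eq_one_or _).resolve_left ?_
    simp_rw [hz]
    exact hs₀
  have hsum : ∑ s, sideProd a α s i = -∑ s, sideProd a α s i := by
    let e : SignedPerm n ≃ SignedPerm n := (Equiv.refl _).prodCongr (Equiv.mulLeft z)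
    rw [← Finset.sum_neg_distrib]
    refine Fintype.sum_equiv e _ _ fun s => ?_
    have : ∏ f, (((z (i (a f)) * s.2 (i (a f)) : ℤˣ) : ℤ) : ℝ) =
        -∏ f, ((s.2 (i (a f)) : ℤ) : ℝ) := by
      simp only [Units.val_mul, Int.cast_mul, Finset.prod_mul_distrib]
      have h1 : ∏ f, ((z (i (a f)) : ℤ) : ℝ) = (((∏ f, z (i (a f)) : ℤˣ) : ℤ) : ℝ) := by
        push_cast; rfl
      rw [h1, hprod]; simp
    simp only [sideProd, e, Equiv.prodCongr_apply, Prod.map_fst, Prod.map_snd, Equiv.coe_refl, id,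
      Equiv.coe_mulLeft, Pi.mul_apply, this]
    ring
  linarith

theorem abs_prod_sign (f : F → ℤˣ) : |∏ x, ((f x : ℤ) : ℝ)| = 1 := by
  rw [Finset.abs_prod]
  refine Finset.prod_eq_one fun x _ => ?_
  rcases Int.units_eq_one_or (f x) with h | h <;> simp [h]

theorem abs_sideProd_le (a : F → A) {α : A → Fin n → ℝ} {t : ℝ} (hα : ∀ v y, |α v y| ≤ t)
    (s : SignedPerm n) (i : A → Fin n) : |sideProd a α s i| ≤ t ^ Fintype.card A := by
  rw [sideProd, abs_mul, abs_prod_sign (fun f => s.2 (i (a f))), mul_one, Finset.abs_prod,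
    ← Finset.card_univ, ← Finset.prod_const]
  exact Finset.prod_le_prod (fun _ _ => abs_nonneg _) fun v _ => hα _ _

theorem card_signedPerm (n : ℕ) :
    (Fintype.card (SignedPerm n) : ℝ) = n.factorial * Fintype.card (Fin n → ℤˣ) := by
  rw [Fintype.card_prod, Fintype.card_perm, Fintype.card_fin]
  push_cast; rfl

/-- Centred labels at indices which occur only once each gain a factor `n ^ (-1/2)`. -/
theorem abs_sum_sideProd_le (hn : 0 < n) (a : F → A) {α : A → Fin n → ℝ} {t : ℝ}
    (hα : ∀ v y, |α v y| ≤ t) (i : A → Fin n) (D : Finset A)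
    (h0 : ∀ v ∈ D, ∑ y, α v y = 0) (hD : ∀ v ∈ D, ∀ w, i w = i v → w = v) :
    |∑ s, sideProd a α s i| ≤ ((Fintype.card A).factorial : ℝ) ^ 2 *
      Fintype.card (SignedPerm n) * t ^ Fintype.card A * (√n)⁻¹ ^ D.card := by
  set X := Finset.univ.image i with hX
  -- The factor at an index `x` collects the labels of all vertices placed at `x`. For `v ∈ D` the
  -- fibre is `{v}`, so this factor is the single centred label `α v`.
  set γ : Fin n → Fin n → ℝ := fun x y => ∏ v with i v = x, α v y with hγ
  have hprod : ∀ σ : Equiv.Perm (Fin n), ∏ v, α v (σ (i v)) = ∏ x ∈ X, γ x (σ x) := by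
    intro σ
    rw [← Finset.prod_fiberwise_of_maps_to (s := Finset.univ) (t := X) (g := i)
      (fun v _ => Finset.mem_image_of_mem _ (Finset.mem_univ _))]
    refine Finset.prod_congr rfl fun x _ => Finset.prod_congr rfl fun v hv => ?_
    rw [(Finset.mem_filter.mp hv).2]
  have hsplit : ∑ s, sideProd a α s i = (∑ σ : Equiv.Perm (Fin n), ∏ x ∈ X, γ x (σ x)) *
      ∑ ξ : Fin n → ℤˣ, ∏ f, ((ξ (i (a f)) : ℤ) : ℝ) := by
    rw [Fintype.sum_prod_type, Finset.sum_mul_sum]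
    simp_rw [sideProd, hprod]
  have hinj : Set.InjOn i D := fun v hv w _ h => (hD v hv w h.symm).symm
  have h1 := abs_sum_perm_prod_le hn X.card X (D.image i) rfl
    (Finset.image_subset_image (Finset.subset_univ _)) γ
    (fun x => t ^ (Finset.univ.filter fun v => i v = x).card) ?_ ?_
  · rw [Finset.card_image_of_injOn hinj, Finset.prod_pow_eq_pow_sum,
      ← Finset.card_eq_sum_card_fiberwise (fun v _ => Finset.mem_image_of_mem _ (Finset.mem_univ _)),
      Finset.card_univ] at h1
    have h2 : |∑ ξ : Fin n → ℤˣ, ∏ f, ((ξ (i (a f)) : ℤ) : ℝ)| ≤ Fintype.card (Fin n → ℤˣ) := by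
      refine (Finset.abs_sum_le_sum_abs _ _).trans ?_
      simp_rw [fun ξ : Fin n → ℤˣ => abs_prod_sign (fun f => ξ (i (a f)))]
      simp
    have h3 : (X.card.factorial : ℝ) ≤ (Fintype.card A).factorial := by
      exact_mod_cast Nat.factorial_le (Finset.card_image_le.trans (le_of_eq Finset.card_univ))
    have ht : 0 ≤ t ^ Fintype.card A := by
      have := (abs_nonneg _).trans (abs_sideProd_le a hα (1, 1) i)
      exact this
    rw [hsplit, abs_mul, card_signedPerm]
    calc _ ≤ ((X.card.factorial : ℝ) ^ 2 * n.factorial * t ^ Fintype.card A *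
          (√n)⁻¹ ^ D.card) * Fintype.card (Fin n → ℤˣ) :=
          mul_le_mul h1 h2 (abs_nonneg _) (by positivity)
      _ ≤ (((Fintype.card A).factorial : ℝ) ^ 2 * n.factorial * t ^ Fintype.card A *
          (√n)⁻¹ ^ D.card) * Fintype.card (Fin n → ℤˣ) := by gcongr
      _ = _ := by ring
  · intro x _ y
    rw [hγ, Finset.abs_prod, ← Finset.prod_const]
    exact Finset.prod_le_prod (fun _ _ => abs_nonneg _) fun v _ => hα _ _
  · intro x hx
    obtain ⟨v, hv, rfl⟩ := Finset.mem_image.mp hx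
    have : (Finset.univ.filter fun w => i w = i v) = {v} := by
      ext w
      simp only [Finset.mem_filter, Finset.mem_univ, true_and, Finset.mem_singleton]
      exact ⟨hD v hv w, fun h => h ▸ rfl⟩
    simp only [hγ, this, Finset.prod_singleton]
    exact h0 v hv

end SideAverage

/-! ### Disjoint copies of a multigraph, glued along a partition -/

section Copies

open scoped Classical

variable {A B F : Type u} [Fintype A] [Fintype B] [Fintype F] {n K : ℕ}

/-- The edge map of `K` disjoint copies of a multigraph. -/
def copyEdge (K : ℕ) (a : F → A) : Fin K × F → Fin K × A := Prod.map id a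

/-- The copies which a partition of the vertices does not join to another copy. -/
noncomputable def isolatedCopies (P : Setoid (Fin K × A)) : Finset (Fin K) :=
  Finset.univ.filter fun k => ∀ k' v v', P (k, v) (k', v') → k' = k

theorem prod_sideProd (a : F → A) (α : A → Fin n → ℝ) (s : SignedPerm n)
    (i : Fin K × A → Fin n) :
    ∏ k, sideProd a α s (fun v => i (k, v)) =
      sideProd (copyEdge K a) (fun w : Fin K × A => α w.2) s i := by
  simp only [sideProd, Finset.prod_mul_distrib, Fintype.prod_prod_type, copyEdge, Prod.map, id]

theorem prod_edgeProd (H : Matrix (Fin n) (Fin n) ℝ) (a : F → A) (b : F → B)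
    (i : Fin K × A → Fin n) (j : Fin K × B → Fin n) :
    ∏ k, edgeProd H a b (fun v => i (k, v)) (fun v => j (k, v)) =
      edgeProd H (copyEdge K a) (copyEdge K b) i j := by
  simp only [edgeProd, Fintype.prod_prod_type, copyEdge, Prod.map, id]

/-- The labels or the degrees of one side make the average over signed permutations vanish to
leading order. -/
def Fluctuating (a : F → A) (α : A → Fin n → ℝ) : Prop :=
  ¬ EvenIncidence a ∨ ∃ v, ∑ y, α v y = 0

theorem Fluctuating.nonempty {a : F → A} {α : A → Fin n → ℝ} (h : Fluctuating a α) :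
    Nonempty A := by
  rcases h with h | ⟨v, _⟩
  · by_contra hA
    rw [not_nonempty_iff] at hA
    exact h fun s => Finset.prod_eq_one fun f _ => (hA.false (a f)).elim
  · exact ⟨v⟩

/-- Signs supported on an isolated copy descend to the quotient, since the partition identifies
nothing within that copy either. Evenness of the quotient would then give evenness of the original
multigraph. -/
theorem isolatedCopies_eq_empty (a : F → A) (ha : ¬ EvenIncidence a)
    (P : Setoid (Fin K × A)) (hP : ∀ k v v', P (k, v) (k, v') → v = v')
    (hE : EvenIncidence (quotEdge (copyEdge K a) P)) : isolatedCopies P = ∅ := by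
  by_contra hne
  obtain ⟨k, hk⟩ := Finset.nonempty_iff_ne_empty.mpr hne
  have hk' := (Finset.mem_filter.mp hk).2
  apply ha
  intro s
  have hlift : ∀ w w' : Fin K × A, P w w' →
      (if w.1 = k then s w.2 else 1) = (if w'.1 = k then s w'.2 else 1) := by
    rintro ⟨k₁, v₁⟩ ⟨k₂, v₂⟩ h
    by_cases h1 : k₁ = k
    · subst h1
      have h2 := hk' _ _ _ h
      subst h2
      rw [hP _ _ _ h]
    · by_cases h2 : k₂ = k
      · subst h2
        exact absurd (hk' _ _ _ (P.symm h)) h1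
      · simp [h1, h2]
  have := hE (fun x => Quotient.lift (fun w : Fin K × A => if w.1 = k then s w.2 else 1) hlift x)
  rw [← this, Fintype.prod_prod_type, Finset.prod_eq_single k]
  · refine Finset.prod_congr rfl fun f _ => ?_
    simp [quotEdge, copyEdge]
  · intro k' _ hk'
    refine Finset.prod_eq_one fun f _ => ?_
    simp [quotEdge, copyEdge, hk']
  · simp

/-- If some degree is odd, either the average vanishes or there is no isolated copy, so there is
nothing to gain. If the label at `v₀` is centred, its index in each isolated copy occurs only once,
and each of these vertices gains n^(-1/2). -/
theorem abs_sum_sideProd_copies_le (hn : 0 < n) (a : F → A) {α : A → Fin n → ℝ} {t : ℝ}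
    (ht : 0 ≤ t) (hα : ∀ v y, |α v y| ≤ t) (h : Fluctuating a α) (i : Fin K × A → Fin n)
    (hi : ∀ k, Function.Injective fun v => i (k, v)) :
    |∑ s, sideProd (copyEdge K a) (fun w : Fin K × A => α w.2) s i| ≤
      ((Fintype.card (Fin K × A)).factorial : ℝ) ^ 2 *
      Fintype.card (SignedPerm n) * t ^ Fintype.card (Fin K × A) *
        (√n)⁻¹ ^ (isolatedCopies (Setoid.ker i)).card := by
  rcases h with h | ⟨v₀, h⟩
  · by_cases hz : ∑ s, sideProd (copyEdge K a) (fun w : Fin K × A => α w.2) s i = 0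
    · rw [hz, abs_zero]
      positivity
    · rw [isolatedCopies_eq_empty a h (Setoid.ker i) (fun k v v' hv => hi k hv)
        (evenIncidence_of_sum_sideProd_ne_zero _ _ _ hz)]
      exact abs_sum_sideProd_le hn (copyEdge K a) (α := fun w : Fin K × A => α w.2)
        (fun w y => hα w.2 y) i (∅ : Finset (Fin K × A)) (fun v hv => absurd hv (by simp))
        (fun v hv => absurd hv (by simp))
  · have := abs_sum_sideProd_le hn (copyEdge K a) (α := fun w : Fin K × A => α w.2)
      (fun w y => hα w.2 y) i
      ((isolatedCopies (Setoid.ker i)).map ⟨fun k => (k, v₀), fun k k' hk => congrArg Prod.fst hk⟩)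
      ?_ ?_
    · rwa [Finset.card_map] at this
    · intro w hw
      obtain ⟨k, _, rfl⟩ := Finset.mem_map.mp hw
      exact h
    · intro w hw w' hww'
      obtain ⟨k, hk, rfl⟩ := Finset.mem_map.mp hw
      obtain ⟨k', v'⟩ := w'
      change i (k', v') = i (k, v₀) at hww'
      change (k', v') = (k, v₀)
      have hkk : k' = k := (Finset.mem_filter.mp hk).2 k' v₀ v' hww'.symm
      subst hkk
      rw [hi k' hww']

/-- Every nonempty fibre of `g` has two elements or contains an element of `I`, so it counts at
least twice on the right. -/
theorem two_mul_card_le_of_fibers {κ X : Type*} [Fintype κ] (g : κ → X) (I : Finset κ)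
    (hI : ∀ k, k ∉ I → ∃ k', k' ≠ k ∧ g k' = g k) :
    2 * (Finset.univ.image g).card ≤ Fintype.card κ + I.card := by
  have h1 : Fintype.card κ = ∑ x ∈ Finset.univ.image g, (Finset.univ.filter fun k => g k = x).card := by
    rw [← Finset.card_univ]
    exact Finset.card_eq_sum_card_fiberwise fun k _ => Finset.mem_image_of_mem _ (Finset.mem_univ _)
  have h2 : I.card = ∑ x ∈ Finset.univ.image g, (I.filter fun k => g k = x).card :=
    Finset.card_eq_sum_card_fiberwise fun k _ => Finset.mem_image_of_mem _ (Finset.mem_univ _)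
  rw [h1, h2, ← Finset.sum_add_distrib, mul_comm, ← smul_eq_mul]
  refine Finset.card_nsmul_le_sum _ _ _ fun x hx => ?_
  obtain ⟨k, _, rfl⟩ := Finset.mem_image.mp hx
  by_cases hk : k ∈ I
  · have p1 : 0 < (Finset.univ.filter fun k' => g k' = g k).card :=
      Finset.card_pos.mpr ⟨k, by simp⟩
    have p2 : 0 < (I.filter fun k' => g k' = g k).card :=
      Finset.card_pos.mpr ⟨k, by simp [hk]⟩
    omega
  · obtain ⟨k', hne, hk'⟩ := hI k hk
    have : ({k', k} : Finset κ) ⊆ Finset.univ.filter fun k'' => g k'' = g k := by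
      intro z hz
      rcases Finset.mem_insert.mp hz with rfl | hz
      · simpa using hk'
      · rw [Finset.mem_singleton.mp hz]; simp
    have := Finset.card_le_card this
    rw [Finset.card_pair hne] at this
    omega

theorem ComponentsLE.eq_of_one {a : F → A} {b : F → B} (h : ComponentsLE a b 1) {X : Type u}
    {p : A → X} {q : B → X} (hpq : ∀ f, p (a f) = q (b f)) {x y : X}
    (hx : x ∈ Set.range p ∪ Set.range q) (hy : y ∈ Set.range p ∪ Set.range q) : x = y :=
  (Set.ncard_le_one (Set.toFinite _)).mp (h X p q hpq) x hx y hy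

/-- Each copy is connected and carries a single value. A copy that is not isolated shares its value
with another one, so the values are counted by `two_mul_card_le_of_fibers`. -/
theorem ComponentsLE.copies {a : F → A} {b : F → B} (h : ComponentsLE a b 1) (hA : Nonempty A)
    (P : Setoid (Fin K × A)) (R : Setoid (Fin K × B)) :
    ComponentsLE (_root_.quotEdge (copyEdge K a) P) (_root_.quotEdge (copyEdge K b) R)
      ((K + (isolatedCopies P).card) / 2) := by
  intro X p q hpq
  obtain ⟨v₀⟩ := hA
  set g : Fin K → X := fun k => p (Quotient.mk P (k, v₀)) with hg
  have hp : ∀ k v, p (Quotient.mk P (k, v)) = g k := fun k v =>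
    h.eq_of_one (p := fun v => p (Quotient.mk P (k, v))) (q := fun v => q (Quotient.mk R (k, v)))
      (fun f => hpq (k, f)) (Or.inl ⟨v, rfl⟩) (Or.inl ⟨v₀, rfl⟩)
  have hq : ∀ k v, q (Quotient.mk R (k, v)) = g k := fun k v =>
    h.eq_of_one (p := fun v => p (Quotient.mk P (k, v))) (q := fun v => q (Quotient.mk R (k, v)))
      (fun f => hpq (k, f)) (Or.inr ⟨v, rfl⟩) (Or.inl ⟨v₀, rfl⟩)
  have hsub : Set.range p ∪ Set.range q ⊆ ((Finset.univ.image g : Finset X) : Set X) := by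
    rintro x (⟨w, rfl⟩ | ⟨w, rfl⟩)
    · induction w using Quotient.ind with | _ w =>
      rw [← Prod.mk.eta (p := w), hp]; simp
    · induction w using Quotient.ind with | _ w =>
      rw [← Prod.mk.eta (p := w), hq]; simp
  have h1 := Set.ncard_le_ncard hsub (Set.toFinite _)
  rw [Set.ncard_coe_finset] at h1
  have h2 := two_mul_card_le_of_fibers g (isolatedCopies P) ?_
  · rw [Fintype.card_fin] at h2
    omega
  · intro k hk
    simp only [isolatedCopies, Finset.mem_filter, Finset.mem_univ, true_and, not_forall] at hk
    obtain ⟨k', v, v', hP, hne⟩ := hk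
    refine ⟨k', hne, ?_⟩
    rw [← hp k v, ← hp k' v', Quotient.sound hP]

end Copies

/-! ### Moments of contractions over distinct indices -/

section Moments

open scoped Classical

variable {A B F : Type u} [Fintype A] [Fintype B] [Fintype F] {n : ℕ}

/-- The indicator of injectivity. -/
noncomputable def injInd {α β : Type*} (i : α → β) : ℝ := if Function.Injective i then 1 else 0

/-- The labelled contraction over pairwise distinct indices. -/
noncomputable def injSum (a : F → A) (b : F → B) (H : Matrix (Fin n) (Fin n) ℝ)
    (α : A → Fin n → ℝ) (β : B → Fin n → ℝ) (s s' : SignedPerm n) : ℝ :=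
  ∑ i : A → Fin n, ∑ j : B → Fin n,
    (injInd i * sideProd a α s i) * (injInd j * sideProd b β s' j) * edgeProd H a b i j

theorem injSum_transpose (a : F → A) (b : F → B) (H : Matrix (Fin n) (Fin n) ℝ)
    (α : A → Fin n → ℝ) (β : B → Fin n → ℝ) (s s' : SignedPerm n) :
    injSum b a H.transpose β α s' s = injSum a b H α β s s' := by
  rw [injSum, Finset.sum_comm]
  refine Finset.sum_congr rfl fun i _ => Finset.sum_congr rfl fun j _ => ?_
  rw [edgeProd_transpose]
  ring

/-- The average over signed permutations of the side factors of `K` copies. -/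
noncomputable def copySum (K : ℕ) (a : F → A) (α : A → Fin n → ℝ) (i : Fin K × A → Fin n) : ℝ :=
  (∏ k, injInd fun v => i (k, v)) * ∑ s, sideProd (copyEdge K a) (fun w : Fin K × A => α w.2) s i

theorem sum_pow_eq_copies {M : Type*} [CommSemiring M] (K : ℕ)
    (g : (A → Fin n) → (B → Fin n) → M) :
    (∑ i, ∑ j, g i j) ^ K = ∑ i : Fin K × A → Fin n, ∑ j : Fin K × B → Fin n,
      ∏ k, g (fun v => i (k, v)) (fun v => j (k, v)) := by
  rw [← Fintype.sum_prod_type', Fintype.sum_pow, ← Fintype.sum_prod_type']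
  refine Fintype.sum_equiv ((Equiv.arrowProdEquivProdArrow _ _ _).trans
    ((Equiv.curry (Fin K) A (Fin n)).symm.prodCongr (Equiv.curry (Fin K) B (Fin n)).symm)) _ _ ?_
  intro p
  rfl

/-- The K-th power is a single contraction over K copies, and for given indices the averages over
the two signed permutations factor into one for each side. -/
theorem sum_injSum_pow (K : ℕ) (a : F → A) (b : F → B) (H : Matrix (Fin n) (Fin n) ℝ)
    (α : A → Fin n → ℝ) (β : B → Fin n → ℝ) :
    ∑ s, ∑ s', injSum a b H α β s s' ^ K =
      ∑ i : Fin K × A → Fin n, ∑ j : Fin K × B → Fin n,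
        copySum K a α i * copySum K b β j * edgeProd H (copyEdge K a) (copyEdge K b) i j := by
  have h : ∀ s s', injSum a b H α β s s' ^ K =
      ∑ i : Fin K × A → Fin n, ∑ j : Fin K × B → Fin n,
        ((∏ k, injInd fun v => i (k, v)) *
          sideProd (copyEdge K a) (fun w : Fin K × A => α w.2) s i) *
        ((∏ k, injInd fun v => j (k, v)) *
          sideProd (copyEdge K b) (fun w : Fin K × B => β w.2) s' j) *
        edgeProd H (copyEdge K a) (copyEdge K b) i j := by
    intro s s'
    rw [injSum, sum_pow_eq_copies]
    refine Finset.sum_congr rfl fun i _ => Finset.sum_congr rfl fun j _ => ?_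
    simp only [Finset.prod_mul_distrib, prod_sideProd, prod_edgeProd]
  simp_rw [h]
  have h2 : ∀ s : SignedPerm n, ∀ G : SignedPerm n → (Fin K × A → Fin n) →
      (Fin K × B → Fin n) → ℝ, ∑ s', ∑ i, ∑ j, G s' i j = ∑ i, ∑ j, ∑ s', G s' i j := by
    intro s G
    rw [Finset.sum_comm]
    exact Finset.sum_congr rfl fun i _ => Finset.sum_comm
  rw [Finset.sum_congr rfl fun s _ => h2 s _]
  rw [h2 (1, 1)]
  refine Finset.sum_congr rfl fun i _ => Finset.sum_congr rfl fun j _ => ?_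
  simp only [copySum]
  rw [Finset.mul_sum, Finset.mul_sum, Finset.sum_mul_sum, Finset.sum_mul]
  exact Finset.sum_congr rfl fun s _ => by rw [Finset.sum_mul]

theorem copySum_eq_of_ker_eq (K : ℕ) (a : F → A) (α : A → Fin n → ℝ) {i i' : Fin K × A → Fin n}
    (h : Setoid.ker i = Setoid.ker i') : copySum K a α i = copySum K a α i' := by
  rw [copySum, copySum, sum_sideProd_eq_of_ker_eq _ _ h]
  congr 1
  refine Finset.prod_congr rfl fun k _ => ?_
  have : Function.Injective (fun v => i (k, v)) ↔ Function.Injective (fun v => i' (k, v)) := by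
    have hk : ∀ v w, i (k, v) = i (k, w) ↔ i' (k, v) = i' (k, w) := fun v w => by
      rw [← Setoid.ker_def (f := i), h, Setoid.ker_def]
    simp only [Function.Injective, hk]
  unfold injInd
  by_cases hk : Function.Injective (fun v => i (k, v))
  · rw [if_pos hk, if_pos (this.1 hk)]
  · rw [if_neg hk, if_neg (mt this.2 hk)]

theorem injInd_nonneg {α β : Type*} (i : α → β) : 0 ≤ injInd i := by
  unfold injInd; split_ifs <;> norm_num

theorem injInd_le_one {α β : Type*} (i : α → β) : injInd i ≤ 1 := by
  unfold injInd; split_ifs <;> norm_num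

theorem abs_copySum_le (hn : 0 < n) (K : ℕ) (a : F → A) {α : A → Fin n → ℝ} {t : ℝ}
    (hα : ∀ v y, |α v y| ≤ t) (i : Fin K × A → Fin n) :
    |copySum K a α i| ≤ ((Fintype.card (Fin K × A)).factorial : ℝ) ^ 2 *
      Fintype.card (SignedPerm n) * t ^ Fintype.card (Fin K × A) := by
  have h := abs_sum_sideProd_le hn (copyEdge K a) (α := fun w : Fin K × A => α w.2)
        (fun w y => hα w.2 y) i (∅ : Finset (Fin K × A)) (fun v hv => absurd hv (by simp))
        (fun v hv => absurd hv (by simp))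
  rw [Finset.card_empty, pow_zero, mul_one] at h
  rw [copySum, abs_mul]
  refine (mul_le_of_le_one_left (abs_nonneg _) ?_).trans h
  rw [abs_of_nonneg (Finset.prod_nonneg fun k _ => injInd_nonneg _)]
  exact Finset.prod_le_one (fun k _ => injInd_nonneg _) fun k _ => injInd_le_one _

theorem abs_copySum_le_of_fluctuating (hn : 0 < n) (K : ℕ) (a : F → A) {α : A → Fin n → ℝ} {t : ℝ}
    (ht : 0 ≤ t) (hα : ∀ v y, |α v y| ≤ t) (h : Fluctuating a α) (i : Fin K × A → Fin n) :
    |copySum K a α i| ≤ ((Fintype.card (Fin K × A)).factorial : ℝ) ^ 2 *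
      Fintype.card (SignedPerm n) * t ^ Fintype.card (Fin K × A) *
        (√n)⁻¹ ^ (isolatedCopies (Setoid.ker i)).card := by
  by_cases hi : ∀ k, Function.Injective fun v => i (k, v)
  · rw [copySum, Finset.prod_eq_one (fun k _ => by simp [injInd, hi k]), one_mul]
    exact abs_sum_sideProd_copies_le hn a ht hα h i hi
  · push Not at hi
    obtain ⟨k, hk⟩ := hi
    rw [copySum, Finset.prod_eq_zero (Finset.mem_univ k) (by simp [injInd, hk]), zero_mul, abs_zero]
    positivity

theorem evenIncidence_of_copySum_ne_zero (K : ℕ) (a : F → A) (α : A → Fin n → ℝ)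
    (i : Fin K × A → Fin n) (h : copySum K a α i ≠ 0) :
    EvenIncidence (quotEdge (copyEdge K a) (Setoid.ker i)) :=
  evenIncidence_of_sum_sideProd_ne_zero _ _ _ (right_ne_zero_of_mul h)

theorem sum_ker_mul_edgeProd (H : Matrix (Fin n) (Fin n) ℝ) (a : F → A) (b : F → B)
    (g : Setoid A → ℝ) (g' : Setoid B → ℝ) :
    ∑ i : A → Fin n, ∑ j : B → Fin n, g (Setoid.ker i) * g' (Setoid.ker j) * edgeProd H a b i j =
      ∑ P : Setoid A, ∑ R : Setoid B, g P * g' R * kernelSum H a b P R := by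
  rw [← Finset.sum_fiberwise (s := Finset.univ) (g := fun i : A → Fin n => Setoid.ker i)]
  refine Finset.sum_congr rfl fun P _ => ?_
  have h1 : ∀ i : A → Fin n, ∑ j : B → Fin n,
      g (Setoid.ker i) * g' (Setoid.ker j) * edgeProd H a b i j =
      ∑ R : Setoid B, ∑ j : B → Fin n with Setoid.ker j = R,
        g (Setoid.ker i) * g' R * edgeProd H a b i j := by
    intro i
    rw [← Finset.sum_fiberwise (s := Finset.univ) (g := fun j : B → Fin n => Setoid.ker j)]
    refine Finset.sum_congr rfl fun R _ => Finset.sum_congr rfl fun j hj => ?_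
    rw [(Finset.mem_filter.mp hj).2]
  simp_rw [h1]
  rw [Finset.sum_comm]
  refine Finset.sum_congr rfl fun R _ => ?_
  rw [kernelSum, Finset.mul_sum]
  refine Finset.sum_congr rfl fun i hi => ?_
  rw [(Finset.mem_filter.mp hi).2, Finset.mul_sum]

/-- Group the expanded power by the coincidences of the indices; pairs of partitions with an odd
degree contribute nothing. If I copies are isolated on the fluctuating side, the label averages give
n^(-I/2) and the contraction of `H` gives at most n^((K+I)/2), which leaves n^(K/2). The number of
partitions and all constants are independent of `n`. -/
theorem exists_moment_bound (a : F → A) (b : F → B) (hc : ComponentsLE a b 1) (K : ℕ) :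
    ∃ (C : ℝ) (D : ℕ), 0 ≤ C ∧ ∀ n : ℕ, 0 < n → ∀ H ∈ Matrix.orthogonalGroup (Fin n) ℝ,
      ∀ t : ℝ, 1 ≤ t → (∀ i j, |H i j| ≤ t / √n) →
      ∀ (α : A → Fin n → ℝ) (β : B → Fin n → ℝ), (∀ v y, |α v y| ≤ t) → (∀ v y, |β v y| ≤ t) →
      Fluctuating a α →
      |∑ s, ∑ s', injSum a b H α β s s' ^ K| ≤
        C * t ^ D * (Fintype.card (SignedPerm n) : ℝ) ^ 2 * √n ^ K := by
  have hE : ∀ (P : Setoid (Fin K × A)) (R : Setoid (Fin K × B)), ∃ C : ℝ, 0 ≤ C ∧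
      (Nonempty A → EvenIncidence (quotEdge (copyEdge K a) P) →
        EvenIncidence (quotEdge (copyEdge K b) R) →
        ∀ n : ℕ, 0 < n → ∀ H ∈ Matrix.orthogonalGroup (Fin n) ℝ, ∀ t : ℝ, 1 ≤ t →
        (∀ i j, |H i j| ≤ t / √n) →
        |kernelSum H (copyEdge K a) (copyEdge K b) P R| ≤
          C * t ^ Fintype.card (Fin K × F) * (n : ℝ) ^ ((K + (isolatedCopies P).card) / 2)) := by
    intro P R
    by_cases h : Nonempty A ∧ EvenIncidence (quotEdge (copyEdge K a) P) ∧
      EvenIncidence (quotEdge (copyEdge K b) R)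
    · obtain ⟨C, hC, hb⟩ := exists_abs_kernelSum_le (copyEdge K a) (copyEdge K b) _ P R h.2.1 h.2.2
        (hc.copies h.1 P R)
      exact ⟨C, hC, fun _ _ _ => hb⟩
    · exact ⟨0, le_rfl, fun h1 h2 h3 => absurd ⟨h1, h2, h3⟩ h⟩
  choose E hE0 hE using hE
  refine ⟨∑ P, ∑ R, ((Fintype.card (Fin K × A)).factorial : ℝ) ^ 2 *
    ((Fintype.card (Fin K × B)).factorial : ℝ) ^ 2 * E P R,
    Fintype.card (Fin K × A) + Fintype.card (Fin K × B) + Fintype.card (Fin K × F),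
    Finset.sum_nonneg fun P _ => Finset.sum_nonneg fun R _ => mul_nonneg (by positivity) (hE0 P R),
    fun n hn H hH t ht hHt α β hα hβ hfl => ?_⟩
  have hn' : (0 : ℝ) < n := by exact_mod_cast hn
  have hn1 : (1 : ℝ) ≤ n := by exact_mod_cast hn
  have hs : (0 : ℝ) < √n := Real.sqrt_pos.mpr hn'
  have hs1 : (1 : ℝ) ≤ √n := Real.one_le_sqrt.mpr hn1
  have ht0 : 0 ≤ t := by linarith
  -- The average depends on the assignment only through its kernel, so it factors through a function
  -- of partitions. A partition which is not the kernel of a map to `Fin n` gets the value 0.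
  obtain ⟨g, hg⟩ : ∃ g : Setoid (Fin K × A) → ℝ,
      g = Function.extend (fun i : Fin K × A → Fin n => Setoid.ker i) (copySum K a α) 0 := ⟨_, rfl⟩
  obtain ⟨g', hg'⟩ : ∃ g : Setoid (Fin K × B) → ℝ,
      g = Function.extend (fun i : Fin K × B → Fin n => Setoid.ker i) (copySum K b β) 0 := ⟨_, rfl⟩
  have hgi : ∀ i, copySum K a α i = g (Setoid.ker i) := fun i => by
    rw [hg]
    exact (Function.FactorsThrough.extend_apply (f := fun i : Fin K × A → Fin n => Setoid.ker i)
      (fun i i' h => copySum_eq_of_ker_eq K a α h) 0 i).symm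
  have hgi' : ∀ i, copySum K b β i = g' (Setoid.ker i) := fun i => by
    rw [hg']
    exact (Function.FactorsThrough.extend_apply (f := fun i : Fin K × B → Fin n => Setoid.ker i)
      (fun i i' h => copySum_eq_of_ker_eq K b β h) 0 i).symm
  have hsum : ∑ s, ∑ s', injSum a b H α β s s' ^ K = ∑ P, ∑ R, g P * g' R *
      kernelSum H (copyEdge K a) (copyEdge K b) P R := by
    rw [sum_injSum_pow]
    simp_rw [hgi, hgi']
    rw [← sum_ker_mul_edgeProd]
    congr!
  rw [hsum, Finset.sum_mul, Finset.sum_mul, Finset.sum_mul]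
  refine (Finset.abs_sum_le_sum_abs _ _).trans (Finset.sum_le_sum fun P _ => ?_)
  rw [Finset.sum_mul, Finset.sum_mul, Finset.sum_mul]
  refine (Finset.abs_sum_le_sum_abs _ _).trans (Finset.sum_le_sum fun R _ => ?_)
  have hnn : 0 ≤ ((Fintype.card (Fin K × A)).factorial : ℝ) ^ 2 *
      ((Fintype.card (Fin K × B)).factorial : ℝ) ^ 2 * E P R *
      t ^ (Fintype.card (Fin K × A) + Fintype.card (Fin K × B) + Fintype.card (Fin K × F)) *
      (Fintype.card (SignedPerm n) : ℝ) ^ 2 * √n ^ K := by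
    have := hE0 P R
    positivity
  by_cases hP : g P = 0
  · rw [hP, zero_mul, zero_mul, abs_zero]; exact hnn
  by_cases hR : g' R = 0
  · rw [hR, mul_zero, zero_mul, abs_zero]; exact hnn
  obtain ⟨i, rfl⟩ : ∃ i : Fin K × A → Fin n, Setoid.ker i = P := by
    by_contra hne
    exact hP (by rw [hg, Function.extend_apply' _ _ _ hne]; rfl)
  obtain ⟨j, rfl⟩ : ∃ j : Fin K × B → Fin n, Setoid.ker j = R := by
    by_contra hne
    exact hR (by rw [hg', Function.extend_apply' _ _ _ hne]; rfl)
  rw [← hgi] at hP ⊢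
  rw [← hgi'] at hR ⊢
  have h1 := abs_copySum_le_of_fluctuating hn K a ht0 hα hfl i
  have h2 := abs_copySum_le hn K b hβ j
  have h3 := hE _ _ hfl.nonempty (evenIncidence_of_copySum_ne_zero K a α i hP)
    (evenIncidence_of_copySum_ne_zero K b β j hR) n hn H hH t ht hHt
  set I := (isolatedCopies (Setoid.ker i)).card
  have hpow : (√n)⁻¹ ^ I * (n : ℝ) ^ ((K + I) / 2) ≤ √n ^ K := by
    have hsq : (n : ℝ) = √n ^ 2 := (Real.sq_sqrt hn'.le).symm
    nth_rewrite 2 [hsq]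
    rw [← pow_mul, inv_pow, inv_mul_le_iff₀ (by positivity), ← pow_add]
    exact pow_le_pow_right₀ hs1 (by omega)
  rw [abs_mul, abs_mul]
  have hE' := hE0 (Setoid.ker i) (Setoid.ker j)
  refine (mul_le_mul (mul_le_mul h1 h2 (abs_nonneg _) (by positivity)) h3 (abs_nonneg _)
    (by positivity)).trans ?_
  refine le_of_eq_of_le ?_ (mul_le_mul_of_nonneg_left hpow
    (a := ((Fintype.card (Fin K × A)).factorial : ℝ) ^ 2 *
      ((Fintype.card (Fin K × B)).factorial : ℝ) ^ 2 * E (Setoid.ker i) (Setoid.ker j) *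
      t ^ (Fintype.card (Fin K × A) + Fintype.card (Fin K × B) + Fintype.card (Fin K × F)) *
      (Fintype.card (SignedPerm n) : ℝ) ^ 2) (by positivity))
  rw [pow_add, pow_add]
  ring

end Moments

/-! ### Observables of fluctuation size -/

section PowBounded

open scoped Classical

variable {A B F : Type u} [Fintype A] [Fintype B] [Fintype F]

/-- A delocalized orthogonal matrix and bounded labels. -/
structure Admissible (n : ℕ) (H : Matrix (Fin n) (Fin n) ℝ) (t : ℝ) (α : A → Fin n → ℝ)
    (β : B → Fin n → ℝ) : Prop where
  pos : 0 < n
  orth : H ∈ Matrix.orthogonalGroup (Fin n) ℝ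
  one_le : 1 ≤ t
  deloc : ∀ i j, |H i j| ≤ t / √n
  left : ∀ v y, |α v y| ≤ t
  right : ∀ v y, |β v y| ≤ t

theorem transpose_mem_orthogonalGroup {n : ℕ} {H : Matrix (Fin n) (Fin n) ℝ}
    (hH : H ∈ Matrix.orthogonalGroup (Fin n) ℝ) :
    H.transpose ∈ Matrix.orthogonalGroup (Fin n) ℝ := by
  rw [Matrix.mem_orthogonalGroup_iff]
  simpa using (Matrix.mem_orthogonalGroup_iff' _ _).mp hH

theorem Admissible.swap {n : ℕ} {H : Matrix (Fin n) (Fin n) ℝ} {t : ℝ} {α : A → Fin n → ℝ}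
    {β : B → Fin n → ℝ} (h : Admissible n H t α β) : Admissible n H.transpose t β α :=
  ⟨h.pos, transpose_mem_orthogonalGroup h.orth, h.one_le, fun i j => h.deloc j i, h.right, h.left⟩

theorem Admissible.mono {n : ℕ} {H : Matrix (Fin n) (Fin n) ℝ} {t t' : ℝ} {α : A → Fin n → ℝ}
    {β : B → Fin n → ℝ} (h : Admissible n H t α β) (ht : t ≤ t') : Admissible n H t' α β :=
  ⟨h.pos, h.orth, h.one_le.trans ht, fun i j => (h.deloc i j).trans (by gcongr),
    fun v y => (h.left v y).trans ht, fun v y => (h.right v y).trans ht⟩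

/-- Quantities depending on a matrix, labels, and two signed permutations. -/
abbrev Observable (A B : Type u) : Type u :=
  ∀ n : ℕ, Matrix (Fin n) (Fin n) ℝ → (A → Fin n → ℝ) → (B → Fin n → ℝ) →
    SignedPerm n → SignedPerm n → ℝ

/-- The `K`-th moment is at most of order `n ^ (K / 2)`. -/
def PowBounded (K : ℕ) (X : Observable A B) : Prop :=
  ∃ (C : ℝ) (D : ℕ), 0 ≤ C ∧ ∀ n H t α β, Admissible n H t α β →
    ∑ s, ∑ s', X n H α β s s' ^ K ≤
      C * t ^ D * (Fintype.card (SignedPerm n) : ℝ) ^ 2 * √n ^ K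

theorem PowBounded.add {K : ℕ} (hK : Even K) {X Y : Observable A B} (hX : PowBounded K X)
    (hY : PowBounded K Y) :
    PowBounded K (fun n H α β s s' => X n H α β s s' + Y n H α β s s') := by
  obtain ⟨C, D, hC, hX⟩ := hX
  obtain ⟨C', D', hC', hY⟩ := hY
  refine ⟨2 ^ (K - 1) * (C + C'), D + D', by positivity, fun n H t α β h => ?_⟩
  have h1 := hX n H t α β h
  have h2 := hY n H t α β h
  have ht := h.one_le
  have ht0 : 0 ≤ t := by linarith
  have e1 : C * t ^ D ≤ C * t ^ (D + D') := by gcongr; omega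
  have e2 : C' * t ^ D' ≤ C' * t ^ (D + D') := by gcongr; omega
  calc ∑ s, ∑ s', (X n H α β s s' + Y n H α β s s') ^ K
      ≤ ∑ s, ∑ s', 2 ^ (K - 1) * (X n H α β s s' ^ K + Y n H α β s s' ^ K) :=
        Finset.sum_le_sum fun s _ => Finset.sum_le_sum fun s' _ => hK.add_pow_le
    _ = 2 ^ (K - 1) * ((∑ s, ∑ s', X n H α β s s' ^ K) + ∑ s, ∑ s', Y n H α β s s' ^ K) := by
        simp only [Finset.mul_sum, ← Finset.sum_add_distrib]
    _ ≤ 2 ^ (K - 1) * (C * t ^ (D + D') * (Fintype.card (SignedPerm n) : ℝ) ^ 2 * √n ^ K +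
          C' * t ^ (D + D') * (Fintype.card (SignedPerm n) : ℝ) ^ 2 * √n ^ K) := by
        gcongr
        · exact h1.trans (by gcongr)
        · exact h2.trans (by gcongr)
    _ = _ := by ring

theorem PowBounded.of_abs_le {K : ℕ} (hK : Even K) {X : Observable A B} {C : ℝ} {D : ℕ}
    (hC : 0 ≤ C) (h : ∀ n H t α β, Admissible n H t α β → ∀ s s', |X n H α β s s'| ≤ C * t ^ D) :
    PowBounded K X := by
  refine ⟨C ^ K, D * K, by positivity, fun n H t α β ha => ?_⟩
  have hn1 : (1 : ℝ) ≤ n := by exact_mod_cast ha.pos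
  have hs1 : (1 : ℝ) ≤ √n ^ K := one_le_pow₀ (Real.one_le_sqrt.mpr hn1)
  have ht0 : 0 ≤ t := by linarith [ha.one_le]
  calc ∑ s, ∑ s', X n H α β s s' ^ K ≤ ∑ _s : SignedPerm n, ∑ _s' : SignedPerm n,
        (C * t ^ D) ^ K := by
        refine Finset.sum_le_sum fun s _ => Finset.sum_le_sum fun s' _ => ?_
        rw [← hK.pow_abs]
        gcongr
        exact h n H t α β ha s s'
    _ = C ^ K * t ^ (D * K) * (Fintype.card (SignedPerm n) : ℝ) ^ 2 := by
        simp only [Finset.sum_const, Finset.card_univ, nsmul_eq_mul]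
        ring
    _ ≤ _ := le_mul_of_one_le_right (by positivity) hs1

theorem PowBounded.zero {K : ℕ} (hK : Even K) :
    PowBounded K (fun _ _ _ _ _ _ => 0 : Observable A B) :=
  PowBounded.of_abs_le hK (C := 0) (D := 0) le_rfl (by simp)

theorem PowBounded.sum {K : ℕ} (hK : Even K) {ι : Type*} (S : Finset ι)
    {X : ι → Observable A B} (hX : ∀ p ∈ S, PowBounded K (X p)) :
    PowBounded K (fun n H α β s s' => ∑ p ∈ S, X p n H α β s s') := by
  induction S using Finset.induction_on with
  | empty => simpa using PowBounded.zero hK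
  | insert p S hp ih =>
    simp_rw [Finset.sum_insert hp]
    exact (hX p (Finset.mem_insert_self _ _)).add hK
      (ih fun q hq => hX q (Finset.mem_insert_of_mem hq))

theorem PowBounded.congr {K : ℕ} {X Y : Observable A B} (hX : PowBounded K X)
    (h : ∀ n H t α β, Admissible n H t α β → ∀ s s', Y n H α β s s' = X n H α β s s') :
    PowBounded K Y := by
  obtain ⟨C, D, hC, hX⟩ := hX
  refine ⟨C, D, hC, fun n H t α β ha => ?_⟩
  simp_rw [h n H t α β ha]
  exact hX n H t α β ha

theorem PowBounded.swap {K : ℕ} {X : Observable A B} (hX : PowBounded K X) :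
    PowBounded K (fun n H β α s' s => X n H.transpose α β s s' : Observable B A) := by
  obtain ⟨C, D, hC, hX⟩ := hX
  refine ⟨C, D, hC, fun n H t α β ha => ?_⟩
  rw [Finset.sum_comm]
  exact hX n H.transpose t β α ha.swap

/-- A polynomial loss in the size `t` of the labels is harmless, because `PowBounded` allows an
arbitrary power of `t`. -/
theorem PowBounded.comp {K : ℕ} {A' B' : Type u} [Fintype A'] [Fintype B'] {X : Observable A' B'}
    (hX : PowBounded K X) (φ : ∀ n, (A → Fin n → ℝ) → A' → Fin n → ℝ)
    (ψ : ∀ n, (B → Fin n → ℝ) → B' → Fin n → ℝ) (c N : ℕ)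
    (h : ∀ n H t α β, Admissible n H t α β → Admissible n H (c * t ^ N) (φ n α) (ψ n β)) :
    PowBounded K (fun n H α β s s' => X n H (φ n α) (ψ n β) s s' : Observable A B) := by
  obtain ⟨C, D, hC, hX⟩ := hX
  refine ⟨C * (c : ℝ) ^ D, N * D, by positivity, fun n H t α β ha => ?_⟩
  refine (hX n H _ _ _ (h n H t α β ha)).trans (le_of_eq ?_)
  rw [mul_pow, ← pow_mul]
  ring

end PowBounded

/-! ### Replacing labels by their averages -/

section Centring

open scoped Classical

variable {A B F : Type u} [Fintype A] [Fintype B] [Fintype F] {n : ℕ}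

/-- The average of a label. -/
noncomputable def labelMean (f : Fin n → ℝ) : ℝ := (1 / (n : ℝ)) * ∑ y, f y

theorem abs_labelMean_le (hn : 0 < n) {f : Fin n → ℝ} {t : ℝ} (h : ∀ y, |f y| ≤ t) :
    |labelMean f| ≤ t := by
  have hn' : (0 : ℝ) < n := by exact_mod_cast hn
  rw [labelMean, abs_mul, abs_of_pos (by positivity), one_div, inv_mul_le_iff₀ hn']
  refine (Finset.abs_sum_le_sum_abs _ _).trans ((Finset.sum_le_sum fun y _ => h y).trans ?_)
  simp

theorem sum_sub_labelMean (hn : 0 < n) (f : Fin n → ℝ) : ∑ y, (f y - labelMean f) = 0 := by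
  have hn' : (n : ℝ) ≠ 0 := by exact_mod_cast hn.ne'
  rw [Finset.sum_sub_distrib, Finset.sum_const, Finset.card_univ, Fintype.card_fin, nsmul_eq_mul,
    labelMean]
  field_simp
  ring

theorem sideProd_update (a : F → A) (α : A → Fin n → ℝ) (v : A) (f g : Fin n → ℝ)
    (s : SignedPerm n) (i : A → Fin n) :
    sideProd a (Function.update α v (fun y => f y - g y)) s i =
      sideProd a (Function.update α v f) s i - sideProd a (Function.update α v g) s i := by
  have h : ∀ f : Fin n → ℝ, ∏ w, Function.update α v f w (s.1 (i w)) =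
      f (s.1 (i v)) * ∏ w ∈ Finset.univ.erase v, α w (s.1 (i w)) := by
    intro f
    rw [← Finset.mul_prod_erase _ _ (Finset.mem_univ v), Function.update_self]
    congr 1
    refine Finset.prod_congr rfl fun w hw => ?_
    rw [Function.update_of_ne (Finset.ne_of_mem_erase hw)]
  simp only [sideProd, h]
  ring

theorem injSum_update (a : F → A) (b : F → B) (H : Matrix (Fin n) (Fin n) ℝ)
    (α : A → Fin n → ℝ) (β : B → Fin n → ℝ) (v : A) (f g : Fin n → ℝ) (s s' : SignedPerm n) :
    injSum a b H (Function.update α v (fun y => f y - g y)) β s s' =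
      injSum a b H (Function.update α v f) β s s' -
        injSum a b H (Function.update α v g) β s s' := by
  simp only [injSum, ← Finset.sum_sub_distrib, sideProd_update]
  refine Finset.sum_congr rfl fun i _ => Finset.sum_congr rfl fun j _ => ?_
  ring

/-- Replace the labels of the vertices in `U` by their averages. -/
noncomputable def meanOn (U : Finset A) (α : A → Fin n → ℝ) (v : A) : Fin n → ℝ :=
  if v ∈ U then fun _ => labelMean (α v) else α v

theorem abs_meanOn_le (hn : 0 < n) {α : A → Fin n → ℝ} {t : ℝ} (h : ∀ v y, |α v y| ≤ t)
    (U : Finset A) (v : A) (y : Fin n) : |meanOn U α v y| ≤ t := by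
  unfold meanOn
  split_ifs
  · exact abs_labelMean_le hn (h v)
  · exact h v y

/-- The moment bound as a statement about observables, after a change `φ` of the labels. The factor
2 leaves room for subtracting a mean from a label. -/
theorem powBounded_injSum_of_fluctuating (a : F → A) (b : F → B) (hc : ComponentsLE a b 1) (K : ℕ)
    (φ : ∀ n, (A → Fin n → ℝ) → A → Fin n → ℝ)
    (hφ : ∀ n t (α : A → Fin n → ℝ), 0 < n → 0 ≤ t → (∀ v y, |α v y| ≤ t) →
      ∀ v y, |φ n α v y| ≤ 2 * t)
    (hfl : ∀ n α, 0 < n → Fluctuating a (φ n α)) :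
    PowBounded K (fun _ H α β s s' => injSum a b H (φ _ α) β s s') := by
  obtain ⟨C, D, hC, h⟩ := exists_moment_bound a b hc K
  refine ⟨C * 2 ^ D, D, by positivity, fun n H t α β ha => (le_abs_self _).trans ?_⟩
  have ht0 : 0 ≤ t := by linarith [ha.one_le]
  have ha' := ha.mono (t' := 2 * t) (by linarith)
  refine (h n ha.pos H ha.orth (2 * t) ha'.one_le ha'.deloc _ β
    (hφ n t α ha.pos ht0 ha.left) ha'.right (hfl n α ha.pos)).trans (le_of_eq ?_)
  rw [mul_pow]
  ring

/-- Replace one label at a time. By multilinearity, the error is a contraction with a centred label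
at the replaced vertex, hence a fluctuation. -/
theorem powBounded_injSum_sub_meanOn (a : F → A) (b : F → B) (hc : ComponentsLE a b 1) {K : ℕ}
    (hK : Even K) (U : Finset A) :
    PowBounded K (fun _ H α β s s' => injSum a b H α β s s' - injSum a b H (meanOn U α) β s s') := by
  induction U using Finset.induction_on with
  | empty =>
    refine (PowBounded.zero hK).congr fun n H t α β _ s s' => ?_
    have : meanOn ∅ α = α := by funext v; simp [meanOn]
    rw [this, sub_self]
  | insert v U hv ih =>
    have hstep := powBounded_injSum_of_fluctuating a b hc K
      (fun n α => Function.update (meanOn U α) v (fun y => α v y - labelMean (α v))) ?_ ?_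
    · refine (ih.add hK hstep).congr fun n H t α β _ s s' => ?_
      have h1 : Function.update (meanOn U α) v (α v) = meanOn U α := by
        rw [Function.update_eq_self_iff]
        simp [meanOn, hv]
      have h2 : Function.update (meanOn U α) v (fun _ => labelMean (α v)) =
          meanOn (insert v U) α := by
        funext w
        by_cases hw : w = v
        · subst hw; simp [meanOn]
        · rw [Function.update_of_ne hw]; simp [meanOn, hw]
      rw [injSum_update a b H (meanOn U α) β v (α v) (fun _ => labelMean (α v)), h1, h2]
      ring
    · intro n t α hn ht hα w y
      by_cases hw : w = v
      · subst hw
        rw [Function.update_self]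
        refine (abs_sub _ _).trans ?_
        linarith [hα w y, abs_labelMean_le hn (hα w)]
      · rw [Function.update_of_ne hw]
        linarith [abs_meanOn_le hn hα U w y]
    · intro n α hn
      exact Or.inr ⟨v, by rw [Function.update_self]; exact sum_sub_labelMean hn (α v)⟩

/-- With even degrees the signs cancel, and constant labels do not see the permutation, so no
randomness is left. -/
theorem sideProd_meanOn_univ {a : F → A} (ha : EvenIncidence a) (α : A → Fin n → ℝ)
    (s : SignedPerm n) (i : A → Fin n) :
    sideProd a (meanOn Finset.univ α) s i = ∏ v, labelMean (α v) := by
  have h1 : ∏ f, ((s.2 (i (a f)) : ℤ) : ℝ) = 1 := by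
    have := ha fun v => s.2 (i v)
    have h2 : ∏ f, ((s.2 (i (a f)) : ℤ) : ℝ) = (((∏ f, s.2 (i (a f)) : ℤˣ) : ℤ) : ℝ) := by
      push_cast; rfl
    rw [h2, this]; simp
  rw [sideProd, h1, mul_one]
  simp [meanOn]

theorem ker_eq_bot_iff {i : A → Fin n} : Setoid.ker i = ⊥ ↔ Function.Injective i :=
  ⟨fun h x y hxy => by
    have : Setoid.ker i x y := hxy
    rw [h] at this
    exact this, fun h => Setoid.ext fun x y => ⟨fun hxy => h hxy, fun hxy => congrArg i hxy⟩⟩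

theorem sum_injInd_edgeProd (a : F → A) (b : F → B) (H : Matrix (Fin n) (Fin n) ℝ) :
    ∑ i : A → Fin n, ∑ j : B → Fin n, injInd i * injInd j * edgeProd H a b i j =
      kernelSum H a b ⊥ ⊥ := by
  rw [kernelSum, Finset.sum_filter]
  refine Finset.sum_congr rfl fun i _ => ?_
  by_cases hi : Function.Injective i
  · rw [if_pos (ker_eq_bot_iff.mpr hi), Finset.sum_filter]
    refine Finset.sum_congr rfl fun j _ => ?_
    by_cases hj : Function.Injective j
    · rw [if_pos (ker_eq_bot_iff.mpr hj)]; simp [injInd, hi, hj]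
    · rw [if_neg (mt ker_eq_bot_iff.mp hj)]; simp [injInd, hj]
  · rw [if_neg (mt ker_eq_bot_iff.mp hi)]
    simp [injInd, hi]

theorem injSum_meanOn_univ {a : F → A} {b : F → B} (ha : EvenIncidence a) (hb : EvenIncidence b)
    (H : Matrix (Fin n) (Fin n) ℝ) (α : A → Fin n → ℝ) (β : B → Fin n → ℝ) (s s' : SignedPerm n) :
    injSum a b H (meanOn Finset.univ α) (meanOn Finset.univ β) s s' =
      (∏ v, labelMean (α v)) * (∏ v, labelMean (β v)) * kernelSum H a b ⊥ ⊥ := by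
  rw [← sum_injInd_edgeProd, Finset.mul_sum]
  refine Finset.sum_congr rfl fun i _ => ?_
  rw [Finset.mul_sum]
  refine Finset.sum_congr rfl fun j _ => ?_
  rw [sideProd_meanOn_univ ha, sideProd_meanOn_univ hb]
  ring

theorem abs_prod_labelMean_le (hn : 0 < n) {α : A → Fin n → ℝ} {t : ℝ} (h : ∀ v y, |α v y| ≤ t) :
    |∏ v, labelMean (α v)| ≤ t ^ Fintype.card A := by
  rw [Finset.abs_prod, ← Finset.card_univ, ← Finset.prod_const]
  exact Finset.prod_le_prod (fun _ _ => abs_nonneg _) fun v _ => abs_labelMean_le hn (h v)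

/-- Labelled contractions over distinct indices concentrate. -/
theorem exists_powBounded_injSum (a : F → A) (b : F → B) (hc : ComponentsLE a b 1) {K : ℕ}
    (hK : Even K) :
    ∃ κ : ℝ, PowBounded K (fun n H α β s s' => injSum a b H α β s s' -
      n * ((∏ v, labelMean (α v)) * (∏ v, labelMean (β v)) * κ)) := by
  -- If a side has an odd degree, the whole contraction is a fluctuation and the constant is 0.
  by_cases ha : EvenIncidence a
  swap
  · refine ⟨0, ?_⟩
    refine (powBounded_injSum_of_fluctuating a b hc K (fun n α => α)
      (fun n t α _ ht h v y => by linarith [h v y]) (fun n α _ => Or.inl ha)).congr ?_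
    intro n H t α β _ s s'
    ring
  by_cases hb : EvenIncidence b
  swap
  · refine ⟨0, ?_⟩
    refine (powBounded_injSum_of_fluctuating b a hc.swap K (fun n α => α)
      (fun n t α _ ht h v y => by linarith [h v y]) (fun n α _ => Or.inl hb)).swap.congr ?_
    intro n H t α β _ s s'
    rw [injSum_transpose]
    ring
  -- The pair of trivial partitions encodes distinct indices on both sides. The relative error 1/n
  -- becomes an absolute error of order one in n, below the fluctuation scale √n.
  obtain ⟨κ, C, hC, hκ⟩ := exists_kernelSum_limit a b 1 (⊥, ⊥) (ha.quotEdge ⊥) (hb.quotEdge ⊥)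
    (hc.quotEdge ⊥ ⊥)
  refine ⟨κ, ?_⟩
  have h1 := powBounded_injSum_sub_meanOn a b hc hK Finset.univ
  have h2 : PowBounded K (fun _ H α β s s' => injSum a b H (meanOn Finset.univ α) β s s' -
      injSum a b H (meanOn Finset.univ α) (meanOn Finset.univ β) s s' : Observable A B) := by
    have := (powBounded_injSum_sub_meanOn b a hc.swap hK Finset.univ).swap
    simp only [injSum_transpose] at this
    have := this.comp (A := A) (B := B) (fun n α => meanOn Finset.univ α) (fun n β => β) 1 1
      (fun n H t α β h => by
        rw [pow_one, Nat.cast_one, one_mul]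
        exact ⟨h.pos, h.orth, h.one_le, h.deloc, abs_meanOn_le h.pos h.left _, h.right⟩)
    exact this
  have h3 : PowBounded K (fun n H α β _ _ => (∏ v, labelMean (α v)) * (∏ v, labelMean (β v)) *
      (kernelSum H a b ⊥ ⊥ - n * κ) : Observable A B) := by
    refine PowBounded.of_abs_le hK (C := C)
      (D := Fintype.card A + Fintype.card B + Fintype.card F) hC fun n H t α β h _ _ => ?_
    have hn' : (0 : ℝ) < n := by exact_mod_cast h.pos
    have ht0 : 0 ≤ t := by linarith [h.one_le]
    have h4 := hκ n h.pos H h.orth t h.one_le h.deloc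
    have h5 : |kernelSum H a b ⊥ ⊥ - n * κ| ≤ C * t ^ Fintype.card F := by
      have : kernelSum H a b ⊥ ⊥ - n * κ = n * (kernelSum H a b ⊥ ⊥ / (n : ℝ) ^ 1 - κ) := by
        field_simp
      rw [this, abs_mul, abs_of_pos hn']
      calc _ ≤ n * (C * (t ^ Fintype.card F / n)) := by gcongr
        _ = _ := by field_simp
    rw [abs_mul, abs_mul]
    calc _ ≤ t ^ Fintype.card A * t ^ Fintype.card B * (C * t ^ Fintype.card F) :=
          mul_le_mul (mul_le_mul (abs_prod_labelMean_le h.pos h.left)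
            (abs_prod_labelMean_le h.pos h.right) (abs_nonneg _) (by positivity)) h5
            (abs_nonneg _) (by positivity)
      _ = _ := by rw [pow_add, pow_add]; ring
  refine ((h1.add hK h2).add hK h3).congr fun n H t α β _ s s' => ?_
  rw [injSum_meanOn_univ ha hb]
  ring

end Centring

/-! ### Contractions over all indices -/

section FullSum

open scoped Classical

variable {A B F : Type u} [Fintype A] [Fintype B] [Fintype F] {n : ℕ}

/-- The labelled contraction over all indices. -/
noncomputable def fullSum (a : F → A) (b : F → B) (H : Matrix (Fin n) (Fin n) ℝ)
    (α : A → Fin n → ℝ) (β : B → Fin n → ℝ) (s s' : SignedPerm n) : ℝ :=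
  ∑ i : A → Fin n, ∑ j : B → Fin n, sideProd a α s i * sideProd b β s' j * edgeProd H a b i j

/-- The vertices in a block of a partition. -/
noncomputable def block (S : Setoid A) (x : Quotient S) : Finset A :=
  Finset.univ.filter fun v => Quotient.mk S v = x

/-- The product of the labels over each block. -/
noncomputable def blockLabel (S : Setoid A) (α : A → Fin n → ℝ) (x : Quotient S) (y : Fin n) : ℝ :=
  ∏ v ∈ block S x, α v y

theorem abs_blockLabel_le {α : A → Fin n → ℝ} {t : ℝ} (ht : 1 ≤ t) (h : ∀ v y, |α v y| ≤ t)
    (S : Setoid A) (x : Quotient S) (y : Fin n) : |blockLabel S α x y| ≤ t ^ Fintype.card A := by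
  rw [blockLabel, Finset.abs_prod]
  calc _ ≤ ∏ _v ∈ block S x, t :=
        Finset.prod_le_prod (fun _ _ => abs_nonneg _) fun v _ => h v y
    _ ≤ _ := by
      rw [Finset.prod_const]
      exact pow_le_pow_right₀ ht (Finset.card_le_univ _)

/-- Every assignment is an injective assignment on the quotient by its own kernel. -/
theorem sum_eq_sum_setoid (g : (A → Fin n) → ℝ) :
    ∑ i, g i = ∑ S : Setoid A, ∑ i : Quotient S → Fin n,
      injInd i * g (fun v => i (Quotient.mk S v)) := by
  rw [← Finset.sum_fiberwise (s := Finset.univ) (g := fun i : A → Fin n => Setoid.ker i)]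
  refine Finset.sum_congr rfl fun S _ => ?_
  have h := sum_quotient_functions (n := n) S (fun i => if Setoid.ker i = S then g i else 0)
  have h0 : (∑ i : A → Fin n with S ≤ Setoid.ker i, if Setoid.ker i = S then g i else 0) =
      ∑ i : A → Fin n with S ≤ Setoid.ker i ∧ Setoid.ker i = S, g i := by
    rw [← Finset.sum_filter, Finset.filter_filter]
  have h1 : (Finset.univ.filter fun i : A → Fin n => S ≤ Setoid.ker i ∧ Setoid.ker i = S) =
      Finset.univ.filter fun i => Setoid.ker i = S := by
    ext i
    simp only [Finset.mem_filter, Finset.mem_univ, true_and]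
    exact ⟨fun h => h.2, fun h => ⟨h.ge, h⟩⟩
  rw [h0, h1] at h
  rw [← h]
  refine Finset.sum_congr rfl fun i _ => ?_
  have h2 : Setoid.ker (fun v => i (Quotient.mk S v)) = S ↔ Function.Injective i := by
    constructor
    · intro h x y hxy
      induction x using Quotient.ind with | _ v =>
      induction y using Quotient.ind with | _ w =>
      refine Quotient.sound ?_
      change S v w
      rw [← h]
      exact hxy
    · intro h
      refine Setoid.ext fun v w => ⟨fun hvw => ?_, fun hvw => ?_⟩
      · exact Quotient.exact (h hvw)
      · exact congrArg i (Quotient.sound hvw)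
  by_cases hi : Function.Injective i
  · rw [if_pos (h2.mpr hi)]; simp [injInd, hi]
  · rw [if_neg (mt h2.mp hi)]; simp [injInd, hi]

theorem sideProd_quotient (a : F → A) (α : A → Fin n → ℝ) (s : SignedPerm n) (S : Setoid A)
    (i : Quotient S → Fin n) :
    sideProd a α s (fun v => i (Quotient.mk S v)) =
      sideProd (quotEdge a S) (blockLabel S α) s i := by
  unfold sideProd
  congr 1
  rw [← Finset.prod_fiberwise (s := Finset.univ) (g := fun v => Quotient.mk S v)]
  refine Finset.prod_congr rfl fun x _ => Finset.prod_congr rfl fun v hv => ?_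
  have hv' : Quotient.mk S v = x := (Finset.mem_filter.mp hv).2
  rw [← hv']

theorem fullSum_eq_sum_injSum (a : F → A) (b : F → B) (H : Matrix (Fin n) (Fin n) ℝ)
    (α : A → Fin n → ℝ) (β : B → Fin n → ℝ) (s s' : SignedPerm n) :
    fullSum a b H α β s s' = ∑ p : Setoid A × Setoid B,
      injSum (quotEdge a p.1) (quotEdge b p.2) H (blockLabel p.1 α) (blockLabel p.2 β) s s' := by
  rw [fullSum, sum_eq_sum_setoid, Fintype.sum_prod_type]
  refine Finset.sum_congr rfl fun S _ => ?_
  simp_rw [sum_eq_sum_setoid (A := B), Finset.mul_sum]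
  rw [Finset.sum_comm]
  refine Finset.sum_congr rfl fun R _ => ?_
  have key : ∀ (i : Quotient S → Fin n) (j : Quotient R → Fin n),
      injInd i * (injInd j * (sideProd a α s (fun v => i (Quotient.mk S v)) *
        sideProd b β s' (fun v => j (Quotient.mk R v)) *
        edgeProd H a b (fun v => i (Quotient.mk S v)) (fun v => j (Quotient.mk R v)))) =
      (injInd i * sideProd (quotEdge a S) (blockLabel S α) s i) *
        (injInd j * sideProd (quotEdge b R) (blockLabel R β) s' j) *
        edgeProd H (quotEdge a S) (quotEdge b R) i j := by
    intro i j
    rw [sideProd_quotient, sideProd_quotient]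
    have : edgeProd H a b (fun v => i (Quotient.mk S v)) (fun v => j (Quotient.mk R v)) =
      edgeProd H (quotEdge a S) (quotEdge b R) i j := rfl
    rw [this]
    ring
  simp_rw [key]
  unfold injSum
  congr!

/-- Labelled contractions along a connected multigraph concentrate. -/
theorem exists_powBounded_fullSum (a : F → A) (b : F → B) (hc : ComponentsLE a b 1) {K : ℕ}
    (hK : Even K) :
    ∃ κ : Setoid A × Setoid B → ℝ, PowBounded K (fun n H α β s s' => fullSum a b H α β s s' -
      n * ∑ p : Setoid A × Setoid B, (∏ x, labelMean (blockLabel p.1 α x)) *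
        (∏ x, labelMean (blockLabel p.2 β x)) * κ p) := by
  choose κ hκ using fun p : Setoid A × Setoid B =>
    exists_powBounded_injSum (quotEdge a p.1) (quotEdge b p.2) (hc.quotEdge p.1 p.2) hK
  refine ⟨κ, ?_⟩
  refine (PowBounded.sum hK Finset.univ (X := fun (p : Setoid A × Setoid B) n H α β s s' =>
    injSum (quotEdge a p.1) (quotEdge b p.2) H (blockLabel p.1 α) (blockLabel p.2 β) s s' -
      n * ((∏ x, labelMean (blockLabel p.1 α x)) *
        (∏ x, labelMean (blockLabel p.2 β x)) * κ p)) ?_).congr ?_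
  · intro p _
    refine (hκ p).comp (fun n α => blockLabel p.1 α) (fun n β => blockLabel p.2 β) 1
      (Fintype.card A + Fintype.card B + 1) ?_
    intro n H t α β h
    rw [Nat.cast_one, one_mul]
    have ht := h.one_le
    refine ⟨h.pos, h.orth, one_le_pow₀ ht, fun i j => (h.deloc i j).trans ?_,
      fun v y => (abs_blockLabel_le ht h.left p.1 v y).trans (pow_le_pow_right₀ ht (by omega)),
      fun v y => (abs_blockLabel_le ht h.right p.2 v y).trans (pow_le_pow_right₀ ht (by omega))⟩
    gcongr
    exact le_self_pow₀ ht (by omega)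
  · intro n H t α β _ s s'
    rw [fullSum_eq_sum_injSum, Finset.sum_sub_distrib, Finset.mul_sum]

end FullSum

/-! ### The value of a network as a labelled contraction -/

section NetworkValue

open scoped Classical

variable {V : Type u} [Fintype V] {k n : ℕ}

theorem signedPermMatrix_mul_apply (σ : Equiv.Perm (Fin n)) (ξ : Fin n → ℤˣ)
    (M : Matrix (Fin n) (Fin n) ℝ) (i j : Fin n) :
    (signedPermMatrix σ ξ * M) i j = ((ξ (σ i) : ℤ) : ℝ) * M (σ i) j := by
  rw [signedPermMatrix, Matrix.mul_assoc, Equiv.Perm.permMatrix, PEquiv.toMatrix_toPEquiv_mul]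
  simp [Matrix.submatrix_apply, Matrix.diagonal_mul]

theorem mul_signedPermMatrix_apply (σ : Equiv.Perm (Fin n)) (ξ : Fin n → ℤˣ)
    (M : Matrix (Fin n) (Fin n) ℝ) (i j : Fin n) :
    (M * signedPermMatrix σ ξ) i j = M i (σ.symm j) * ((ξ j : ℤ) : ℝ) := by
  rw [signedPermMatrix, ← Matrix.mul_assoc, Equiv.Perm.permMatrix, PEquiv.mul_toMatrix_toPEquiv]
  simp [Matrix.submatrix_apply, Matrix.mul_diagonal]

theorem conj_diagonal_apply (O : Matrix (Fin n) (Fin n) ℝ) (d : Fin n → ℝ) (i i' : Fin n) :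
    (O * Matrix.diagonal d * O.transpose) i i' = ∑ j, O i j * d j * O i' j := by
  rw [Matrix.mul_apply]
  simp [Matrix.mul_diagonal]

theorem prod_sum_eq_sum_comp_perm {B : Type*} [Fintype B] (τ : Equiv.Perm (Fin n))
    (g : B → Fin n → ℝ) :
    ∏ e, ∑ j, g e j = ∑ j : B → Fin n, ∏ e, g e (τ (j e)) := by
  rw [Finset.prod_univ_sum, Fintype.piFinset_univ,
    ← Equiv.sum_comp (Equiv.arrowCongr (Equiv.refl B) τ)]
  rfl

namespace DiagonalTensorNetwork

/-- The two ends of an edge. -/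
noncomputable def endpoint (T : DiagonalTensorNetwork V k) (f : T.graph.edgeSet × Bool) : V :=
  if f.2 then (f.1 : Sym2 V).out.2 else (f.1 : Sym2 V).out.1

/-- The label of a vertex, as a function of the index. -/
noncomputable def label (T : DiagonalTensorNetwork V k) (x : Fin n → EuclideanSpace ℝ (Fin k))
    (v : V) (y : Fin n) : ℝ :=
  MvPolynomial.eval (fun j => x y j) (T.q v)

/-- Adjacent vertices of the tree get equal values through the edge that joins them, and the tree is
connected. -/
theorem componentsLE_one (T : DiagonalTensorNetwork V k) :
    ComponentsLE T.endpoint (Prod.fst : T.graph.edgeSet × Bool → T.graph.edgeSet) 1 := by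
  intro X p q hpq
  have hadj : ∀ u v, T.graph.Adj u v → p u = p v := by
    intro u v huv
    let e : T.graph.edgeSet := ⟨s(u, v), huv⟩
    have h1 := hpq (e, false)
    have h2 := hpq (e, true)
    simp only [endpoint, if_true, Bool.false_eq_true, if_false] at h1 h2
    have h3 : s((e : Sym2 V).out.1, (e : Sym2 V).out.2) = s(u, v) := Quot.out_eq _
    rcases Sym2.eq_iff.mp h3 with ⟨h4, h5⟩ | ⟨h4, h5⟩
    · rw [← h4, ← h5, h1, h2]
    · rw [← h4, ← h5, h1, h2]
  have hreach : ∀ u v, p u = p v := by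
    intro u v
    obtain ⟨w⟩ := T.isTree.connected.preconnected u v
    induction w with
    | nil => rfl
    | cons h _ ih => exact (hadj _ _ h).trans ih
  obtain ⟨v₀⟩ := T.isTree.connected.nonempty
  rw [Set.ncard_le_one (Set.toFinite _)]
  have hall : ∀ x ∈ Set.range p ∪ Set.range q, x = p v₀ := by
    rintro x (⟨v, rfl⟩ | ⟨e, rfl⟩)
    · exact hreach _ _
    · rw [← hpq (e, false)]; exact hreach _ _
  intro x hx y hy
  rw [hall x hx, hall y hy]

theorem prod_edgeFinset (T : DiagonalTensorNetwork V k) (g : Sym2 V → ℝ) :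
    ∏ e ∈ T.graph.edgeFinset, g e = ∏ e : T.graph.edgeSet, g e :=
  Finset.prod_subtype _ (fun _ => SimpleGraph.mem_edgeFinset) _

/-- The value of a network on a matrix conjugated by signed permutations. -/
theorem val_eq_fullSum (T : DiagonalTensorNetwork V k) (H : Matrix (Fin n) (Fin n) ℝ)
    (d : Fin n → ℝ) (x : Fin n → EuclideanSpace ℝ (Fin k)) (s s' : SignedPerm n) :
    T.val ((signedPermMatrix s.1 s.2 * H * signedPermMatrix s'.1 s'.2) * Matrix.diagonal d *
      (signedPermMatrix s.1 s.2 * H * signedPermMatrix s'.1 s'.2).transpose) x =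
      (1 / (n : ℝ)) * fullSum T.endpoint (Prod.fst : T.graph.edgeSet × Bool → T.graph.edgeSet) H
        (T.label x) (fun _ => d) (s.1.symm, s.2) (s'.1, fun y => s'.2 (s'.1 y)) := by
  obtain ⟨σ, ξ⟩ := s
  obtain ⟨τ, ζ⟩ := s'
  rw [val, fullSum]
  congr 1
  -- Substituting σ⁻¹ for the vertex indices, and below τ for the edge indices, moves the
  -- permutations from `H` to the labels. This produces the inverse of `σ` and the signs composed
  -- with `τ`.
  rw [← Equiv.sum_comp (Equiv.arrowCongr (Equiv.refl V) σ.symm)]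
  refine Finset.sum_congr rfl fun i _ => ?_
  rw [prod_edgeFinset]
  simp_rw [conj_diagonal_apply]
  rw [prod_sum_eq_sum_comp_perm τ, Finset.mul_sum]
  refine Finset.sum_congr rfl fun j _ => ?_
  simp only [Equiv.arrowCongr_apply, Equiv.coe_refl, Function.comp_apply, Equiv.refl_symm, id,
    mul_signedPermMatrix_apply, signedPermMatrix_mul_apply, Equiv.symm_apply_apply,
    Equiv.apply_symm_apply, sideProd, edgeProd, label, Fintype.prod_prod_type, Fintype.prod_bool,
    endpoint, if_true, Bool.false_eq_true, if_false, Finset.prod_mul_distrib]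
  ring

/-- The equivalence used to reindex signed permutations. -/
def reindexLeft (n : ℕ) : SignedPerm n ≃ SignedPerm n where
  toFun s := (s.1.symm, s.2)
  invFun s := (s.1.symm, s.2)
  left_inv _ := rfl
  right_inv _ := rfl

/-- The equivalence used to reindex signed permutations. -/
def reindexRight (n : ℕ) : SignedPerm n ≃ SignedPerm n where
  toFun s := (s.1, fun y => s.2 (s.1 y))
  invFun s := (s.1, fun y => s.2 (s.1.symm y))
  left_inv s := by simp
  right_inv s := by simp

/-- The matrix `O D Oᵀ` with `O = Π_V H Π_E`. -/
noncomputable def conjMatrix (H : Matrix (Fin n) (Fin n) ℝ) (d : Fin n → ℝ) (s s' : SignedPerm n) :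
    Matrix (Fin n) (Fin n) ℝ :=
  (signedPermMatrix s.1 s.2 * H * signedPermMatrix s'.1 s'.2) * Matrix.diagonal d *
      (signedPermMatrix s.1 s.2 * H * signedPermMatrix s'.1 s'.2).transpose

/-- The combination of the moments of the labels which approximates the value. -/
noncomputable def momentSum (T : DiagonalTensorNetwork V k)
    (κ : Setoid V × Setoid T.graph.edgeSet → ℝ)
    (m : (Finset V → ℝ) × (Finset T.graph.edgeSet → ℝ)) : ℝ :=
  ∑ p : Setoid V × Setoid T.graph.edgeSet,
    (∏ x, m.1 (block p.1 x)) * (∏ x, m.2 (block p.2 x)) * κ p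

theorem continuous_momentSum (T : DiagonalTensorNetwork V k)
    (κ : Setoid V × Setoid T.graph.edgeSet → ℝ) : Continuous (T.momentSum κ) := by
  unfold momentSum
  fun_prop

/-- The empirical moments of the labels. -/
noncomputable def empiricalMoments (T : DiagonalTensorNetwork V k)
    (x : Fin n → EuclideanSpace ℝ (Fin k)) (U : Finset V) : ℝ :=
  labelMean fun y => ∏ v ∈ U, T.label x v y

/-- The contraction fluctuates on the scale √n and the value is 1/n times it, so the twelfth moment
is of order n^(-6). The exponent 12 makes it possible to lose two factors of n later and still have
n^(-4). -/
theorem exists_moment_val_sub (T : DiagonalTensorNetwork V k) :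
    ∃ (κ : Setoid V × Setoid T.graph.edgeSet → ℝ) (C : ℝ) (D : ℕ), 0 ≤ C ∧
      ∀ n : ℕ, 0 < n → ∀ H ∈ Matrix.orthogonalGroup (Fin n) ℝ, ∀ t : ℝ, 1 ≤ t →
      (∀ i j, |H i j| ≤ t / √n) → ∀ (x : Fin n → EuclideanSpace ℝ (Fin k)) (d : Fin n → ℝ),
      (∀ v y, |T.label x v y| ≤ t) → (∀ y, |d y| ≤ t) →
      ∑ s, ∑ s', (T.val (conjMatrix H d s s') x - T.momentSum κ
        (T.empiricalMoments x, fun U => labelMean fun y => d y ^ U.card)) ^ 12 ≤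
        C * t ^ D * (Fintype.card (SignedPerm n) : ℝ) ^ 2 / (n : ℝ) ^ 6 := by
  obtain ⟨κ, C, D, hC, h⟩ := exists_powBounded_fullSum T.endpoint
    (Prod.fst : T.graph.edgeSet × Bool → T.graph.edgeSet) T.componentsLE_one
    (K := 12) (by decide)
  refine ⟨κ, C, D, hC, fun n hn H hH t ht hHt x d hx hd => ?_⟩
  have hn' : (0 : ℝ) < n := by exact_mod_cast hn
  have h1 := h n H t (T.label x) (fun _ => d) ⟨hn, hH, ht, hHt, hx, fun _ => hd⟩
  have hL : ∑ p : Setoid V × Setoid T.graph.edgeSet,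
      (∏ x', labelMean (blockLabel p.1 (T.label x) x')) *
        (∏ x', labelMean (blockLabel p.2 (fun _ => d) x')) * κ p =
      T.momentSum κ (T.empiricalMoments x, fun U => labelMean fun y => d y ^ U.card) := by
    unfold momentSum empiricalMoments blockLabel
    simp only [Finset.prod_const]
  simp only [hL] at h1
  set L := T.momentSum κ (T.empiricalMoments x, fun U => labelMean fun y => d y ^ U.card)
  have h2 : ∑ s, ∑ s', (T.val (conjMatrix H d s s') x - L) ^ 12 =
      (∑ s, ∑ s', (fullSum T.endpoint (Prod.fst : T.graph.edgeSet × Bool → T.graph.edgeSet) H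
        (T.label x) (fun _ => d) s s' - n * L) ^ 12) / (n : ℝ) ^ 12 := by
    rw [Finset.sum_div]
    refine Fintype.sum_equiv (reindexLeft n) _ _ fun s => ?_
    rw [Finset.sum_div]
    refine Fintype.sum_equiv (reindexRight n) _ _ fun s' => ?_
    rw [conjMatrix, val_eq_fullSum, ← div_pow]
    congr 1
    simp only [reindexLeft, reindexRight, Equiv.coe_fn_mk]
    field_simp
  have hs : √(n : ℝ) ^ 12 = (n : ℝ) ^ 6 := by
    rw [show (12 : ℕ) = 2 * 6 from rfl, pow_mul, Real.sq_sqrt hn'.le]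
  rw [h2, div_le_div_iff₀ (by positivity) (by positivity)]
  rw [hs] at h1
  calc _ ≤ (C * t ^ D * (Fintype.card (SignedPerm n) : ℝ) ^ 2 * (n : ℝ) ^ 6) * (n : ℝ) ^ 6 := by
        gcongr
    _ = _ := by ring

/-- For delocalized eigenvectors and labels of small size whose moments are close to `m`, the value
is close to the limit for all but few signed permutations. -/
theorem exists_card_bad_le (T : DiagonalTensorNetwork V k) :
    ∃ κ : Setoid V × Setoid T.graph.edgeSet → ℝ,
      ∀ (mV : Finset V → ℝ) (mE : ℕ → ℝ) (ε : ℝ), 0 < ε →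
      ∃ δ : ℝ, 0 < δ ∧ ∃ N : ℕ, ∀ n ≥ N, 0 < n → ∀ H ∈ Matrix.orthogonalGroup (Fin n) ℝ,
      (∀ i j, |H i j| ≤ (n : ℝ) ^ (-1 / 2 + δ)) →
      ∀ (x : Fin n → EuclideanSpace ℝ (Fin k)) (d : Fin n → ℝ),
      (∀ v y, |T.label x v y| ≤ (n : ℝ) ^ δ) → (∀ y, |d y| ≤ (n : ℝ) ^ δ) →
      (∀ U, |T.empiricalMoments x U - mV U| < δ) →
      (∀ m ≤ Fintype.card T.graph.edgeSet, |labelMean (fun y => d y ^ m) - mE m| < δ) →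
      ((Finset.univ.filter fun s : SignedPerm n × SignedPerm n =>
        ε ≤ |T.val (conjMatrix H d s.1 s.2) x -
          T.momentSum κ (mV, fun U => mE U.card)|).card : ℝ) ≤
        (Fintype.card (SignedPerm n) : ℝ) ^ 2 / (n : ℝ) ^ 4 := by
  obtain ⟨κ, C, D, hC, hmom⟩ := T.exists_moment_val_sub
  refine ⟨κ, fun mV mE ε hε => ?_⟩
  obtain ⟨δ₁, hδ₁, hcont⟩ := Metric.continuous_iff.mp (T.continuous_momentSum κ)
    (mV, fun U => mE U.card) (ε / 2) (by positivity)
  obtain ⟨N, hN⟩ := exists_nat_ge (C / (ε / 2) ^ 12)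
  -- Here `δ₁` comes from the continuity of `momentSum`, the bound 1/(D + 1) ensures t^D ≤ n for t =
  -- n^δ, and `N` ensures C/(ε/2)^12 ≤ n. The last two cost one factor n each, from n^(-6) to
  -- n^(-4).
  refine ⟨min δ₁ (1 / (D + 1)), by positivity, N, fun n hnN hn H hH hHn x d hx hd hmx hmd => ?_⟩
  set δ := min δ₁ (1 / ((D : ℝ) + 1)) with hδ
  have hδ0 : 0 < δ := by positivity
  have hn' : (0 : ℝ) < n := by exact_mod_cast hn
  have hn1 : (1 : ℝ) ≤ n := by exact_mod_cast hn
  have ht : 1 ≤ (n : ℝ) ^ δ := Real.one_le_rpow hn1 hδ0.le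
  have htD : ((n : ℝ) ^ δ) ^ D ≤ n := by
    rw [← Real.rpow_natCast, ← Real.rpow_mul hn'.le]
    refine (Real.rpow_le_rpow_of_exponent_le hn1 (y := δ * D) (z := 1) ?_).trans_eq
      (Real.rpow_one _)
    have : δ ≤ 1 / ((D : ℝ) + 1) := min_le_right _ _
    calc δ * D ≤ 1 / ((D : ℝ) + 1) * (D + 1) := by gcongr; linarith
      _ = 1 := by field_simp
  have hHn' : ∀ i j, |H i j| ≤ (n : ℝ) ^ δ / √n := by
    intro i j
    refine (hHn i j).trans_eq ?_
    rw [Real.sqrt_eq_rpow, ← Real.rpow_sub hn']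
    congr 1; ring
  have h1 := hmom n hn H hH _ ht hHn' x d hx hd
  set L := T.momentSum κ (T.empiricalMoments x, fun U => labelMean fun y => d y ^ U.card) with hL
  set L₀ := T.momentSum κ (mV, fun U => mE U.card) with hL₀
  have hLL : |L - L₀| < ε / 2 := by
    rw [← Real.dist_eq]
    refine hcont _ ?_
    rw [Prod.dist_eq, max_lt_iff, dist_pi_lt_iff hδ₁, dist_pi_lt_iff hδ₁]
    refine ⟨fun U => (hmx U).trans_le (min_le_left _ _), fun U => ?_⟩
    exact (hmd U.card (Finset.card_le_univ _)).trans_le (min_le_left _ _)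
  set bad := Finset.univ.filter fun s : SignedPerm n × SignedPerm n =>
    ε ≤ |T.val (conjMatrix H d s.1 s.2) x - L₀| with hbad
  have h2 : (bad.card : ℝ) * (ε / 2) ^ 12 ≤
      ∑ s, ∑ s', (T.val (conjMatrix H d s s') x - L) ^ 12 := by
    rw [← Fintype.sum_prod_type' (f := fun s s' => (T.val (conjMatrix H d s s') x - L) ^ 12),
      ← nsmul_eq_mul, ← Finset.sum_const]
    refine (Finset.sum_le_sum fun s hs => ?_).trans
      (Finset.sum_le_sum_of_subset_of_nonneg (Finset.subset_univ bad) fun s _ _ =>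
        (by decide : Even 12).pow_nonneg _)
    have h3 : ε ≤ |T.val (conjMatrix H d s.1 s.2) x - L₀| := (Finset.mem_filter.mp hs).2
    rw [← (by decide : Even 12).pow_abs (T.val (conjMatrix H d s.1 s.2) x - L)]
    gcongr
    have := abs_sub_le (T.val (conjMatrix H d s.1 s.2) x) L L₀
    linarith
  have hεp : (0 : ℝ) < (ε / 2) ^ 12 := by positivity
  have hNn : C ≤ n * (ε / 2) ^ 12 := by
    rw [← div_le_iff₀ hεp]
    exact hN.trans (by exact_mod_cast hnN)
  have h3 : (bad.card : ℝ) * (ε / 2) ^ 12 ≤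
      (Fintype.card (SignedPerm n) : ℝ) ^ 2 / (n : ℝ) ^ 4 * (ε / 2) ^ 12 := by
    refine (h2.trans h1).trans ?_
    calc _ ≤ (n * (ε / 2) ^ 12) * n * (Fintype.card (SignedPerm n) : ℝ) ^ 2 / (n : ℝ) ^ 6 := by
          gcongr
      _ = _ := by field_simp
  exact le_of_mul_le_mul_right h3 hεp

end DiagonalTensorNetwork

end NetworkValue

/-! ### A Borel–Cantelli lemma under independence of the pair only -/

section BorelCantelli

open scoped ENNReal

theorem tsum_ofReal_inv_sq_ne_top : ∑' n : ℕ, ENNReal.ofReal (1 / (n : ℝ) ^ 2) ≠ ∞ :=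
  (Real.summable_one_div_nat_pow.mpr one_lt_two).tsum_ofReal_ne_top

variable {Ω : Type*} [MeasurableSpace Ω] {P : Measure Ω} [IsProbabilityMeasure P]

/-- Markov's inequality for the conditional probability of `A` given the first coordinate,
restricted to an event. -/
theorem measure_section_ge_le {𝒲 𝒳 : Type*} [MeasurableSpace 𝒲] [MeasurableSpace 𝒳]
    {W : Ω → 𝒲} (hW : Measurable W) (l : Measure 𝒳) [IsProbabilityMeasure l]
    {A : Set (𝒲 × 𝒳)} (hA : MeasurableSet A) (G : Set Ω) {r : ℝ≥0∞}
    (h : ∀ x, P ({ω | (W ω, x) ∈ A} ∩ G) ≤ r) {c : ℝ≥0∞} :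
    c * P ({ω | c ≤ l (Prod.mk (W ω) ⁻¹' A)} ∩ G) ≤ r := by
  have hm : Measurable fun w => l (Prod.mk w ⁻¹' A) := measurable_measure_prodMk_left hA
  have hms : MeasurableSet {ω | c ≤ l (Prod.mk (W ω) ⁻¹' A)} :=
    measurableSet_le measurable_const (hm.comp hW)
  rw [← Measure.restrict_apply hms]
  refine (mul_meas_ge_le_lintegral (hm.comp hW) c).trans ?_
  change ∫⁻ ω, (fun w => l (Prod.mk w ⁻¹' A)) (W ω) ∂(P.restrict G) ≤ r
  -- Exchanging the order of integration bounds the mean of the section measure by the bound for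
  -- each fixed `x`. Here `x` is integrated against `l`, so no independence is involved.
  rw [← lintegral_map hm hW, ← Measure.prod_apply hA, Measure.prod_apply_symm hA]
  refine (lintegral_mono (g := fun _ => r) fun x => ?_).trans (by simp)
  change ((P.restrict G).map W) ((fun w => (w, x)) ⁻¹' A) ≤ r
  rw [Measure.map_apply hW (measurable_prodMk_right hA),
    Measure.restrict_apply (hW (measurable_prodMk_right hA))]
  exact h x

/-- By independence, the measure of the section at `W ω` is the conditional probability of `A` given
`W`; where it is below `c`, the event has probability at most `c`. -/
theorem measure_section_lt_le {𝒲 𝒳 : Type*} [MeasurableSpace 𝒲] [MeasurableSpace 𝒳]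
    {W : Ω → 𝒲} {X : Ω → 𝒳} (hW : Measurable W) (hX : Measurable X) (hind : IndepFun W X P)
    {A : Set (𝒲 × 𝒳)} (hA : MeasurableSet A) {c : ℝ≥0∞} :
    P {ω | (W ω, X ω) ∈ A ∧ (P.map X) (Prod.mk (W ω) ⁻¹' A) < c} ≤ c := by
  have hm : Measurable fun w => (P.map X) (Prod.mk w ⁻¹' A) := by
    have := Measure.isProbabilityMeasure_map hX.aemeasurable (μ := P)
    exact measurable_measure_prodMk_left hA
  have := Measure.isProbabilityMeasure_map hX.aemeasurable (μ := P)
  have := Measure.isProbabilityMeasure_map hW.aemeasurable (μ := P)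
  set S : Set (𝒲 × 𝒳) := A ∩ {p | (P.map X) (Prod.mk p.1 ⁻¹' A) < c} with hS
  have hSm : MeasurableSet S :=
    hA.inter (measurableSet_lt (hm.comp measurable_fst) measurable_const)
  have h1 : P {ω | (W ω, X ω) ∈ A ∧ (P.map X) (Prod.mk (W ω) ⁻¹' A) < c} =
      (P.map fun ω => (W ω, X ω)) S := by
    rw [Measure.map_apply (hW.prodMk hX) hSm]
    rfl
  rw [h1, (indepFun_iff_map_prod_eq_prod_map_map hW.aemeasurable hX.aemeasurable).mp hind,
    Measure.prod_apply hSm]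
  refine (lintegral_mono (g := fun _ => c) fun w => ?_).trans (by simp)
  by_cases hw : (P.map X) (Prod.mk w ⁻¹' A) < c
  · exact (measure_mono fun x hx => hx.1).trans hw.le
  · have : Prod.mk w ⁻¹' S = ∅ := by
      ext x
      simp only [hS, Set.mem_preimage, Set.mem_inter_iff, Set.mem_ofPred_eq, hw, and_false,
        Set.mem_empty_iff_false]
    rw [this]; simp

/-- A Borel–Cantelli lemma: `X n` is independent of `W n` only, while the probability of `A n` is
controlled on an event which need not be a function of `W n`. -/
theorem ae_eventually_notMem_of_indepFun {𝒲 𝒳 : ℕ → Type*} [∀ n, MeasurableSpace (𝒲 n)]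
    [∀ n, MeasurableSpace (𝒳 n)] {W : ∀ n, Ω → 𝒲 n} {X : ∀ n, Ω → 𝒳 n}
    (hW : ∀ n, Measurable (W n)) (hX : ∀ n, Measurable (X n))
    (hind : ∀ n, IndepFun (W n) (X n) P) {A : ∀ n, Set (𝒲 n × 𝒳 n)}
    (hA : ∀ n, MeasurableSet (A n)) {GX : ∀ n, Set (𝒳 n)} (hGX : ∀ n, MeasurableSet (GX n))
    {GW : ℕ → Set Ω} (hXev : ∀ᵐ ω ∂P, ∀ᶠ n in atTop, X n ω ∈ GX n)
    (hWev : ∀ᵐ ω ∂P, ∀ᶠ n in atTop, ω ∈ GW n) (N : ℕ)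
    (h : ∀ n, N < n → ∀ x ∈ GX n,
      P ({ω | (W n ω, x) ∈ A n} ∩ GW n) ≤ ENNReal.ofReal (1 / (n : ℝ) ^ 4)) :
    ∀ᵐ ω ∂P, ∀ᶠ n in atTop, (W n ω, X n ω) ∉ A n := by
  -- Intersecting with `GX` makes the bound on the sections valid for every `x`.
  set B : ∀ n, Set (𝒲 n × 𝒳 n) := fun n => A n ∩ Prod.snd ⁻¹' GX n with hB
  have hBm : ∀ n, MeasurableSet (B n) := fun n => (hA n).inter (measurable_snd (hGX n))
  -- The threshold n^(-2) is the square root of n^(-4). Both errors, n^(-4)/c for large sections and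
  -- c for small ones, are then summable.
  set c : ℕ → ℝ≥0∞ := fun n => ENNReal.ofReal (1 / (n : ℝ) ^ 2) with hc
  set φ : ∀ n, Ω → ℝ≥0∞ := fun n ω => (P.map (X n)) (Prod.mk (W n ω) ⁻¹' B n) with hφ
  have hbound : ∀ n, N < n → ∀ x, P ({ω | (W n ω, x) ∈ B n} ∩ GW n) ≤
      ENNReal.ofReal (1 / (n : ℝ) ^ 4) := by
    intro n hn x
    by_cases hx : x ∈ GX n
    · refine (measure_mono ?_).trans (h n hn x hx)
      exact Set.inter_subset_inter_left _ fun ω hω => hω.1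
    · have : ({ω | (W n ω, x) ∈ B n} ∩ GW n) = ∅ := by
        ext ω
        simp only [hB, Set.mem_inter_iff, Set.mem_ofPred_eq, Set.mem_preimage, hx, and_false,
          false_and, Set.mem_empty_iff_false]
      rw [this]; simp
  have hE1 : ∀ n, P {ω | N < n ∧ c n ≤ φ n ω ∧ ω ∈ GW n} ≤ c n := by
    intro n
    by_cases hn : N < n
    · have hn' : (0 : ℝ) < n := by exact_mod_cast (Nat.zero_le N).trans_lt hn
      have := Measure.isProbabilityMeasure_map (hX n).aemeasurable (μ := P)
      have h1 := measure_section_ge_le (P := P) (hW n) (P.map (X n)) (hBm n) (GW n)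
        (hbound n hn) (c := c n)
      have h2 : ENNReal.ofReal (1 / (n : ℝ) ^ 4) = c n * c n := by
        rw [hc, ← ENNReal.ofReal_mul (by positivity)]
        congr 1
        field_simp
      rw [h2] at h1
      have h3 : c n ≠ 0 := by
        simp only [hc, ne_eq, ENNReal.ofReal_eq_zero, not_le]
        positivity
      have h4 := (ENNReal.mul_le_mul_iff_right h3 ENNReal.ofReal_ne_top).mp h1
      refine (measure_mono ?_).trans h4
      rintro ω ⟨_, h5, h6⟩
      exact ⟨h5, h6⟩
    · have : {ω | N < n ∧ c n ≤ φ n ω ∧ ω ∈ GW n} = ∅ := by simp [hn]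
      rw [this]; simp
  have hE2 : ∀ n, P {ω | (W n ω, X n ω) ∈ B n ∧ φ n ω < c n} ≤ c n := fun n =>
    measure_section_lt_le (hW n) (hX n) (hind n) (hBm n)
  have hsum := tsum_ofReal_inv_sq_ne_top
  have hae1 := ae_eventually_notMem (ne_top_of_le_ne_top hsum (ENNReal.tsum_le_tsum hE1))
  have hae2 := ae_eventually_notMem (ne_top_of_le_ne_top hsum (ENNReal.tsum_le_tsum hE2))
  filter_upwards [hae1, hae2, hXev, hWev] with ω h1 h2 h3 h4
  filter_upwards [h1, h2, h3, h4, eventually_gt_atTop N] with n h1 h2 h3 h4 h5 h6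
  by_cases h7 : c n ≤ φ n ω
  · exact h1 ⟨h5, h7, h4⟩
  · exact h2 ⟨⟨h6, h3⟩, not_le.mp h7⟩

open scoped Classical in
/-- If every point belongs to at most `r` of the events, then their probabilities sum to at most
`r`. -/
theorem sum_measure_le_of_card_le {ι : Type*} [Fintype ι] {E : ι → Set Ω}
    (hE : ∀ i, MeasurableSet (E i)) {r : ℝ}
    (h : ∀ ω, ((Finset.univ.filter fun i => ω ∈ E i).card : ℝ) ≤ r) :
    ∑ i, P (E i) ≤ ENNReal.ofReal r := by
  have h1 : ∑ i, P (E i) = ∫⁻ ω, ∑ i, (E i).indicator 1 ω ∂P := by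
    rw [lintegral_finsetSum _ fun i _ => measurable_one.indicator (hE i)]
    exact Finset.sum_congr rfl fun i _ => (lintegral_indicator_one (hE i)).symm
  rw [h1]
  refine (lintegral_mono (g := fun _ => ENNReal.ofReal r) fun ω => ?_).trans (by simp)
  have h2 : ∑ i, (E i).indicator (1 : Ω → ℝ≥0∞) ω =
      ((Finset.univ.filter fun i => ω ∈ E i).card : ℝ≥0∞) := by
    simp [Set.indicator_apply, Finset.sum_boole]
  rw [h2, ← ENNReal.ofReal_natCast]
  exact ENNReal.ofReal_le_ofReal (h ω)

end BorelCantelli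

/-! ### Test functions of polynomial growth and empirical moments -/

section PolynomialGrowth

variable {E : Type*} [NormedAddCommGroup E]

/-- Continuous functions of at most polynomial growth. -/
def PolynomialGrowth (f : E → ℝ) : Prop :=
  Continuous f ∧ ∃ (C : ℝ) (p : ℕ), 0 ≤ C ∧ ∀ z, |f z| ≤ C * (1 + ‖z‖) ^ p

theorem PolynomialGrowth.const (c : ℝ) : PolynomialGrowth fun _ : E => c :=
  ⟨continuous_const, |c|, 0, abs_nonneg c, by simp⟩

theorem PolynomialGrowth.mul {f g : E → ℝ} (hf : PolynomialGrowth f) (hg : PolynomialGrowth g) :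
    PolynomialGrowth fun z => f z * g z := by
  obtain ⟨hf, C, p, hC, h⟩ := hf
  obtain ⟨hg, C', p', hC', h'⟩ := hg
  refine ⟨hf.mul hg, C * C', p + p', by positivity, fun z => ?_⟩
  rw [abs_mul, pow_add]
  calc _ ≤ (C * (1 + ‖z‖) ^ p) * (C' * (1 + ‖z‖) ^ p') := by
        gcongr
        · exact h z
        · exact h' z
    _ = _ := by ring

theorem PolynomialGrowth.add {f g : E → ℝ} (hf : PolynomialGrowth f) (hg : PolynomialGrowth g) :
    PolynomialGrowth fun z => f z + g z := by
  obtain ⟨hf, C, p, hC, h⟩ := hf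
  obtain ⟨hg, C', p', hC', h'⟩ := hg
  refine ⟨hf.add hg, C + C', p + p', by positivity, fun z => ?_⟩
  have h1 : (1 : ℝ) ≤ 1 + ‖z‖ := by linarith [norm_nonneg z]
  have h2 : (1 + ‖z‖) ^ p ≤ (1 + ‖z‖) ^ (p + p') := pow_le_pow_right₀ h1 (by omega)
  have h3 : (1 + ‖z‖) ^ p' ≤ (1 + ‖z‖) ^ (p + p') := pow_le_pow_right₀ h1 (by omega)
  calc |f z + g z| ≤ |f z| + |g z| := abs_add_le _ _
    _ ≤ C * (1 + ‖z‖) ^ (p + p') + C' * (1 + ‖z‖) ^ (p + p') :=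
        add_le_add ((h z).trans (by gcongr)) ((h' z).trans (by gcongr))
    _ = _ := by ring

theorem PolynomialGrowth.pow {f : E → ℝ} (hf : PolynomialGrowth f) (m : ℕ) :
    PolynomialGrowth fun z => f z ^ m := by
  induction m with
  | zero => simpa using PolynomialGrowth.const (E := E) 1
  | succ m ih => simpa only [pow_succ] using ih.mul hf

theorem PolynomialGrowth.prod {ι : Type*} (U : Finset ι) {f : ι → E → ℝ}
    (hf : ∀ v, PolynomialGrowth (f v)) : PolynomialGrowth fun z => ∏ v ∈ U, f v z := by
  classical
  induction U using Finset.induction_on with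
  | empty => simpa using PolynomialGrowth.const (E := E) 1
  | insert v U hv ih => simpa only [Finset.prod_insert hv] using (hf v).mul ih

theorem polynomialGrowth_id : PolynomialGrowth fun z : ℝ => z :=
  ⟨continuous_id, 1, 1, zero_le_one, fun z => by
    rw [Real.norm_eq_abs, one_mul, pow_one]
    linarith⟩

theorem polynomialGrowth_eval {k : ℕ} (q : MvPolynomial (Fin k) ℝ) :
    PolynomialGrowth fun z : EuclideanSpace ℝ (Fin k) => MvPolynomial.eval (fun j => z j) q := by
  induction q using MvPolynomial.induction_on with
  | C c => simpa using PolynomialGrowth.const (E := EuclideanSpace ℝ (Fin k)) c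
  | add p q hp hq => simpa using hp.add hq
  | mul_X p j hp =>
    have hj : PolynomialGrowth fun z : EuclideanSpace ℝ (Fin k) => z j :=
      ⟨by fun_prop, 1, 1, zero_le_one, fun z => by
        have : |z j| ≤ ‖z‖ := PiLp.norm_apply_le z j
        rw [one_mul, pow_one]
        linarith⟩
    simpa using hp.mul hj

variable [MeasurableSpace E] {y : (n : ℕ) → Fin n → E} {μ : Measure E}

theorem TendstoW.tendsto_labelMean (h : TendstoW y μ) {f : E → ℝ} (hf : PolynomialGrowth f) :
    Tendsto (fun n : ℕ => labelMean fun i => f (y n i)) atTop (𝓝 (∫ z, f z ∂μ)) := by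
  obtain ⟨hc, C, p, hC, hb⟩ := hf
  -- The exponent is raised to `p + 1` because `TendstoW` asks for an exponent of at least 1.
  refine h (p + 1) (by omega) f hc ⟨(C + 1) * 2 ^ p, by positivity, fun z => ?_⟩
  have h1 : (1 : ℝ) ≤ 1 + ‖z‖ := by linarith [norm_nonneg z]
  calc |f z| ≤ C * (1 + ‖z‖) ^ p := hb z
    _ ≤ (C + 1) * (1 + ‖z‖) ^ (p + 1) := by
        gcongr
        · linarith
        · omega
    _ ≤ (C + 1) * (2 ^ p * (1 ^ (p + 1) + ‖z‖ ^ (p + 1))) := by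
        gcongr
        exact add_pow_le zero_le_one (norm_nonneg z) (p + 1)
    _ = _ := by rw [one_pow]; ring

theorem TendstoW.eventually_abs_labelMean_sub_lt (h : TendstoW y μ) {f : E → ℝ}
    (hf : PolynomialGrowth f) {δ : ℝ} (hδ : 0 < δ) :
    ∀ᶠ n : ℕ in atTop, |labelMean (fun i => f (y n i)) - ∫ z, f z ∂μ| < δ := by
  simpa only [Real.dist_eq] using (h.tendsto_labelMean hf).eventually (Metric.ball_mem_nhds _ hδ)

/-- Convergence of all moments makes the maximum grow slower than any power. -/
theorem TendstoW.eventually_abs_le_rpow (h : TendstoW y μ) {f : E → ℝ}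
    (hf : PolynomialGrowth f) {δ : ℝ} (hδ : 0 < δ) :
    ∀ᶠ n : ℕ in atTop, ∀ i, |f (y n i)| ≤ (n : ℝ) ^ δ := by
  -- With m ≥ 1/δ, the 2m-th power of each entry is at most n times the empirical moment, hence
  -- eventually at most n² ≤ (n^δ)^(2m).
  obtain ⟨m, hm⟩ := exists_nat_ge (1 / δ)
  have hmδ : 1 ≤ m * δ := by rwa [div_le_iff₀ hδ] at hm
  have hm0 : m ≠ 0 := by
    rintro rfl
    norm_num at hmδ
  set M := ∫ z, f z ^ (2 * m) ∂μ with hM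
  filter_upwards [h.eventually_abs_labelMean_sub_lt (hf.pow (2 * m)) one_pos, eventually_gt_atTop 0,
    tendsto_natCast_atTop_atTop.eventually_ge_atTop (|M| + 1)] with n h1 hn hnM i
  have hn' : (0 : ℝ) < n := by exact_mod_cast hn
  have hn1 : (1 : ℝ) ≤ n := by exact_mod_cast hn
  have h2 : labelMean (fun i => f (y n i) ^ (2 * m)) ≤ n := by
    have := (abs_lt.mp h1).2
    linarith [le_abs_self M]
  have h3 : f (y n i) ^ (2 * m) ≤ (n : ℝ) ^ 2 := by
    have h4 : f (y n i) ^ (2 * m) ≤ ∑ j, f (y n j) ^ (2 * m) :=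
      Finset.single_le_sum (f := fun j => f (y n j) ^ (2 * m))
        (fun j _ => (even_two_mul m).pow_nonneg _) (Finset.mem_univ i)
    rw [labelMean, one_div, inv_mul_le_iff₀ hn'] at h2
    linarith [sq (n : ℝ)]
  have h5 : (n : ℝ) ^ 2 ≤ ((n : ℝ) ^ δ) ^ (2 * m) := by
    rw [← Real.rpow_natCast, ← Real.rpow_natCast, ← Real.rpow_mul hn'.le]
    refine Real.rpow_le_rpow_of_exponent_le hn1 ?_
    push_cast
    nlinarith
  rw [← (even_two_mul m).pow_abs] at h3
  exact le_of_pow_le_pow_left₀ (by omega) (by positivity) (h3.trans h5)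

end PolynomialGrowth

/-! ### Measurability of matrix operations and of the value -/

section MatrixMeasurability

variable {Ω : Type*} [MeasurableSpace Ω] {m n : ℕ}

theorem measurable_matrix_iff {M : Ω → Matrix (Fin m) (Fin n) ℝ} :
    Measurable M ↔ ∀ i j, Measurable fun ω => M ω i j := by
  exact (measurable_pi_iff (X := fun _ : Fin m => Fin n → ℝ) (g := fun ω => M ω)).trans
    (forall_congr' fun i => measurable_pi_iff)

theorem measurable_matrix_entry (i : Fin m) (j : Fin n) :
    Measurable fun M : Matrix (Fin m) (Fin n) ℝ => M i j :=
  measurable_matrix_iff.mp measurable_id i j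

theorem Measurable.matrix_entry {M : Ω → Matrix (Fin m) (Fin n) ℝ} (hM : Measurable M)
    (i : Fin m) (j : Fin n) : Measurable fun ω => M ω i j :=
  measurable_matrix_iff.mp hM i j

theorem Measurable.matrix_mul {l : ℕ} {M : Ω → Matrix (Fin l) (Fin m) ℝ}
    {N : Ω → Matrix (Fin m) (Fin n) ℝ} (hM : Measurable M) (hN : Measurable N) :
    Measurable fun ω => M ω * N ω := by
  refine measurable_matrix_iff.mpr fun i j => ?_
  simp only [Matrix.mul_apply]
  exact Finset.measurable_fun_sum _ fun x _ => (hM.matrix_entry i x).mul (hN.matrix_entry x j)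

theorem Measurable.matrix_transpose {M : Ω → Matrix (Fin m) (Fin n) ℝ} (hM : Measurable M) :
    Measurable fun ω => (M ω).transpose :=
  measurable_matrix_iff.mpr fun i j => hM.matrix_entry j i

theorem Measurable.matrix_diagonal {d : Ω → Fin n → ℝ} (hd : Measurable d) :
    Measurable fun ω => Matrix.diagonal (d ω) := by
  refine measurable_matrix_iff.mpr fun i j => ?_
  by_cases hij : i = j
  · subst hij
    simpa [Function.comp_def] using (measurable_pi_apply i).comp hd
  · simp [Matrix.diagonal_apply_ne _ hij]

theorem Measurable.conj_diagonal {O : Ω → Matrix (Fin n) (Fin n) ℝ} {d : Ω → Fin n → ℝ}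
    (hO : Measurable O) (hd : Measurable d) :
    Measurable fun ω => O ω * Matrix.diagonal (d ω) * (O ω).transpose :=
  (hO.matrix_mul hd.matrix_diagonal).matrix_mul hO.matrix_transpose

theorem Measurable.conjMatrix {H : Ω → Matrix (Fin n) (Fin n) ℝ} {d : Ω → Fin n → ℝ}
    (hH : Measurable H) (hd : Measurable d) (s s' : SignedPerm n) :
    Measurable fun ω => DiagonalTensorNetwork.conjMatrix (H ω) (d ω) s s' :=
  ((measurable_const.matrix_mul hH).matrix_mul measurable_const).conj_diagonal hd

theorem DiagonalTensorNetwork.measurable_label {V : Type*} {k : ℕ}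
    (T : DiagonalTensorNetwork V k) (v : V) (y : Fin n) :
    Measurable fun x : Fin n → EuclideanSpace ℝ (Fin k) => T.label x v y :=
  (polynomialGrowth_eval (T.q v)).1.measurable.comp (measurable_pi_apply y)

theorem DiagonalTensorNetwork.measurable_val {V : Type*} [Fintype V] {k : ℕ}
    (T : DiagonalTensorNetwork V k) :
    Measurable fun p : Matrix (Fin n) (Fin n) ℝ × (Fin n → EuclideanSpace ℝ (Fin k)) =>
      T.val p.1 p.2 := by
  unfold DiagonalTensorNetwork.val
  refine measurable_const.mul (Finset.measurable_fun_sum _ fun i _ => ?_)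
  refine (Finset.measurable_fun_prod _ fun v _ => ?_).mul (Finset.measurable_fun_prod _ fun e _ => ?_)
  · exact (T.measurable_label v (i v)).comp measurable_snd
  · exact (measurable_matrix_entry _ _).comp measurable_fst

end MatrixMeasurability

/-! ### Almost sure convergence for mixtures of conjugates -/

section Mixture

open scoped Classical ENNReal

variable {Ω : Type*} [MeasurableSpace Ω]

/-- Random matrices whose law is that of `O D Oᵀ` with `O = Π_V H Π_E`, for independent uniformly
random signed permutations and a delocalized orthogonal matrix `H`. -/
structure IsConjMixture (P : Measure Ω) (ν : Measure ℝ)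
    (W : (n : ℕ) → Ω → Matrix (Fin n) (Fin n) ℝ) (d : (n : ℕ) → Ω → Fin n → ℝ)
    (H : (n : ℕ) → Ω → Matrix (Fin n) (Fin n) ℝ) : Prop where
  measurable : ∀ n, Measurable (W n)
  spectrum : HasLimitSpectrum P ν d
  measurable_basis : ∀ n, Measurable (H n)
  orth : ∀ n ω, H n ω ∈ Matrix.orthogonalGroup (Fin n) ℝ
  deloc : ∀ ε : ℝ, 0 < ε → ∀ᵐ ω ∂P, ∀ᶠ n : ℕ in atTop,
    ∀ i j : Fin n, |H n ω i j| ≤ (n : ℝ) ^ (-1 / 2 + ε)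
  law : ∀ n (B : Set (Matrix (Fin n) (Fin n) ℝ)) (G : Set (Fin n → ℝ)) (c : ℝ),
    MeasurableSet B → MeasurableSet G →
    (Fintype.card (SignedPerm n) : ℝ≥0∞) ^ 2 *
        P {ω | W n ω ∈ B ∧ d n ω ∈ G ∧ ∀ i j, |H n ω i j| ≤ c} =
      ∑ s : SignedPerm n × SignedPerm n,
        P {ω | DiagonalTensorNetwork.conjMatrix (H n ω) (d n ω) s.1 s.2 ∈ B ∧
          d n ω ∈ G ∧ ∀ i j, |H n ω i j| ≤ c}

variable {V : Type u} [Fintype V] {k : ℕ}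

namespace DiagonalTensorNetwork

/-- The moments of the labels of a network under the limit laws. -/
noncomputable def limitMoments (T : DiagonalTensorNetwork V k)
    (μ : Measure (EuclideanSpace ℝ (Fin k))) (ν : Measure ℝ) :
    (Finset V → ℝ) × (Finset T.graph.edgeSet → ℝ) :=
  (fun U => ∫ z, ∏ v ∈ U, MvPolynomial.eval (fun j => z j) (T.q v) ∂μ,
    fun U => ∫ z, z ^ U.card ∂ν)

theorem measurableSet_bounds {n : ℕ} (M : Matrix (Fin n) (Fin n) ℝ → Prop) (c : ℝ)
    (hM : ∀ H, M H ↔ ∀ i j, |H i j| ≤ c) : MeasurableSet {H | M H} := by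
  have : {H | M H} = ⋂ i, ⋂ j, {H : Matrix (Fin n) (Fin n) ℝ | |H i j| ≤ c} := by
    ext H
    simp [hM]
  rw [this]
  exact MeasurableSet.iInter fun i => MeasurableSet.iInter fun j =>
    measurableSet_le (measurable_matrix_entry i j).abs measurable_const

theorem measurable_labelMean {n : ℕ} {X : Type*} [MeasurableSpace X] {f : X → Fin n → ℝ}
    (hf : ∀ y, Measurable fun x => f x y) : Measurable fun x => labelMean (f x) :=
  measurable_const.mul (Finset.measurable_fun_sum _ fun y _ => hf y)

/-- Almost sure convergence of the value, for mixtures of conjugates. -/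
theorem tendsto_val_of_isConjMixture (T : DiagonalTensorNetwork V k)
    {κ : Setoid V × Setoid T.graph.edgeSet → ℝ}
    (hκ : ∀ (mV : Finset V → ℝ) (mE : ℕ → ℝ) (ε : ℝ), 0 < ε →
      ∃ δ : ℝ, 0 < δ ∧ ∃ N : ℕ, ∀ n ≥ N, 0 < n → ∀ H ∈ Matrix.orthogonalGroup (Fin n) ℝ,
      (∀ i j, |H i j| ≤ (n : ℝ) ^ (-1 / 2 + δ)) →
      ∀ (x : Fin n → EuclideanSpace ℝ (Fin k)) (d : Fin n → ℝ),
      (∀ v y, |T.label x v y| ≤ (n : ℝ) ^ δ) → (∀ y, |d y| ≤ (n : ℝ) ^ δ) →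
      (∀ U, |T.empiricalMoments x U - mV U| < δ) →
      (∀ m ≤ Fintype.card T.graph.edgeSet, |labelMean (fun y => d y ^ m) - mE m| < δ) →
      ((Finset.univ.filter fun s : SignedPerm n × SignedPerm n =>
        ε ≤ |T.val (conjMatrix H d s.1 s.2) x -
          T.momentSum κ (mV, fun U => mE U.card)|).card : ℝ) ≤
        (Fintype.card (SignedPerm n) : ℝ) ^ 2 / (n : ℝ) ^ 4)
    {μ : Measure (EuclideanSpace ℝ (Fin k))} {ν : Measure ℝ}
    {P : Measure Ω} [IsProbabilityMeasure P]
    {x : (n : ℕ) → Ω → Fin n → EuclideanSpace ℝ (Fin k)} (hx : ∀ n, Measurable (x n))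
    (hxμ : ∀ᵐ ω ∂P, TendstoW (fun n => x n ω) μ)
    {W : (n : ℕ) → Ω → Matrix (Fin n) (Fin n) ℝ} {d : (n : ℕ) → Ω → Fin n → ℝ}
    {H : (n : ℕ) → Ω → Matrix (Fin n) (Fin n) ℝ} (hW : IsConjMixture P ν W d H)
    (hind : ∀ n, IndepFun (W n) (x n) P) :
    ∀ᵐ ω ∂P, Tendsto (fun n => T.val (W n ω) (x n ω)) atTop
      (𝓝 (T.momentSum κ (T.limitMoments μ ν))) := by
  set L := T.momentSum κ (T.limitMoments μ ν) with hL
  -- A countable family of tolerances 1/(m + 1) suffices for almost sure convergence.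
  have main : ∀ m : ℕ, ∀ᵐ ω ∂P, ∀ᶠ n : ℕ in atTop,
      ¬ (1 / ((m : ℝ) + 1) ≤ |T.val (W n ω) (x n ω) - L|) := by
    intro m
    set ε : ℝ := 1 / ((m : ℝ) + 1) with hε
    have hε0 : 0 < ε := by positivity
    obtain ⟨δ, hδ, N, hbad⟩ := hκ (T.limitMoments μ ν).1 (fun m => ∫ z, z ^ m ∂ν) ε hε0
    have hL' : T.momentSum κ ((T.limitMoments μ ν).1, fun U => ∫ z, z ^ U.card ∂ν) = L := rfl
    simp only [hL'] at hbad
    set GX : ∀ n, Set (Fin n → EuclideanSpace ℝ (Fin k)) := fun n =>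
      {x | (∀ v y, |T.label x v y| ≤ (n : ℝ) ^ δ) ∧
        ∀ U, |T.empiricalMoments x U - (T.limitMoments μ ν).1 U| < δ} with hGX
    set GD : ∀ n : ℕ, Set (Fin n → ℝ) := fun n => {d | (∀ y, |d y| ≤ (n : ℝ) ^ δ) ∧
      ∀ m ≤ Fintype.card T.graph.edgeSet,
        |labelMean (fun y => d y ^ m) - ∫ z, z ^ m ∂ν| < δ} with hGD
    have hGXm : ∀ n, MeasurableSet (GX n) := by
      intro n
      refine MeasurableSet.inter ?_ ?_
      · have : {x : Fin n → EuclideanSpace ℝ (Fin k) | ∀ v y, |T.label x v y| ≤ (n : ℝ) ^ δ} =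
            ⋂ v, ⋂ y, {x | |T.label x v y| ≤ (n : ℝ) ^ δ} := by ext; simp
        change MeasurableSet {x : Fin n → EuclideanSpace ℝ (Fin k) |
          ∀ v y, |T.label x v y| ≤ (n : ℝ) ^ δ}
        rw [this]
        exact MeasurableSet.iInter fun v => MeasurableSet.iInter fun y =>
          measurableSet_le (T.measurable_label v y).abs measurable_const
      · have : {x : Fin n → EuclideanSpace ℝ (Fin k) |
            ∀ U, |T.empiricalMoments x U - (T.limitMoments μ ν).1 U| < δ} =
            ⋂ U, {x | |T.empiricalMoments x U - (T.limitMoments μ ν).1 U| < δ} := by ext; simp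
        change MeasurableSet {x : Fin n → EuclideanSpace ℝ (Fin k) |
            ∀ U, |T.empiricalMoments x U - (T.limitMoments μ ν).1 U| < δ}
        rw [this]
        refine MeasurableSet.iInter fun U => measurableSet_lt ?_ measurable_const
        refine Measurable.abs (Measurable.sub_const ?_ _)
        exact measurable_labelMean fun y => Finset.measurable_fun_prod _ fun v _ =>
          T.measurable_label v y
    have hGDm : ∀ n, MeasurableSet (GD n) := by
      intro n
      refine MeasurableSet.inter ?_ ?_
      · have : {d : Fin n → ℝ | ∀ y, |d y| ≤ (n : ℝ) ^ δ} =
            ⋂ y, {d | |d y| ≤ (n : ℝ) ^ δ} := by ext; simp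
        change MeasurableSet {d : Fin n → ℝ | ∀ y, |d y| ≤ (n : ℝ) ^ δ}
        rw [this]
        exact MeasurableSet.iInter fun y =>
          measurableSet_le (measurable_pi_apply y).abs measurable_const
      · have : {d : Fin n → ℝ | ∀ m ≤ Fintype.card T.graph.edgeSet,
            |labelMean (fun y => d y ^ m) - ∫ z, z ^ m ∂ν| < δ} =
            ⋂ m, ⋂ (_ : m ≤ Fintype.card T.graph.edgeSet), {d |
            |labelMean (fun y => d y ^ m) - ∫ z, z ^ m ∂ν| < δ} := by ext; simp
        change MeasurableSet {d : Fin n → ℝ | ∀ m ≤ Fintype.card T.graph.edgeSet,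
            |labelMean (fun y => d y ^ m) - ∫ z, z ^ m ∂ν| < δ}
        rw [this]
        refine MeasurableSet.iInter fun m => MeasurableSet.iInter fun _ =>
          measurableSet_lt ?_ measurable_const
        refine Measurable.abs (Measurable.sub_const ?_ _)
        exact measurable_labelMean fun y => (measurable_pi_apply y).pow_const m
    set A : ∀ n, Set (Matrix (Fin n) (Fin n) ℝ × (Fin n → EuclideanSpace ℝ (Fin k))) := fun n =>
      {p | ε ≤ |T.val p.1 p.2 - L|} with hA
    have hAm : ∀ n, MeasurableSet (A n) := fun n =>
      measurableSet_le measurable_const (T.measurable_val.sub_const L).abs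
    -- Only `W n` is known to be independent of `x n`; the good event concerns `d n` and `H n`,
    -- which may depend on `x n` and need not be functions of `W n`.
    refine ae_eventually_notMem_of_indepFun hW.measurable hx hind hAm hGXm
      (GW := fun n => {ω | d n ω ∈ GD n ∧ ∀ i j, |H n ω i j| ≤ (n : ℝ) ^ (-1 / 2 + δ)})
      ?_ ?_ N ?_
    · filter_upwards [hxμ] with ω hω
      have h1 : ∀ v, ∀ᶠ n : ℕ in atTop, ∀ y, |T.label (x n ω) v y| ≤ (n : ℝ) ^ δ := fun v =>
        hω.eventually_abs_le_rpow (polynomialGrowth_eval (T.q v)) hδ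
      have h2 : ∀ U, ∀ᶠ n : ℕ in atTop,
          |T.empiricalMoments (x n ω) U - (T.limitMoments μ ν).1 U| < δ := fun U =>
        hω.eventually_abs_labelMean_sub_lt (PolynomialGrowth.prod U
          fun v => polynomialGrowth_eval (T.q v)) hδ
      filter_upwards [eventually_all.mpr h1, eventually_all.mpr h2] with n h3 h4
      exact ⟨h3, h4⟩
    · filter_upwards [hW.spectrum.tendstoW, hW.deloc δ hδ] with ω hω hdel
      have h1 : ∀ᶠ n : ℕ in atTop, ∀ m ∈ Finset.range (Fintype.card T.graph.edgeSet + 1),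
          |labelMean (fun y => d n ω y ^ m) - ∫ z, z ^ m ∂ν| < δ :=
        (Finset.eventually_all _).mpr fun m _ =>
          hω.eventually_abs_labelMean_sub_lt (polynomialGrowth_id.pow m) hδ
      filter_upwards [hω.eventually_abs_le_rpow polynomialGrowth_id hδ, h1, hdel] with n h2 h3 h4
      exact ⟨⟨h2, fun m hm => h3 m (Finset.mem_range.mpr (by omega))⟩, h4⟩
    · intro n hn x hx
      have hn0 : 0 < n := (Nat.zero_le N).trans_lt hn
      have hn' : (0 : ℝ) < n := by exact_mod_cast hn0
      have hcard : (0 : ℝ) < Fintype.card (SignedPerm n) := by exact_mod_cast Fintype.card_pos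
      set B : Set (Matrix (Fin n) (Fin n) ℝ) := {w | ε ≤ |T.val w x - L|} with hB
      have hBm : MeasurableSet B := measurable_prodMk_right (hAm n)
      have hlaw := hW.law n B (GD n) ((n : ℝ) ^ (-1 / 2 + δ)) hBm (hGDm n)
      -- By `law`, the probability is an average over pairs of signed permutations. At each `ω` in
      -- the good event at most a fraction n^(-4) of the pairs is bad, and off the good event none
      -- is counted.
      have hsum := sum_measure_le_of_card_le (P := P)
        (E := fun s : SignedPerm n × SignedPerm n => {ω |
          conjMatrix (H n ω) (d n ω) s.1 s.2 ∈ B ∧ d n ω ∈ GD n ∧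
            ∀ i j, |H n ω i j| ≤ (n : ℝ) ^ (-1 / 2 + δ)})
        (r := (Fintype.card (SignedPerm n) : ℝ) ^ 2 / (n : ℝ) ^ 4) ?_ ?_
      · rw [← hlaw] at hsum
        have h1 : ENNReal.ofReal ((Fintype.card (SignedPerm n) : ℝ) ^ 2 / (n : ℝ) ^ 4) =
            (Fintype.card (SignedPerm n) : ℝ≥0∞) ^ 2 * ENNReal.ofReal (1 / (n : ℝ) ^ 4) := by
          rw [div_eq_mul_one_div, ENNReal.ofReal_mul (by positivity),
            ENNReal.ofReal_pow hcard.le, ENNReal.ofReal_natCast]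
        rw [h1] at hsum
        refine (measure_mono ?_).trans ((ENNReal.mul_le_mul_iff_right ?_ ?_).mp hsum)
        · rintro ω ⟨h2, h3, h4⟩
          exact ⟨h2, h3, h4⟩
        · exact pow_ne_zero _ (by exact_mod_cast Fintype.card_ne_zero)
        · exact ENNReal.pow_ne_top (ENNReal.natCast_ne_top _)
      · intro s
        refine MeasurableSet.inter (hBm.preimage
          ((hW.measurable_basis n).conjMatrix (hW.spectrum.measurable n) s.1 s.2)) ?_
        refine MeasurableSet.inter ((hGDm n).preimage (hW.spectrum.measurable n)) ?_
        exact (measurableSet_bounds (fun H => ∀ i j, |H i j| ≤ (n : ℝ) ^ (-1 / 2 + δ)) _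
          (fun _ => Iff.rfl)).preimage (hW.measurable_basis n)
      · intro ω
        by_cases hgood : d n ω ∈ GD n ∧ ∀ i j, |H n ω i j| ≤ (n : ℝ) ^ (-1 / 2 + δ)
        · refine le_trans ?_ (hbad n hn.le hn0 (H n ω) (hW.orth n ω) hgood.2 x (d n ω) hx.1
            hgood.1.1 hx.2 hgood.1.2)
          gcongr with s
          exact fun h => h.1
        · refine le_of_eq_of_le (b := 0) ?_ (by positivity)
          have hno : ∀ s : SignedPerm n × SignedPerm n, ¬ (conjMatrix (H n ω) (d n ω) s.1 s.2 ∈ B ∧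
              d n ω ∈ GD n ∧ ∀ i j, |H n ω i j| ≤ (n : ℝ) ^ (-1 / 2 + δ)) := fun s h => hgood h.2
          simp only [Set.mem_ofPred_eq, hno, Finset.filter_false, Finset.card_empty, Nat.cast_zero]
  filter_upwards [ae_all_iff.mpr main] with ω hω
  rw [Metric.tendsto_nhds]
  intro ε hε
  obtain ⟨m, hm⟩ := exists_nat_one_div_lt hε
  filter_upwards [hω m] with n hn
  rw [Real.dist_eq]
  exact (not_le.mp hn).trans hm

end DiagonalTensorNetwork

end Mixture

/-! ### Generalized invariant matrices are mixtures -/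

section GeneralizedInvariant

open scoped Classical ENNReal

variable {Ω : Type*} [MeasurableSpace Ω]

/-- The law is a uniform average of point masses indexed by the permutation and the signs, which
turns integrals into finite sums. -/
theorem IsUniformSignedPerm.lintegral_map {P : Measure Ω} {n : ℕ}
    {R : Ω → Matrix (Fin n) (Fin n) ℝ} (hR : IsUniformSignedPerm P R)
    {g : Matrix (Fin n) (Fin n) ℝ → ℝ≥0∞} (hg : Measurable g) :
    ∫⁻ M, g M ∂(P.map R) =
      (Fintype.card (SignedPerm n) : ℝ≥0∞)⁻¹ * ∑ s : SignedPerm n, g (signedPermMatrix s.1 s.2) := by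
  have hsum : P.map R = ∑ s : SignedPerm n, (Fintype.card (SignedPerm n) : ℝ≥0∞)⁻¹ •
      Measure.dirac (signedPermMatrix s.1 s.2) := by
    ext B hB
    rw [hR.2, PMF.toMeasure_apply_eq_toOuterMeasure_apply _ hB, PMF.toOuterMeasure_map_apply,
      PMF.toOuterMeasure_apply, tsum_fintype, Measure.finsetSum_apply]
    refine Finset.sum_congr rfl fun s _ => ?_
    rw [Measure.smul_apply, Measure.dirac_apply' _ hB, smul_eq_mul]
    by_cases h : signedPermMatrix s.1 s.2 ∈ B
    · rw [Set.indicator_of_mem (by exact h), Set.indicator_of_mem h, PMF.uniformOfFintype_apply]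
      simp only [Pi.one_apply, mul_one]
    · rw [Set.indicator_of_notMem (by exact h), Set.indicator_of_notMem h, mul_zero]
  rw [hsum, lintegral_finsetSum_measure, Finset.mul_sum]
  refine Finset.sum_congr rfl fun s _ => ?_
  rw [lintegral_smul_measure, lintegral_dirac' _ hg, smul_eq_mul]

/-- The law of a function of two independent uniform signed permutations and an independent
element is the average over all pairs of signed permutations. -/
theorem card_sq_mul_measure_eq_sum {P : Measure Ω} [IsProbabilityMeasure P] {n : ℕ}
    {R S : Ω → Matrix (Fin n) (Fin n) ℝ} (hR : IsUniformSignedPerm P R)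
    (hS : IsUniformSignedPerm P S) (hRS : IndepFun R S P)
    {E : Type*} [MeasurableSpace E] {Y : Ω → E} (hY : Measurable Y)
    (hind : IndepFun (fun ω => (R ω, S ω)) Y P)
    {A : Set ((Matrix (Fin n) (Fin n) ℝ × Matrix (Fin n) (Fin n) ℝ) × E)}
    (hA : MeasurableSet A) :
    (Fintype.card (SignedPerm n) : ℝ≥0∞) ^ 2 * P {ω | ((R ω, S ω), Y ω) ∈ A} =
      ∑ s : SignedPerm n × SignedPerm n,
        P {ω | ((signedPermMatrix s.1.1 s.1.2, signedPermMatrix s.2.1 s.2.2), Y ω) ∈ A} := by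
  have hRm := hR.1
  have hSm := hS.1
  have := Measure.isProbabilityMeasure_map (μ := P) hRm.aemeasurable
  have := Measure.isProbabilityMeasure_map (μ := P) hSm.aemeasurable
  have := Measure.isProbabilityMeasure_map (μ := P) hY.aemeasurable
  have hlaw : P.map (fun ω => ((R ω, S ω), Y ω)) =
      ((P.map R).prod (P.map S)).prod (P.map Y) := by
    rw [(indepFun_iff_map_prod_eq_prod_map_map (hRm.prodMk hSm).aemeasurable
      hY.aemeasurable).mp hind,
      (indepFun_iff_map_prod_eq_prod_map_map hRm.aemeasurable hSm.aemeasurable).mp hRS]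
  have hm : Measurable fun z => (P.map Y) (Prod.mk z ⁻¹' A) := measurable_measure_prodMk_left hA
  have hcard : (Fintype.card (SignedPerm n) : ℝ≥0∞) ≠ 0 := by
    simp [Fintype.card_ne_zero]
  have hP : P {ω | ((R ω, S ω), Y ω) ∈ A} = (Fintype.card (SignedPerm n) : ℝ≥0∞)⁻¹ *
      ∑ s : SignedPerm n, (Fintype.card (SignedPerm n) : ℝ≥0∞)⁻¹ * ∑ t : SignedPerm n,
        P {ω | ((signedPermMatrix s.1 s.2, signedPermMatrix t.1 t.2), Y ω) ∈ A} := by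
    have h1 : P {ω | ((R ω, S ω), Y ω) ∈ A} = P.map (fun ω => ((R ω, S ω), Y ω)) A :=
      (Measure.map_apply ((hRm.prodMk hSm).prodMk hY) hA).symm
    rw [h1, hlaw, Measure.prod_apply hA, lintegral_prod _ hm.aemeasurable,
      hR.lintegral_map hm.lintegral_prod_right']
    congr 1
    refine Finset.sum_congr rfl fun s _ => ?_
    rw [hS.lintegral_map (g := fun y => (P.map Y) (Prod.mk (signedPermMatrix s.1 s.2, y) ⁻¹' A))
      (hm.comp measurable_prodMk_left)]
    congr 1
    refine Finset.sum_congr rfl fun t _ => ?_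
    rw [Measure.map_apply hY (measurable_prodMk_left hA)]
    rfl
  rw [hP, ← Finset.mul_sum, ← Fintype.sum_prod_type' (f := fun s t : SignedPerm n =>
    P {ω | ((signedPermMatrix s.1 s.2, signedPermMatrix t.1 t.2), Y ω) ∈ A}), sq, mul_assoc,
    ← mul_assoc _ _⁻¹, ENNReal.mul_inv_cancel hcard (ENNReal.natCast_ne_top _), one_mul,
    ← mul_assoc, ENNReal.mul_inv_cancel hcard (ENNReal.natCast_ne_top _), one_mul]

theorem IsSymmGeneralizedInvariant.exists_isConjMixture {P : Measure Ω} [IsProbabilityMeasure P]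
    {ν : Measure ℝ} {W : (n : ℕ) → Ω → Matrix (Fin n) (Fin n) ℝ}
    (hW : IsSymmGeneralizedInvariant P ν W) : ∃ d H, IsConjMixture P ν W d H := by
  obtain ⟨d, O, H, R, S, hWO, hd, hO, hH, horth, hR, hS, hRS, hind, hdel⟩ := hW
  have hWn : ∀ n, W n = fun ω => R n ω * H n ω * S n ω * Matrix.diagonal (d n ω) *
      (R n ω * H n ω * S n ω).transpose := fun n => funext fun ω => by rw [hWO, hO]
  refine ⟨d, H, ⟨fun n => ?_, hd, hH, horth, fun ε hε => ?_, fun n B G c hB hG => ?_⟩⟩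
  · rw [hWn]
    exact (((hR n).1.matrix_mul (hH n)).matrix_mul (hS n).1).conj_diagonal (hd.measurable n)
  · filter_upwards [hdel ε hε] with ω hω
    filter_upwards [hω] with n hn i j using (hn i j).le
  · let F : (Matrix (Fin n) (Fin n) ℝ × Matrix (Fin n) (Fin n) ℝ) ×
        ((Fin n → ℝ) × Matrix (Fin n) (Fin n) ℝ) → Matrix (Fin n) (Fin n) ℝ := fun z =>
      z.1.1 * z.2.2 * z.1.2 * Matrix.diagonal z.2.1 * (z.1.1 * z.2.2 * z.1.2).transpose
    have hF : Measurable F :=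
      (((measurable_fst.comp measurable_fst).matrix_mul
        (measurable_snd.comp measurable_snd)).matrix_mul
        (measurable_snd.comp measurable_fst)).conj_diagonal (measurable_fst.comp measurable_snd)
    have hA : MeasurableSet {z | F z ∈ B ∧ z.2.1 ∈ G ∧ ∀ i j, |z.2.2 i j| ≤ c} :=
      (hF hB).inter (((measurable_fst.comp measurable_snd) hG).inter
        ((measurable_snd.comp measurable_snd)
          (DiagonalTensorNetwork.measurableSet_bounds _ c fun _ => Iff.rfl)))
    have := card_sq_mul_measure_eq_sum (hR n) (hS n) (hRS n)
      ((hd.measurable n).prodMk (hH n)) (hind n) hA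
    rw [hWn]
    exact this

end GeneralizedInvariant

/-! ### Orthogonally invariant matrices are delocalized mixtures -/

section Haar

open scoped Classical ENNReal

variable {n : ℕ}

instance orthogonalGroup.instMeasurableMul₂ : MeasurableMul₂ (Matrix.orthogonalGroup (Fin n) ℝ) :=
  ⟨((measurable_subtype_coe.comp measurable_fst).matrix_mul
    (measurable_subtype_coe.comp measurable_snd)).subtype_mk⟩

instance orthogonalGroup.instMeasurableInv : MeasurableInv (Matrix.orthogonalGroup (Fin n) ℝ) :=
  ⟨(measurable_subtype_coe.matrix_transpose).subtype_mk⟩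

/-- A left invariant probability measure on a measurable group is right invariant. -/
theorem isMulRightInvariant_of_isProbabilityMeasure {G : Type*} [Group G] [MeasurableSpace G]
    [MeasurableMul₂ G] [MeasurableInv G] (μ : Measure G) [IsProbabilityMeasure μ]
    [μ.IsMulLeftInvariant] : μ.IsMulRightInvariant := by
  refine ⟨fun g => ?_⟩
  have := Measure.isProbabilityMeasure_map (μ := μ) (measurable_mul_const g).aemeasurable
  -- A right translate of `μ` is again left invariant, so it is a multiple of `μ`; comparing total
  -- masses gives the factor 1.
  have h := measure_eq_div_smul (μ.map (· * g)) μ (s := Set.univ) (by simp) (by simp)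
  simpa using h

theorem signedPermMatrix_mem_orthogonalGroup (s : SignedPerm n) :
    signedPermMatrix s.1 s.2 ∈ Matrix.orthogonalGroup (Fin n) ℝ := by
  rw [Matrix.mem_orthogonalGroup_iff]
  ext i j
  rw [signedPermMatrix_mul_apply, Matrix.transpose_apply]
  have h := signedPermMatrix_mul_apply s.1 s.2 (1 : Matrix (Fin n) (Fin n) ℝ) j (s.1 i)
  rw [mul_one] at h
  rw [h, Matrix.one_apply, Matrix.one_apply]
  by_cases hij : i = j
  · subst hij
    rcases Int.units_eq_one_or (s.2 (s.1 i)) with h | h <;> simp [h]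
  · have : s.1 j ≠ s.1 i := fun h => hij (s.1.injective h).symm
    simp [hij, this]

/-- Every unit vector is a row of an orthogonal matrix. -/
theorem exists_orthogonal_row (i : Fin n) (u : Fin n → ℝ) (hu : ∑ k, u k ^ 2 = 1) :
    ∃ R : Matrix.orthogonalGroup (Fin n) ℝ, ∀ k, (R : Matrix (Fin n) (Fin n) ℝ) i k = u k := by
  let v : Fin n → EuclideanSpace ℝ (Fin n) := fun _ => WithLp.toLp 2 u
  have hv : Orthonormal ℝ (({i} : Set (Fin n)).domRestrict v) := by
    refine ⟨fun j => ?_, fun j k hjk => (hjk (Subsingleton.elim _ _)).elim⟩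
    simp [v, EuclideanSpace.norm_eq, hu]
  obtain ⟨b, hb⟩ := hv.exists_orthonormalBasis_extension_of_card_eq (by simp)
  refine ⟨⟨Matrix.of fun j k => b j k, ?_⟩, fun k => by simp [hb i rfl, v]⟩
  rw [Matrix.mem_orthogonalGroup_iff]
  ext j k
  have h := orthonormal_iff_ite.mp b.orthonormal k j
  rw [PiLp.inner_apply] at h
  simp only [Matrix.mul_apply, Matrix.transpose_apply, Matrix.of_apply, Matrix.one_apply]
  simpa [eq_comm] using h

theorem sum_exp_sign_sum (a : Fin n → ℝ) :
    ∑ e : Fin n → ℤˣ, Real.exp (∑ k, ((e k : ℤ) : ℝ) * a k) = 2 ^ n * ∏ k, Real.cosh (a k) := by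
  simp only [Real.exp_sum]
  rw [← Fintype.piFinset_univ,
    ← Finset.prod_univ_sum (fun _ => Finset.univ) fun k (u : ℤˣ) => Real.exp (((u : ℤ) : ℝ) * a k)]
  have : ∀ k, ∑ u : ℤˣ, Real.exp (((u : ℤ) : ℝ) * a k) = 2 * Real.cosh (a k) := fun k => by
    have huniv : (Finset.univ : Finset ℤˣ) = {1, -1} := rfl
    rw [huniv, Finset.sum_pair (by decide), Real.cosh_eq]
    simp only [Units.val_one, Units.val_neg, Int.cast_one, Int.cast_neg, one_mul, neg_mul]
    ring
  rw [Finset.prod_congr rfl fun k _ => this k, Finset.prod_mul_distrib, Finset.prod_const,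
    Finset.card_univ, Fintype.card_fin]

/-- The sum over signs factors into a product of cosh (a k), and cosh y ≤ exp(y²/2) reduces the
product to the norm of `a`. -/
theorem sum_cosh_sign_sum_le (a : Fin n → ℝ) (ha : ∑ k, a k ^ 2 = 1) :
    ∑ e : Fin n → ℤˣ, Real.cosh (∑ k, ((e k : ℤ) : ℝ) * a k) ≤ 2 ^ n * Real.exp (1 / 2) := by
  have h : ∑ e : Fin n → ℤˣ, Real.cosh (∑ k, ((e k : ℤ) : ℝ) * a k) =
      2 ^ n * ∏ k, Real.cosh (a k) := by
    have h1 := sum_exp_sign_sum a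
    have h2 := sum_exp_sign_sum fun k => -a k
    simp only [Real.cosh_neg, mul_neg, Finset.sum_neg_distrib] at h2
    simp only [Real.cosh_eq (∑ k, _), ← Finset.sum_div, Finset.sum_add_distrib, h1, h2]
    ring
  rw [h]
  gcongr
  calc ∏ k, Real.cosh (a k) ≤ ∏ k, Real.exp (a k ^ 2 / 2) :=
        Finset.prod_le_prod (fun k _ => (Real.cosh_pos _).le) fun k _ => Real.cosh_le_exp_half_sq _
    _ = Real.exp (1 / 2) := by rw [← Real.exp_sum, ← Finset.sum_div, ha]

variable {Ω : Type*} [MeasurableSpace Ω]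

/-- The entries of a Haar distributed orthogonal matrix are subexponential at scale `n ^ (-1/2)`. -/
theorem lintegral_cosh_entry_le {P : Measure Ω} (hn : 0 < n) [IsProbabilityMeasure P]
    {O : Ω → Matrix.orthogonalGroup (Fin n) ℝ} (hO : Measurable O)
    (hinv : (P.map O).IsMulLeftInvariant) (i j : Fin n) :
    ∫⁻ ω, ENNReal.ofReal (Real.cosh (√n * (O ω : Matrix (Fin n) (Fin n) ℝ) i j)) ∂P ≤
      ENNReal.ofReal (Real.exp (1 / 2)) := by
  have hn' : (0 : ℝ) < n := by exact_mod_cast hn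
  have hent : ∀ k, Measurable fun R : Matrix.orthogonalGroup (Fin n) ℝ =>
      (R : Matrix (Fin n) (Fin n) ℝ) k j := fun k => measurable_subtype_coe.matrix_entry k j
  have hOk : ∀ k, Measurable fun ω => (O ω : Matrix (Fin n) (Fin n) ℝ) k j :=
    fun k => (hent k).comp hO
  have hm : Measurable fun R : Matrix.orthogonalGroup (Fin n) ℝ =>
      ENNReal.ofReal (Real.cosh (√n * (R : Matrix (Fin n) (Fin n) ℝ) i j)) :=
    (Real.measurable_cosh.comp (measurable_const.mul (hent i))).ennreal_ofReal
  -- Left multiplication by an orthogonal matrix whose `i`-th row is e/√n preserves the law and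
  -- turns √n O[i, j] into the signed sum Σ_k e_k O[k, j]. All sign vectors therefore give the same
  -- integral.
  have hsign : ∀ e : Fin n → ℤˣ,
      ∫⁻ ω, ENNReal.ofReal (Real.cosh (√n * (O ω : Matrix (Fin n) (Fin n) ℝ) i j)) ∂P =
      ∫⁻ ω, ENNReal.ofReal (Real.cosh (∑ k, ((e k : ℤ) : ℝ) *
        (O ω : Matrix (Fin n) (Fin n) ℝ) k j)) ∂P := fun e => by
    obtain ⟨R, hR⟩ := exists_orthogonal_row i (fun k => ((e k : ℤ) : ℝ) / √n) (by
      have : ∀ k, (((e k : ℤ) : ℝ) / √n) ^ 2 = 1 / n := fun k => by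
        rw [div_pow, Real.sq_sqrt hn'.le]
        rcases Int.units_eq_one_or (e k) with h | h <;> simp [h]
      simp only [this, Finset.sum_const, Finset.card_univ, Fintype.card_fin, nsmul_eq_mul]
      field_simp)
    have h := lintegral_mul_left_eq_self (μ := P.map O) (fun R : Matrix.orthogonalGroup (Fin n) ℝ =>
      ENNReal.ofReal (Real.cosh (√n * (R : Matrix (Fin n) (Fin n) ℝ) i j))) R
    have h' := lintegral_map (μ := P) (hm.comp (measurable_const_mul R)) hO
    simp only [Function.comp_def] at h'
    rw [lintegral_map hm hO, h'] at h
    rw [← h]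
    refine lintegral_congr fun ω => ?_
    congr 2
    rw [Submonoid.coe_mul, Matrix.mul_apply, Finset.mul_sum]
    refine Finset.sum_congr rfl fun k _ => ?_
    rw [hR]
    have : √(n : ℝ) ≠ 0 := (Real.sqrt_pos.mpr hn').ne'
    field_simp
  have hcol : ∀ ω, ∑ k, (O ω : Matrix (Fin n) (Fin n) ℝ) k j ^ 2 = 1 := fun ω => by
    have h := congrFun (congrFun ((Matrix.mem_orthogonalGroup_iff' (A := (O ω).1)).mp (O ω).2) j) j
    rw [Matrix.mul_apply, Matrix.one_apply_eq] at h
    simpa [sq] using h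
  set I := ∫⁻ ω, ENNReal.ofReal (Real.cosh (√n * (O ω : Matrix (Fin n) (Fin n) ℝ) i j)) ∂P with hI
  -- Averaging over all 2^n sign vectors inside the integral gives a pointwise bound, because the
  -- columns of `O` are unit vectors.
  have hmul : (2 : ℝ≥0∞) ^ n * I ≤ 2 ^ n * ENNReal.ofReal (Real.exp (1 / 2)) := by
    calc (2 : ℝ≥0∞) ^ n * I = ∑ e : Fin n → ℤˣ, I := by
          simp [Finset.card_univ]
      _ = ∑ e : Fin n → ℤˣ, ∫⁻ ω, ENNReal.ofReal (Real.cosh (∑ k, ((e k : ℤ) : ℝ) *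
            (O ω : Matrix (Fin n) (Fin n) ℝ) k j)) ∂P := Finset.sum_congr rfl fun e _ => hsign e
      _ = ∫⁻ ω, ∑ e : Fin n → ℤˣ, ENNReal.ofReal (Real.cosh (∑ k, ((e k : ℤ) : ℝ) *
            (O ω : Matrix (Fin n) (Fin n) ℝ) k j)) ∂P :=
          (lintegral_finsetSum _ fun e _ => (Real.measurable_cosh.comp
            (Finset.measurable_fun_sum _ fun k _ => measurable_const.mul (hOk k))).ennreal_ofReal).symm
      _ ≤ ∫⁻ _, ENNReal.ofReal (2 ^ n * Real.exp (1 / 2)) ∂P := by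
          refine lintegral_mono fun ω => ?_
          rw [← ENNReal.ofReal_sum_of_nonneg fun e _ => (Real.cosh_pos _).le]
          exact ENNReal.ofReal_le_ofReal (sum_cosh_sign_sum_le _ (hcol ω))
      _ = 2 ^ n * ENNReal.ofReal (Real.exp (1 / 2)) := by
          rw [lintegral_const, measure_univ, mul_one, ENNReal.ofReal_mul (by positivity),
            ENNReal.ofReal_pow (by norm_num), ENNReal.ofReal_ofNat]
  exact (ENNReal.mul_le_mul_iff_right (by simp) (by simp)).mp hmul

/-- Markov's inequality for cosh, with cosh y ≥ exp(|y|)/2. -/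
theorem measure_entry_lt_le {P : Measure Ω} (hn : 0 < n) [IsProbabilityMeasure P]
    {O : Ω → Matrix.orthogonalGroup (Fin n) ℝ} (hO : Measurable O)
    (hinv : (P.map O).IsMulLeftInvariant) (i j : Fin n) (t : ℝ) :
    P {ω | t < √n * |(O ω : Matrix (Fin n) (Fin n) ℝ) i j|} ≤
      ENNReal.ofReal (2 * Real.exp (1 / 2) / Real.exp t) := by
  have hm : Measurable fun ω =>
      ENNReal.ofReal (Real.cosh (√n * (O ω : Matrix (Fin n) (Fin n) ℝ) i j)) :=
    (Real.measurable_cosh.comp (measurable_const.mul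
      ((measurable_subtype_coe.comp hO).matrix_entry i j))).ennreal_ofReal
  have hpos : 0 < Real.exp t / 2 := by positivity
  calc P {ω | t < √n * |(O ω : Matrix (Fin n) (Fin n) ℝ) i j|}
      ≤ P {ω | ENNReal.ofReal (Real.exp t / 2) ≤
          ENNReal.ofReal (Real.cosh (√n * (O ω : Matrix (Fin n) (Fin n) ℝ) i j))} := by
        refine measure_mono fun ω hω => ENNReal.ofReal_le_ofReal ?_
        have hω' : t < √n * |(O ω : Matrix (Fin n) (Fin n) ℝ) i j| := hω
        rw [← Real.cosh_abs, abs_mul, abs_of_nonneg (Real.sqrt_nonneg _), Real.cosh_eq]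
        have := Real.exp_le_exp.mpr hω'.le
        have := Real.exp_pos (-(√n * |(O ω : Matrix (Fin n) (Fin n) ℝ) i j|))
        linarith
    _ ≤ _ / ENNReal.ofReal (Real.exp t / 2) :=
        meas_ge_le_lintegral_div hm.aemeasurable (by simpa using hpos) ENNReal.ofReal_ne_top
    _ ≤ ENNReal.ofReal (Real.exp (1 / 2)) / ENNReal.ofReal (Real.exp t / 2) := by
        gcongr
        exact lintegral_cosh_entry_le hn hO hinv i j
    _ = ENNReal.ofReal (2 * Real.exp (1 / 2) / Real.exp t) := by
        rw [← ENNReal.ofReal_div_of_pos hpos]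
        congr 1
        field_simp

/-- The entries of Haar distributed orthogonal matrices are delocalized. -/
theorem ae_eventually_abs_entry_le {P : Measure Ω} [IsProbabilityMeasure P]
    {O : (n : ℕ) → Ω → Matrix.orthogonalGroup (Fin n) ℝ} (hO : ∀ n, Measurable (O n))
    (hinv : ∀ n, (P.map (O n)).IsMulLeftInvariant) {ε : ℝ} (hε : 0 < ε) :
    ∀ᵐ ω ∂P, ∀ᶠ n : ℕ in atTop, ∀ i j : Fin n,
      |(O n ω : Matrix (Fin n) (Fin n) ℝ) i j| ≤ (n : ℝ) ^ (-1 / 2 + ε) := by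
  -- With m ≥ 4/ε, one term of the exponential series gives exp(n^ε) ≥ n^(εm)/m! ≥ n⁴/m!. The union
  -- bound over the n² entries then leaves the summable order n^(-2).
  obtain ⟨m, hm⟩ := exists_nat_ge (4 / ε)
  have hm' : 4 ≤ ε * m := by rwa [div_le_iff₀' hε] at hm
  set C : ℝ := 2 * Real.exp (1 / 2) * m.factorial with hC
  have hC0 : 0 ≤ C := by positivity
  have hbound : ∀ n : ℕ, P {ω | ∃ i j : Fin n,
      (n : ℝ) ^ (-1 / 2 + ε) < |(O n ω : Matrix (Fin n) (Fin n) ℝ) i j|} ≤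
      ENNReal.ofReal (C / (n : ℝ) ^ 2) := fun n => by
    rcases Nat.eq_zero_or_pos n with rfl | hn
    · simp
    have hn' : (0 : ℝ) < n := by exact_mod_cast hn
    have hn1 : (1 : ℝ) ≤ n := by exact_mod_cast hn
    have hentry : ∀ i j : Fin n, P {ω | (n : ℝ) ^ (-1 / 2 + ε) <
        |(O n ω : Matrix (Fin n) (Fin n) ℝ) i j|} ≤ ENNReal.ofReal (C / (n : ℝ) ^ 4) := by
      intro i j
      have hexp : (n : ℝ) ^ 4 ≤ m.factorial * Real.exp ((n : ℝ) ^ ε) := by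
        have h := Real.pow_div_factorial_le_exp ((n : ℝ) ^ ε) (by positivity) m
        rw [div_le_iff₀' (by positivity), ← Real.rpow_natCast, ← Real.rpow_mul hn'.le] at h
        refine le_trans ?_ h
        rw [← Real.rpow_natCast]
        exact Real.rpow_le_rpow_of_exponent_le hn1 (by exact_mod_cast hm')
      refine le_trans (measure_mono fun ω hω => ?_)
        ((measure_entry_lt_le hn (hO n) (hinv n) i j ((n : ℝ) ^ ε)).trans
          (ENNReal.ofReal_le_ofReal ?_))
      · have hω' : (n : ℝ) ^ (-1 / 2 + ε) < |(O n ω : Matrix (Fin n) (Fin n) ℝ) i j| := hω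
        have h1 : √(n : ℝ) * (n : ℝ) ^ (-1 / 2 + ε) = (n : ℝ) ^ ε := by
          rw [Real.sqrt_eq_rpow, ← Real.rpow_add hn']
          ring_nf
        change (n : ℝ) ^ ε < _
        rw [← h1]
        exact mul_lt_mul_of_pos_left hω' (Real.sqrt_pos.mpr hn')
      · rw [div_le_div_iff₀ (Real.exp_pos _) (by positivity), hC, mul_assoc (2 * _)]
        gcongr
    calc _ = P (⋃ i : Fin n, ⋃ j : Fin n, {ω | (n : ℝ) ^ (-1 / 2 + ε) <
          |(O n ω : Matrix (Fin n) (Fin n) ℝ) i j|}) := by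
          congr 1
          ext ω
          simp
      _ ≤ ∑ i : Fin n, ∑ j : Fin n, P {ω | (n : ℝ) ^ (-1 / 2 + ε) <
          |(O n ω : Matrix (Fin n) (Fin n) ℝ) i j|} :=
          (measure_iUnion_fintype_le _ _).trans
            (Finset.sum_le_sum fun i _ => measure_iUnion_fintype_le _ _)
      _ ≤ ∑ i : Fin n, ∑ j : Fin n, ENNReal.ofReal (C / (n : ℝ) ^ 4) :=
          Finset.sum_le_sum fun i _ => Finset.sum_le_sum fun j _ => hentry i j
      _ = ENNReal.ofReal (C / (n : ℝ) ^ 2) := by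
          simp only [Finset.sum_const, Finset.card_univ, Fintype.card_fin, nsmul_eq_mul]
          rw [← ENNReal.ofReal_natCast, ← ENNReal.ofReal_mul hn'.le, ← ENNReal.ofReal_mul hn'.le]
          congr 1
          field_simp
  have hsum : ∑' n : ℕ, P {ω | ∃ i j : Fin n,
      (n : ℝ) ^ (-1 / 2 + ε) < |(O n ω : Matrix (Fin n) (Fin n) ℝ) i j|} ≠ ∞ := by
    have hs : Summable fun n : ℕ => C / (n : ℝ) ^ 2 := by
      simpa [div_eq_mul_inv] using (Real.summable_nat_pow_inv.mpr one_lt_two).mul_left C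
    refine ne_top_of_le_ne_top ?_ (ENNReal.tsum_le_tsum hbound)
    rw [← ENNReal.ofReal_tsum_of_nonneg (fun n => by positivity) hs]
    exact ENNReal.ofReal_ne_top
  filter_upwards [ae_eventually_notMem hsum] with ω hω
  filter_upwards [hω] with n hn i j
  by_contra h
  exact hn ⟨i, j, not_le.mp h⟩

/-- The Haar matrix serves as its own `H`. By bi-invariance and independence of `d`, replacing `O`
by R O S leaves the joint law with `d` unchanged, and signed permutations only permute the absolute
values of the entries. All terms in the sum of `law` are therefore equal. -/
theorem IsOrthogonallyInvariant.exists_isConjMixture {P : Measure Ω} [IsProbabilityMeasure P]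
    {ν : Measure ℝ} {W : (n : ℕ) → Ω → Matrix (Fin n) (Fin n) ℝ}
    (hW : IsOrthogonallyInvariant P ν W) : ∃ d H, IsConjMixture P ν W d H := by
  obtain ⟨d, O, hWO, hd, hO, hHaar, hind⟩ := hW
  have hinv : ∀ n, (P.map (O n)).IsMulLeftInvariant := fun n => (hHaar n).toIsMulLeftInvariant
  have hOm : ∀ n, Measurable fun ω => (O n ω : Matrix (Fin n) (Fin n) ℝ) :=
    fun n => measurable_subtype_coe.comp (hO n)
  have hWn : ∀ n, W n = fun ω => (O n ω : Matrix (Fin n) (Fin n) ℝ) * Matrix.diagonal (d n ω) *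
      (O n ω : Matrix (Fin n) (Fin n) ℝ).transpose := fun n => funext fun ω => hWO n ω
  refine ⟨d, fun n ω => (O n ω : Matrix (Fin n) (Fin n) ℝ), ⟨fun n => ?_, hd, hOm,
    fun n ω => (O n ω).2, fun ε hε => ae_eventually_abs_entry_le hO hinv hε,
    fun n B G c hB hG => ?_⟩⟩
  · rw [hWn]
    exact (hOm n).conj_diagonal (hd.measurable n)
  have := Measure.isProbabilityMeasure_map (μ := P) (hO n).aemeasurable
  have hleft := hinv n
  have hright := isMulRightInvariant_of_isProbabilityMeasure (P.map (O n))
  let F : Matrix.orthogonalGroup (Fin n) ℝ × (Fin n → ℝ) → Matrix (Fin n) (Fin n) ℝ := fun z =>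
    (z.1 : Matrix (Fin n) (Fin n) ℝ) * Matrix.diagonal z.2 *
      (z.1 : Matrix (Fin n) (Fin n) ℝ).transpose
  let A : Set (Matrix.orthogonalGroup (Fin n) ℝ × (Fin n → ℝ)) :=
    {z | F z ∈ B ∧ z.2 ∈ G ∧ ∀ i j, |(z.1 : Matrix (Fin n) (Fin n) ℝ) i j| ≤ c}
  have hF : Measurable F :=
    (measurable_subtype_coe.comp measurable_fst).conj_diagonal measurable_snd
  have hA : MeasurableSet A :=
    (hF hB).inter ((measurable_snd hG).inter ((measurable_subtype_coe.comp measurable_fst)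
      (DiagonalTensorNetwork.measurableSet_bounds _ c fun _ => Iff.rfl)))
  have hlaw : ∀ R S : Matrix.orthogonalGroup (Fin n) ℝ,
      P {ω | (R * O n ω * S, d n ω) ∈ A} = P {ω | (O n ω, d n ω) ∈ A} := fun R S => by
    have hm : Measurable fun Q : Matrix.orthogonalGroup (Fin n) ℝ => R * Q * S :=
      (measurable_mul_const S).comp (measurable_const_mul R)
    have hmap : (P.map (O n)).map (fun Q => R * Q * S) = P.map (O n) := by
      have h := Measure.map_map (μ := P.map (O n)) (measurable_mul_const S)
        (measurable_const_mul R)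
      rw [map_mul_left_eq_self, map_mul_right_eq_self] at h
      exact h.symm
    have hm' : Measurable fun ω => R * O n ω * S := hm.comp (hO n)
    have hjoint : P.map (fun ω => (R * O n ω * S, d n ω)) = P.map fun ω => (O n ω, d n ω) := by
      rw [(indepFun_iff_map_prod_eq_prod_map_map hm'.aemeasurable
        (hd.measurable n).aemeasurable).mp ((hind n).comp hm measurable_id),
        (indepFun_iff_map_prod_eq_prod_map_map (hO n).aemeasurable
        (hd.measurable n).aemeasurable).mp (hind n)]
      congr 1
      exact (Measure.map_map hm (hO n)).symm.trans hmap
    have h : (P.map fun ω => (R * O n ω * S, d n ω)) A = _ := congrArg (fun ρ => ρ A) hjoint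
    rwa [Measure.map_apply (hm'.prodMk (hd.measurable n)) hA,
      Measure.map_apply ((hO n).prodMk (hd.measurable n)) hA] at h
  have hterm : ∀ s : SignedPerm n × SignedPerm n,
      P {ω | DiagonalTensorNetwork.conjMatrix (O n ω : Matrix (Fin n) (Fin n) ℝ) (d n ω) s.1 s.2 ∈ B ∧
          d n ω ∈ G ∧ ∀ i j, |(O n ω : Matrix (Fin n) (Fin n) ℝ) i j| ≤ c} =
        P {ω | (O n ω, d n ω) ∈ A} := fun s => by
    rw [← hlaw ⟨_, signedPermMatrix_mem_orthogonalGroup s.1⟩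
      ⟨_, signedPermMatrix_mem_orthogonalGroup s.2⟩]
    congr 1
    ext ω
    refine and_congr Iff.rfl (and_congr Iff.rfl ?_)
    have habs : ∀ u : ℤˣ, |((u : ℤ) : ℝ)| = 1 := fun u => by
      rcases Int.units_eq_one_or u with h | h <;> simp [h]
    have hent : ∀ i j, |(signedPermMatrix s.1.1 s.1.2 * (O n ω : Matrix (Fin n) (Fin n) ℝ) *
        signedPermMatrix s.2.1 s.2.2) i j| =
        |(O n ω : Matrix (Fin n) (Fin n) ℝ) (s.1.1 i) (s.2.1.symm j)| := fun i j => by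
      rw [mul_signedPermMatrix_apply, signedPermMatrix_mul_apply, abs_mul, abs_mul, habs, habs,
        one_mul, mul_one]
    change _ ↔ ∀ i j, |(signedPermMatrix s.1.1 s.1.2 * (O n ω : Matrix (Fin n) (Fin n) ℝ) *
        signedPermMatrix s.2.1 s.2.2) i j| ≤ c
    simp only [hent]
    refine ⟨fun h i j => h _ _, fun h i j => ?_⟩
    simpa using h (s.1.1.symm i) (s.2.1 j)
  simp only [hterm, Finset.sum_const, Finset.card_univ, Fintype.card_prod, nsmul_eq_mul]
  rw [hWn]
  push_cast
  rw [sq]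
  rfl

end Haar

theorem lemma2p7 {V : Type*} [Fintype V] {k : ℕ} (T : DiagonalTensorNetwork V k) :
    ∃ limVal : Measure (EuclideanSpace ℝ (Fin k)) → Measure ℝ → ℝ,
      ∀ (μ : Measure (EuclideanSpace ℝ (Fin k))) (ν : Measure ℝ)
        [IsProbabilityMeasure μ] [IsProbabilityMeasure ν], FiniteMoments μ →
      ∀ (Ω : Type*) [MeasurableSpace Ω] (P : Measure Ω) [IsProbabilityMeasure P]
        (x : (n : ℕ) → Ω → Fin n → EuclideanSpace ℝ (Fin k)),
        (∀ n, Measurable (x n)) →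
        (∀ᵐ ω ∂P, TendstoW (fun n => x n ω) μ) →
        (∀ W : (n : ℕ) → Ω → Matrix (Fin n) (Fin n) ℝ,
          IsSymmGeneralizedInvariant P ν W → (∀ n, IndepFun (W n) (x n) P) →
          ∀ᵐ ω ∂P, Tendsto (fun n => T.val (W n ω) (x n ω)) atTop (𝓝 (limVal μ ν))) ∧
        (∀ G : (n : ℕ) → Ω → Matrix (Fin n) (Fin n) ℝ,
          IsOrthogonallyInvariant P ν G → (∀ n, IndepFun (G n) (x n) P) →
          ∀ᵐ ω ∂P, Tendsto (fun n => T.val (G n ω) (x n ω)) atTop (𝓝 (limVal μ ν))) := by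
  obtain ⟨κ, hκ⟩ := T.exists_card_bad_le
  -- The coefficients `κ` depend only on `T`, and the laws enter through the moments of the labels
  -- and of the spectrum, so both models share this limit.
  refine ⟨fun μ ν => T.momentSum κ (T.limitMoments μ ν),
    fun μ ν _ _ _ Ω _ P _ x hx hxμ => ⟨fun W hW hind => ?_, fun G hG hind => ?_⟩⟩
  · obtain ⟨d, H, h⟩ := hW.exists_isConjMixture
    exact T.tendsto_val_of_isConjMixture hκ hx hxμ h hind
  · obtain ⟨d, H, h⟩ := hG.exists_isConjMixture
    exact T.tendsto_val_of_isConjMixture hκ hx hxμ h hind
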